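/- Let $M$ be a real $C^\infty$ manifold of dimension $n$ (Hausdorff, second countable); vector fields, tensor fields, frames, coordinates and maps are $C^\infty$. A derivation along vector fields $D$ of the tensor algebra over $M$ assigns to every vector field $X$ a derivation $D_X$ of the tensor algebra (an $\mathbb R$-linear, type-preserving map obeying the Leibniz rule and commuting with contractions) with $D_Xf=X(f)$ on functions; the dependence of $D_X$ on $X$ is otherwise arbitrary. $D$ is a linear connection if $D_{fX+Y}=fD_X+D_Y$ for all functions $f$ and vector fields $X,Y$. In a frame $(e_i)$ the component matrix $W_X$ is defined by $D_Xe_j=\sum_i(W_X)^i{}_j\,e_i$. $D$ is linear at $p$ if in some frame around $p$ one has $W_X(p)=\sum_k X^k(p)\Gamma_k$ for all $X=\sum_kX^ke_k$, with matrices $\Gamma_k$ independent of $X$; it is linear on $S\subseteq M$ if it is linear at each point of $S$. A frame over an open set containing $S$ is normal for $D$ on $S$ if $W_X=0$ on $S$ for all $X$; coordinates are normal on $S$ if their coordinate frame is. The torsion and curvature are $T(X,Y)=D_XY-D_YX-[X,Y]$ and $R(X,Y)Z=D_XD_YZ-D_YD_XZ-D_{[X,Y]}Z$; torsionless (flat)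 on $S$ means $T(X,Y)=0$ ($R(X,Y)Z=0$) on $S$ for all vector fields $X,Y$ (and $Z$). $D$ is called flat along an immersion $\gamma:N\to M$ if $R(X,Y)Z=0$ at $\gamma(q)$ for every $q\in N$ and all vector fields $X,Y,Z$ on $M$ such that $X_{\gamma(q')}$ and $Y_{\gamma(q')}$ are tangent to $\gamma$ (lie in the image of $d\gamma_{q'}$) for all $q'$ near $q$. Then the following hold. 1. (Necessity of linearity.) If $D$ admits a frame normal on $S$, then $D$ is linear on $S$, and at each point of $S$ its components have the above linear form in every frame. 2. (Transition equations.) Let $e$ and $e'$, $e'_j=\sum_iA^i{}_je_i$, be frames over an open set containing $S$. Then $e'$ is normal on $S$ iff $X(A)+W_XA=0$ on $S$ for all $X$, where $W_X$ are the components in $e$. If $e$ is normal on $S$, then $e'$ is normal on $S$ iff $dA=0$ at every point of $S$. 3. (Reduction to linear connections.) $D$ is linear on $S$ iff there is a linear connection $\nabla$ on $M$ with $D_XY=\nabla_XY$ on $S$ for all vector fields $X,Y$; for every such $\nabla$ and every $S'\subseteq S$, a frame is normal on $S'$ for $D$ iff it is normal on $S'$ for $\nabla$. 4. (Point.) A frame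 normal at $p$ exists iff $D$ is linear at $p$. Coordinates normal at $p$ exist iff $D$ is linear and torsionless at $p$. 5. (Path.) Let $J\subseteq\mathbb R$ be an interval and $\gamma$ a regular path on $J$ ($C^\infty$ on an open set containing $J$, with $\dot\gamma\neq0$ on $J$; such a path is locally injective). Every $s\in J$ has an open neighborhood $O\subseteq\mathbb R$ with a frame (resp. coordinates) normal on $\gamma(J\cap O)$ iff $D$ is linear (resp. linear and torsionless) on $\gamma(J)$. If $\gamma|_J$ is a homeomorphism onto its image, a frame normal on all of $\gamma(J)$ exists iff $D$ is linear on $\gamma(J)$. 6. (Neighborhoods.) Let $U\subseteq M$ be open. Every point of $U$ has an open neighborhood $V\subseteq U$ with a frame (resp. coordinates) normal on $V$ iff $D$ is linear and flat (resp. linear, flat and torsionless) on $U$. 7. (Submanifolds and mappings.) Let $\gamma:N\to M$ be an immersion of a manifold $N$ without boundary. Every $q\in N$ has an open neighborhood $O$ with a frame (resp. coordinates) normal on $\gamma(O)$ iff $D$ is linear on $\gamma(N)$ and flat along $\gamma$ (resp. and, in addition, torsionless on $\gamma(N)$). If $\gamma$ is an embedding, the same conditions are necessary and sufficient for every point of the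 submanifold $\gamma(N)$ to have an open neighborhood $V$ in $M$ with a frame (resp. coordinates) normal on $\gamma(N)\cap V$. -/

import Mathlib

open Set Filter Topology Module
open scoped Manifold ContDiff

noncomputable section

namespace NormalFrames

/-! ### Mixed tensors on a finite-dimensional vector space -/

section LinearAlgebra

variable (V : Type*) [AddCommGroup V] [Module ℝ V]

/-- Tensors of type `(r, s)` (`r` times contravariant, `s` times covariant) on `V`: real-valued
multilinear maps of `r` covectors and `s` vectors. -/
abbrev Tensor (r s : ℕ) : Type _ :=
  MultilinearMap ℝ (fun _ : Fin r => Dual ℝ V) (MultilinearMap ℝ (fun _ : Fin s => V) ℝ)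

variable {V}

/-- A vector regarded as a tensor of type `(1, 0)`: `α ↦ α v`. -/
def vecTensor (v : V) : Tensor V 1 0 where
  toFun α := MultilinearMap.constOfIsEmpty ℝ _ (α 0 v)
  map_update_add' := by
    intro _ m i x y
    ext
    fin_cases i
    simp
  map_update_smul' := by
    intro _ m i c x
    ext
    fin_cases i
    simp

theorem update_comp_castAdd {A : Type*} {m n : ℕ} [DecidableEq (Fin (m + n))]
    (f : Fin (m + n) → A) (i : Fin m) (x : A) :
    (fun k => Function.update f (Fin.castAdd n i) x (Fin.castAdd n k)) =
      Function.update (fun k => f (Fin.castAdd n k)) i x := by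
  funext k
  by_cases h : k = i
  · subst h; simp
  · have h' : Fin.castAdd n k ≠ Fin.castAdd n i := fun e => h (Fin.castAdd_injective m n e)
    simp [h, h']

theorem update_comp_natAdd {A : Type*} {m n : ℕ} [DecidableEq (Fin (m + n))]
    (f : Fin (m + n) → A) (i : Fin n) (x : A) :
    (fun k => Function.update f (Fin.natAdd m i) x (Fin.natAdd m k)) =
      Function.update (fun k => f (Fin.natAdd m k)) i x := by
  funext k
  by_cases h : k = i
  · subst h; simp
  · have h' : Fin.natAdd m k ≠ Fin.natAdd m i := fun e => h (Fin.natAdd_injective n m e)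
    simp [h, h']

theorem update_castAdd_comp_natAdd {A : Type*} {m n : ℕ} [DecidableEq (Fin (m + n))]
    (f : Fin (m + n) → A) (i : Fin m) (x : A) :
    (fun k => Function.update f (Fin.castAdd n i) x (Fin.natAdd m k)) =
      fun k => f (Fin.natAdd m k) := by
  funext k
  have h : Fin.natAdd m k ≠ Fin.castAdd n i := by
    intro e
    have := congrArg Fin.val e
    simp at this
    omega
  simp [h]

theorem update_natAdd_comp_castAdd {A : Type*} {m n : ℕ} [DecidableEq (Fin (m + n))]
    (f : Fin (m + n) → A) (i : Fin n) (x : A) :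
    (fun k => Function.update f (Fin.natAdd m i) x (Fin.castAdd n k)) =
      fun k => f (Fin.castAdd n k) := by
  funext k
  have h : Fin.castAdd n k ≠ Fin.natAdd m i := by
    intro e
    have := congrArg Fin.val e
    simp at this
    omega
  simp [h]

/-- The tensor product of mixed tensors. -/
def tensorMul {r s r' s' : ℕ} (S : Tensor V r s) (T : Tensor V r' s') :
    Tensor V (r + r') (s + s') where
  toFun α :=
    { toFun := fun v =>
        S (fun i => α (Fin.castAdd r' i)) (fun j => v (Fin.castAdd s' j)) *
          T (fun i => α (Fin.natAdd r i)) (fun j => v (Fin.natAdd s j))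
      map_update_add' := by
        intro _ v j x y
        refine Fin.addCases (fun j => ?_) (fun j => ?_) j
        · simp only [update_comp_castAdd, update_castAdd_comp_natAdd,
            MultilinearMap.map_update_add, add_mul]
        · simp only [update_comp_natAdd, update_natAdd_comp_castAdd,
            MultilinearMap.map_update_add, mul_add]
      map_update_smul' := by
        intro _ v j c x
        refine Fin.addCases (fun j => ?_) (fun j => ?_) j
        · simp only [update_comp_castAdd, update_castAdd_comp_natAdd,
            MultilinearMap.map_update_smul, smul_eq_mul, mul_assoc]
        · simp only [update_comp_natAdd, update_natAdd_comp_castAdd,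
            MultilinearMap.map_update_smul, smul_eq_mul, mul_left_comm] }
  map_update_add' := by
    intro _ α i x y
    ext v
    refine Fin.addCases (fun i => ?_) (fun i => ?_) i
    · simp [update_comp_castAdd, update_castAdd_comp_natAdd, add_mul]
    · simp [update_comp_natAdd, update_natAdd_comp_castAdd, mul_add]
  map_update_smul' := by
    intro _ α i c x
    ext v
    refine Fin.addCases (fun i => ?_) (fun i => ?_) i
    · simp [update_comp_castAdd, update_castAdd_comp_natAdd, mul_assoc]
    · simp [update_comp_natAdd, update_natAdd_comp_castAdd, mul_left_comm]

theorem insertNth_update_const {A : Type*} {n : ℕ} [DecidableEq (Fin n)]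
    [DecidableEq (Fin (n + 1))] (p : Fin (n + 1)) (z : A) (i : Fin n) (y : A) (f : Fin n → A) :
    (p.insertNth z (Function.update f i y) : Fin (n + 1) → A) =
      Function.update (p.insertNth z f : Fin (n + 1) → A) (p.succAbove i) y := by
  have h := Fin.insertNth_update (α := fun _ => A) p z i y f
  convert h

/-- The contraction of the `a`-th contravariant with the `b`-th covariant index:
insert a basis of `V` and its dual basis and sum. -/
def contract [FiniteDimensional ℝ V] {r s : ℕ} (a : Fin (r + 1)) (b : Fin (s + 1))
    (T : Tensor V (r + 1) (s + 1)) : Tensor V r s where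
  toFun α :=
    { toFun := fun v => ∑ k, T (a.insertNth ((finBasis ℝ V).coord k) α)
          (b.insertNth (finBasis ℝ V k) v)
      map_update_add' := by
        intro _ v j x y
        simp only [insertNth_update_const, ← Finset.sum_add_distrib]
        refine Finset.sum_congr rfl fun k _ => ?_
        convert MultilinearMap.map_update_add (T (a.insertNth ((finBasis ℝ V).coord k) α))
          (b.insertNth (finBasis ℝ V k) v) (b.succAbove j) x y
      map_update_smul' := by
        intro _ v j c x
        simp only [insertNth_update_const, Finset.smul_sum]
        refine Finset.sum_congr rfl fun k _ => ?_
        convert MultilinearMap.map_update_smul (T (a.insertNth ((finBasis ℝ V).coord k) α))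
          (b.insertNth (finBasis ℝ V k) v) (b.succAbove j) c x }
  map_update_add' := by
    intro _ α i x y
    ext v
    simp only [insertNth_update_const, MultilinearMap.coe_mk, add_apply,
      ← Finset.sum_add_distrib]
    refine Finset.sum_congr rfl fun k _ => ?_
    rw [← add_apply]
    congr 1
    convert MultilinearMap.map_update_add T
      (a.insertNth ((finBasis ℝ V).coord k) α) (a.succAbove i) x y
  map_update_smul' := by
    intro _ α i c x
    ext v
    simp only [insertNth_update_const, MultilinearMap.coe_mk, smul_apply,
      Finset.smul_sum]
    refine Finset.sum_congr rfl fun k _ => ?_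
    rw [← smul_apply]
    congr 1
    convert MultilinearMap.map_update_smul T
      (a.insertNth ((finBasis ℝ V).coord k) α) (a.succAbove i) c x

end LinearAlgebra

/-! ### Tensor fields and derivations -/

variable (E : Type*) [NormedAddCommGroup E] [NormedSpace ℝ E]
  (M : Type*) [TopologicalSpace M] [ChartedSpace E M] [IsManifold 𝓘(ℝ, E) ∞ M]

/-- Smooth vector fields on `M`. -/
abbrev VF : Type _ :=
  ContMDiffSection 𝓘(ℝ, E) E ∞ (fun p : M => TangentSpace 𝓘(ℝ, E) p)

/-- Smooth covector fields: pairing with every smooth vector field gives a smooth function. -/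
def CovectorField : Submodule ℝ ((p : M) → Dual ℝ (TangentSpace 𝓘(ℝ, E) p)) where
  carrier := {α | ∀ X : VF E M, ContMDiff 𝓘(ℝ, E) 𝓘(ℝ, ℝ) ∞ fun p => α p (X p)}
  add_mem' hα hη X := (hα X).add (hη X)
  zero_mem' _ := contMDiff_const
  smul_mem' _ _ hα X := contMDiff_const.mul (hα X)

/-- Smooth tensor fields of type `(r, s)`: the evaluation on smooth covector fields and smooth
vector fields is smooth. -/
def TensorField (r s : ℕ) : Submodule ℝ ((p : M) → Tensor (TangentSpace 𝓘(ℝ, E) p) r s) where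
  carrier := {T | ∀ (α : Fin r → CovectorField E M) (X : Fin s → VF E M),
    ContMDiff 𝓘(ℝ, E) 𝓘(ℝ, ℝ) ∞ fun p => T p (fun i => (α i).1 p) (fun j => X j p)}
  add_mem' hS hT α X := (hS α X).add (hT α X)
  zero_mem' _ _ := contMDiff_const
  smul_mem' _ _ hT α X := contMDiff_const.mul (hT α X)

variable {E M}

/-- The tensor product of tensor fields. -/
def tfMul {r s r' s' : ℕ} (S : TensorField E M r s) (T : TensorField E M r' s') :
    TensorField E M (r + r') (s + s') :=
  ⟨fun p => tensorMul (S.1 p) (T.1 p), fun α X =>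
    (S.2 (fun i => α (Fin.castAdd r' i)) (fun j => X (Fin.castAdd s' j))).mul
      (T.2 (fun i => α (Fin.natAdd r i)) (fun j => X (Fin.natAdd s j)))⟩

/-- A vector field as a tensor field of type `(1, 0)`. -/
def vfTensor (Y : VF E M) : TensorField E M 1 0 :=
  ⟨fun p => vecTensor (Y p), fun α _ => (α 0).2 Y⟩

variable [FiniteDimensional ℝ E]

instance (p : M) : FiniteDimensional ℝ (TangentSpace 𝓘(ℝ, E) p) :=
  inferInstanceAs (FiniteDimensional ℝ E)

/-- The derivative `X f` of a function in the direction of a vector field, at `p`. -/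
def dirDeriv (X : VF E M) (f : M → ℝ) (p : M) : ℝ :=
  mfderiv 𝓘(ℝ, E) 𝓘(ℝ, ℝ) f p (X p)

variable (E M)

/-- Derivations of the tensor algebra over `M`: type-preserving `ℝ`-linear maps that satisfy the
Leibniz rule for tensor products and commute with all contractions. -/
structure TensorDerivation where
  toFun : (r s : ℕ) → TensorField E M r s →ₗ[ℝ] TensorField E M r s
  leibniz : ∀ {r s r' s' : ℕ} (S : TensorField E M r s) (T : TensorField E M r' s'),
    toFun (r + r') (s + s') (tfMul S T) = tfMul (toFun r s S) T + tfMul S (toFun r' s' T)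
  comm_contract : ∀ {r s : ℕ} (a : Fin (r + 1)) (b : Fin (s + 1))
    (T : TensorField E M (r + 1) (s + 1)) (U : TensorField E M r s),
    (∀ p, U.1 p = contract a b (T.1 p)) →
      ∀ p, (toFun r s U).1 p = contract a b ((toFun (r + 1) (s + 1) T).1 p)

/-- A derivation along vector fields of the tensor algebra over `M`: to every vector field `X` a
derivation `D_X` with `D_X f = X f` on functions is assigned; equivalently `D_X = L_X + S_X` with
`L_X` the Lie derivative and `S_X` a tensor field of type `(1, 1)`. How `S_X` depends on `X` is
completely arbitrary. -/
structure DerivationAlongVF where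
  der : VF E M → TensorDerivation E M
  der_fun : ∀ (X : VF E M) (f : TensorField E M 0 0) (p : M),
    ((der X).toFun 0 0 f).1 p ![] ![] = dirDeriv X (fun q => f.1 q ![] ![]) p

variable {E M}

/-- The commutator of smooth vector fields. -/
def bracket (X Y : VF E M) : VF E M where
  toFun := VectorField.mlieBracket 𝓘(ℝ, E) X Y
  contMDiff_toFun := by
    have : CompleteSpace E := FiniteDimensional.complete ℝ E
    intro p
    have : IsManifold 𝓘(ℝ, E) (minSmoothness ℝ 2) M :=
      IsManifold.of_le (n := ∞)
        (by simpa [minSmoothness_of_isRCLikeNormedField] using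
          (WithTop.coe_le_coe.2 (le_top : (2 : ℕ∞) ≤ ⊤)))
    have : IsManifold 𝓘(ℝ, E) (((⊤ : ℕ∞) : WithTop ℕ∞) + 1) M := by
      simpa using (inferInstance : IsManifold 𝓘(ℝ, E) ∞ M)
    exact ContMDiffAt.mlieBracket_vectorField (n := (⊤ : ℕ∞)) (m := (⊤ : ℕ∞)) (X.contMDiff p)
      (Y.contMDiff p)
      (by simp [minSmoothness_of_isRCLikeNormedField])

namespace DerivationAlongVF

variable (D : DerivationAlongVF E M)

/-- `D_X Y` for vector fields `X`, `Y`, as a tensor field of type `(1, 0)`. -/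
def act (X Y : VF E M) : TensorField E M 1 0 := (D.der X).toFun 1 0 (vfTensor Y)

/-- The torsion `T(X, Y) = D_X Y - D_Y X - [X, Y]`. -/
def torsion (X Y : VF E M) (p : M) : Tensor (TangentSpace 𝓘(ℝ, E) p) 1 0 :=
  (D.act X Y).1 p - (D.act Y X).1 p - vecTensor (bracket X Y p)

/-- The curvature `R(X, Y) = D_X ∘ D_Y - D_Y ∘ D_X - D_{[X, Y]}`, applied to a vector field. -/
def curvature (X Y Z : VF E M) (p : M) : Tensor (TangentSpace 𝓘(ℝ, E) p) 1 0 :=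
  ((D.der X).toFun 1 0 (D.act Y Z)).1 p - ((D.der Y).toFun 1 0 (D.act X Z)).1 p -
    (D.act (bracket X Y) Z).1 p

/-- `D` is a linear connection: `D_X` is linear in `X` over the smooth functions. -/
def IsLinearConnection : Prop :=
  ∀ (f : M → ℝ), ContMDiff 𝓘(ℝ, E) 𝓘(ℝ, ℝ) ∞ f → ∀ X Y Z : VF E M,
    (∀ p, Z p = f p • X p + Y p) → ∀ (r s : ℕ) (T : TensorField E M r s) (p : M),
      ((D.der Z).toFun r s T).1 p = f p • ((D.der X).toFun r s T).1 p + ((D.der Y).toFun r s T).1 p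

end DerivationAlongVF

/-! ### Frames, components, linearity, normality -/

/-- The index set of frames, with `dim M` elements. -/
abbrev Idx (E : Type*) [NormedAddCommGroup E] [NormedSpace ℝ E] : Type := Fin (finrank ℝ E)

/-- `e` is a smooth frame over the open set `V`. The values of `e` off `V` are irrelevant. -/
def IsFrame (e : Idx E → (p : M) → TangentSpace 𝓘(ℝ, E) p) (V : Set M) : Prop :=
  IsOpen V ∧ IsLocalFrameOn 𝓘(ℝ, E) E ∞ e V

namespace DerivationAlongVF

variable (D : DerivationAlongVF E M)

/-- `W` is the matrix of components of `D_X` at `p` in the frame `e` defined around `p`: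
`D_X e_j = ∑ i, W i j • e_i` at `p`. As `D_X` is a local operator, `D_X e_j` at `p` is `D_X Y` at
`p` for any global field `Y` that agrees with `e_j` near `p`. -/
def HasComponents (e : Idx E → (p : M) → TangentSpace 𝓘(ℝ, E) p) (X : VF E M) (p : M)
    (W : Matrix (Idx E) (Idx E) ℝ) : Prop :=
  ∀ (j : Idx E) (Y : VF E M), (∀ᶠ q in 𝓝 p, Y q = e j q) →
    (D.act X Y).1 p = vecTensor (∑ i, W i j • e i p)

/-- In the frame `e`, the components of `D_X` at `p` have the form `∑ k, X^k(p) • Γ_k` with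
matrices `Γ_k` (the coefficients of `D` at `p`) that do not depend on `X`. -/
def LinearInFrameAt (e : Idx E → (p : M) → TangentSpace 𝓘(ℝ, E) p) (p : M) : Prop :=
  ∃ Γ : Idx E → Matrix (Idx E) (Idx E) ℝ, ∀ (X : VF E M) (c : Idx E → ℝ),
    X p = ∑ k, c k • e k p → D.HasComponents e X p (∑ k, c k • Γ k)

/-- `D` is linear at `p`: its components are linear in `X(p)` in some frame around `p`. -/
def LinearAt (p : M) : Prop :=
  ∃ (V : Set M) (e : Idx E → (p : M) → TangentSpace 𝓘(ℝ, E) p),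
    p ∈ V ∧ IsFrame e V ∧ D.LinearInFrameAt e p

/-- `D` is linear on the set `S`. -/
def LinearOn (S : Set M) : Prop := ∀ p ∈ S, D.LinearAt p

/-- `D` is torsionless on the set `S`. -/
def TorsionlessOn (S : Set M) : Prop :=
  ∀ p ∈ S, ∀ X Y : VF E M, D.torsion X Y p = 0

/-- The curvature of `D` vanishes on the set `S`. -/
def FlatOn (S : Set M) : Prop :=
  ∀ p ∈ S, ∀ X Y Z : VF E M, D.curvature X Y Z p = 0

/-- The frame `e` is normal for `D` on `S`: the components of `D_X` in it vanish on `S` for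
every vector field `X`. -/
def NormalOn (e : Idx E → (p : M) → TangentSpace 𝓘(ℝ, E) p) (S : Set M) : Prop :=
  ∀ p ∈ S, ∀ X : VF E M, D.HasComponents e X p 0

/-- There is a frame over an open set containing `S` that is normal for `D` on `S`. -/
def HasNormalFrame (S : Set M) : Prop :=
  ∃ (V : Set M) (e : Idx E → (p : M) → TangentSpace 𝓘(ℝ, E) p),
    S ⊆ V ∧ IsFrame e V ∧ D.NormalOn e S

/-- `D` and `D'` act in the same way on vector fields at the points of `S`. -/
def AgreeOn (D' : DerivationAlongVF E M) (S : Set M) : Prop :=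
  ∀ p ∈ S, ∀ X Y : VF E M, (D.act X Y).1 p = (D'.act X Y).1 p

end DerivationAlongVF

/-- The coordinate frame of a chart `φ`, in the coordinates on `E` given by a fixed basis. -/
def coordFrame (φ : OpenPartialHomeomorph M E) (j : Idx E) (p : M) : TangentSpace 𝓘(ℝ, E) p :=
  (mfderiv 𝓘(ℝ, E) 𝓘(ℝ, E) φ p).inverse (finBasis ℝ E j : E)

namespace DerivationAlongVF

variable (D : DerivationAlongVF E M)

/-- There are local coordinates on an open set containing `S` that are normal for `D` on `S`,
i.e. whose coordinate frame is normal for `D` on `S`. -/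
def HasNormalCoords (S : Set M) : Prop :=
  ∃ φ ∈ IsManifold.maximalAtlas 𝓘(ℝ, E) ∞ M, S ⊆ φ.source ∧ D.NormalOn (coordFrame φ) S

/-- The curvature of `D` vanishes along the map `γ : N → M`: `R(X, Y) Z = 0` at `γ q` whenever
`X` and `Y` are tangent to `γ` near `q`. -/
def FlatAlong {F : Type*} [NormedAddCommGroup F] [NormedSpace ℝ F] {N : Type*}
    [TopologicalSpace N] [ChartedSpace F N] (γ : N → M) : Prop :=
  ∀ (q : N) (X Y Z : VF E M),
    (∀ᶠ q' in 𝓝 q, ∃ v, mfderiv 𝓘(ℝ, F) 𝓘(ℝ, E) γ q' v = X (γ q')) →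
    (∀ᶠ q' in 𝓝 q, ∃ v, mfderiv 𝓘(ℝ, F) 𝓘(ℝ, E) γ q' v = Y (γ q')) →
      D.curvature X Y Z (γ q) = 0

end DerivationAlongVF

/-- `γ : N → M` is a smooth immersion. -/
def IsSmoothImmersion {F : Type*} [NormedAddCommGroup F] [NormedSpace ℝ F] {N : Type*}
    [TopologicalSpace N] [ChartedSpace F N] (γ : N → M) : Prop :=
  ContMDiff 𝓘(ℝ, F) 𝓘(ℝ, E) ∞ γ ∧
    ∀ q, Function.Injective (mfderiv 𝓘(ℝ, F) 𝓘(ℝ, E) γ q)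

/-- `γ` is a smooth regular path on the interval `J` (any kind of interval): it is smooth on an
open set containing `J` and its velocity vanishes nowhere on `J`. -/
def IsRegularPath (γ : ℝ → M) (J : Set ℝ) : Prop :=
  J.OrdConnected ∧ (∃ O : Set ℝ, IsOpen O ∧ J ⊆ O ∧ ContMDiffOn 𝓘(ℝ, ℝ) 𝓘(ℝ, E) ∞ γ O) ∧
    ∀ s ∈ J, mfderiv 𝓘(ℝ, ℝ) 𝓘(ℝ, E) γ s ≠ 0

end NormalFrames

end

/-! Everything depends on `D` only through the operators Y ↦ D_X Y on vector fields (`cov`). The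
Leibniz rule makes them local in Y (`cov_congr`) and gives their expansion in a frame (`cov_frame`).
Linearity at p becomes a statement without frames: D_X Y at p is a linear function of X(p)
(`PointLinear`).

In a chart there is a smooth matrix-valued form Γ such that D_X Y = X(Y) + Γ(X)Y at every point near
the centre where `D` is linear (`exists_connectionForm`). A frame with matrix B is normal at such a
point iff dB = -ΓB there. Vanishing torsion is the symmetry of Γ. Vanishing curvature in directions
tangent to a slice is dη + η ∧ η = 0 for the restriction η of Γ to the slice.

Necessity: in a normal frame D_X merely differentiates components. Linearity is then clear, the
curvature in tangent directions becomes XY - YX - [X, Y] acting on functions, and in normal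
coordinates the torsion vanishes by the coordinate formula of the bracket.

Sufficiency: an immersion is linear in suitable coordinates (`exists_slice_chart`). On the slice dA
= -ηA is solved by parallel transport along rays, and flatness makes the result a solution in all
directions (`exists_parallel_of_flat`). The solution extends off the slice so that the equation for
B holds at the slice points (`exists_first_order_parallel`). For coordinates, A⁻¹ restricted to the
slice is closed when Γ is symmetric in tangent directions, and a second-order Taylor polynomial
transverse to the slice yields a change of coordinates with D²ψ = Dψ·Γ wherever Γ is fully symmetric
(`exists_normal_change`). All this is collected in `exists_normal_along`, and points, paths, open
sets and immersions are its cases with a source of dimension 0, 1, dim M or arbitrary. In dimension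
at most 1 flatness of η is automatic, so no condition on curvature appears.

The reduction to linear connections replaces D_X by ∑ αᵢ(X) D_{Xᵢ}, where ∑ αᵢ ⊗ Xᵢ is a locally
finite decomposition of the identity of TM (`DualSystem`). A frame along a whole embedded path comes
from parallel fields along the path. These are determined by one value and exist locally with every
value, so they exist on the whole interval (`exists_section_of_locally_rigid`). A partition of unity
extends them to a neighborhood without spoiling normality, because ∑ dρ = 0. -/

noncomputable section

namespace NormalFrames

/-! ### Tangent vectors and sections in a chart -/

section Charts

variable {E : Type*} [NormedAddCommGroup E] [NormedSpace ℝ E]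
  {M : Type*} [TopologicalSpace M] [ChartedSpace E M]

/-- The differential of a chart, read as an endomorphism of the model space. -/
def chartDeriv (φ : OpenPartialHomeomorph M E) (p : M) : E →L[ℝ] E :=
  mfderiv 𝓘(ℝ, E) 𝓘(ℝ, E) φ p

/-- The inverse of the differential of a chart. -/
def chartDerivInv (φ : OpenPartialHomeomorph M E) (p : M) : E →L[ℝ] E :=
  (chartDeriv φ p).inverse

/-- The coordinate representation of a section of the tangent bundle in a chart. -/
def chartRep (φ : OpenPartialHomeomorph M E) (s : (p : M) → TangentSpace 𝓘(ℝ, E) p) (p : M) : E :=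
  chartDeriv φ p (s p)

variable {φ : OpenPartialHomeomorph M E}
  (hφ : φ ∈ IsManifold.maximalAtlas 𝓘(ℝ, E) ∞ M)
include hφ

theorem mdifferentiable_of_mem_maximalAtlas : φ.MDifferentiable 𝓘(ℝ, E) 𝓘(ℝ, E) :=
  ⟨(contMDiffOn_of_mem_maximalAtlas hφ).mdifferentiableOn (by simp),
    (contMDiffOn_symm_of_mem_maximalAtlas hφ).mdifferentiableOn (by simp)⟩

theorem isInvertible_chartDeriv {p : M} (hp : p ∈ φ.source) : (chartDeriv φ p).IsInvertible :=
  ⟨(mdifferentiable_of_mem_maximalAtlas hφ).mfderiv hp, rfl⟩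

theorem chartDeriv_chartDerivInv {p : M} (hp : p ∈ φ.source) (w : E) :
    chartDeriv φ p (chartDerivInv φ p w) = w :=
  (isInvertible_chartDeriv hφ hp).self_apply_inverse w

theorem chartDerivInv_chartDeriv {p : M} (hp : p ∈ φ.source) (w : E) :
    chartDerivInv φ p (chartDeriv φ p w) = w :=
  (isInvertible_chartDeriv hφ hp).inverse_apply_self w

theorem chartDerivInv_eq_of_rightInverse {p : M} (hp : p ∈ φ.source) {g : E →L[ℝ] E}
    (hg : ∀ w, chartDeriv φ p (g w) = w) : chartDerivInv φ p = g := by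
  ext w
  conv_lhs => rw [← hg w, chartDerivInv_chartDeriv hφ hp]

/-- Expresses the inverse through the smooth map `φ.symm`, so that fields given by their coordinates
are seen to be smooth. -/
theorem chartDerivInv_eq {p : M} (hp : p ∈ φ.source) :
    chartDerivInv φ p = (mfderiv 𝓘(ℝ, E) 𝓘(ℝ, E) φ.symm (φ p) : E →L[ℝ] E) := by
  refine chartDerivInv_eq_of_rightInverse hφ hp fun w => ?_
  have := (mdifferentiable_of_mem_maximalAtlas hφ).comp_symm_deriv (φ.map_source hp)
  rw [φ.left_inv hp] at this
  exact DFunLike.congr_fun this w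

variable [IsManifold 𝓘(ℝ, E) ∞ M]

/-- The tangent map of `φ` is smooth, and on the trivial bundle `TangentBundle 𝓘(ℝ, E) E` so is the
projection to the fibre component. -/
theorem contMDiffAt_chartRep {s : (p : M) → TangentSpace 𝓘(ℝ, E) p} {p : M} (hp : p ∈ φ.source)
    (hs : ContMDiffAt 𝓘(ℝ, E) (𝓘(ℝ, E).prod 𝓘(ℝ, E)) ∞
      (fun q => (⟨q, s q⟩ : TangentBundle 𝓘(ℝ, E) M)) p) :
    ContMDiffAt 𝓘(ℝ, E) 𝓘(ℝ, E) ∞ (chartRep φ s) p := by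
  have : IsManifold 𝓘(ℝ, E) 1 M := IsManifold.of_le (n := ∞) (by simp)
  have h1 := (contMDiffOn_of_mem_maximalAtlas hφ).contMDiffOn_tangentMapWithin (m := ∞)
    (by simp) φ.open_source.uniqueMDiffOn
  have h2 : ContMDiffAt 𝓘(ℝ, E) (𝓘(ℝ, E).prod 𝓘(ℝ, E)) ∞
      (fun q => tangentMapWithin 𝓘(ℝ, E) 𝓘(ℝ, E) φ φ.source ⟨q, s q⟩) p := by
    refine ContMDiffAt.comp p ((h1 ⟨p, s p⟩ hp).contMDiffAt ?_) hs
    exact (φ.open_source.preimage (FiberBundle.continuous_proj E _)).mem_nhds hp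
  have h3 := (contMDiff_snd_tangentBundle_modelSpace E 𝓘(ℝ, E) (n := ∞)).contMDiffAt.comp p h2
  refine h3.congr_of_eventuallyEq ?_
  filter_upwards [φ.open_source.mem_nhds hp] with q hq
  simp only [Function.comp, tangentMapWithin, mfderivWithin_of_isOpen φ.open_source hq]
  rfl

theorem contMDiffOn_chartDerivInv {f : M → E} {V : Set M} (hV : V ⊆ φ.source)
    (hf : ContMDiffOn 𝓘(ℝ, E) 𝓘(ℝ, E) ∞ f V) :
    ContMDiffOn 𝓘(ℝ, E) (𝓘(ℝ, E).prod 𝓘(ℝ, E)) ∞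
      (fun q => (⟨q, chartDerivInv φ q (f q)⟩ : TangentBundle 𝓘(ℝ, E) M)) V := by
  have : IsManifold 𝓘(ℝ, E) 1 M := IsManifold.of_le (n := ∞) (by simp)
  have h1 := (contMDiffOn_symm_of_mem_maximalAtlas hφ).contMDiffOn_tangentMapWithin (m := ∞)
    (by simp) φ.open_target.uniqueMDiffOn
  have h0 : ContMDiffOn 𝓘(ℝ, E) (𝓘(ℝ, E).prod 𝓘(ℝ, E)) ∞
      (fun q => (⟨φ q, f q⟩ : TangentBundle 𝓘(ℝ, E) E)) V := by
    have h := ((contMDiffOn_of_mem_maximalAtlas hφ).mono hV).prodMk hf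
    rw [chartedSpaceSelf_prod] at h
    exact (contMDiff_tangentBundleModelSpaceHomeomorph_symm (I := 𝓘(ℝ, E))
      (n := ∞)).comp_contMDiffOn h
  have h2 := h1.comp h0 (fun q hq => φ.map_source (hV hq))
  refine h2.congr fun q hq => ?_
  have hq' := φ.map_source (hV hq)
  simp only [Function.comp, tangentMapWithin, mfderivWithin_of_isOpen φ.open_target hq']
  rw [chartDerivInv_eq hφ (hV hq)]
  congr 1
  · exact (φ.left_inv (hV hq)).symm

end Charts

/-! ### Global extensions of germs -/

section Extension

variable {E : Type*} [NormedAddCommGroup E] [NormedSpace ℝ E] [FiniteDimensional ℝ E]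
  {M : Type*} [TopologicalSpace M] [ChartedSpace E M] [IsManifold 𝓘(ℝ, E) ∞ M] [T2Space M]

variable (E) in
theorem exists_smooth_cutoff {p : M} {V : Set M} (hV : V ∈ 𝓝 p) :
    ∃ ρ : M → ℝ, ContMDiff 𝓘(ℝ, E) 𝓘(ℝ, ℝ) ∞ ρ ∧ tsupport ρ ⊆ V ∧ ∀ᶠ q in 𝓝 p, ρ q = 1 := by
  obtain ⟨f, hf, -⟩ := (SmoothBumpFunction.nhds_basis_support (I := 𝓘(ℝ, E)) hV).mem_iff.1
    (Filter.univ_mem : (univ : Set M) ∈ 𝓝 p)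
  exact ⟨f, f.contMDiff, hf, f.eventuallyEq_one⟩

/-- Frames are local objects while derivations act on global fields. A cutoff changes the section
away from p only, which a local operator does not notice at p. -/
theorem exists_vectorField_eventuallyEq {V : Set M} (hV : IsOpen V) {p : M} (hp : p ∈ V)
    {s : (p : M) → TangentSpace 𝓘(ℝ, E) p}
    (hs : ContMDiffOn 𝓘(ℝ, E) (𝓘(ℝ, E).prod 𝓘(ℝ, E)) ∞
      (fun q => (⟨q, s q⟩ : TangentBundle 𝓘(ℝ, E) M)) V) :
    ∃ X : VF E M, ∀ᶠ q in 𝓝 p, X q = s q := by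
  obtain ⟨ρ, hρ, hρV, h1⟩ := exists_smooth_cutoff E (hV.mem_nhds hp)
  refine ⟨⟨ρ • s, hρ.contMDiffOn.smul_section_of_tsupport hV hρV hs⟩, ?_⟩
  filter_upwards [h1] with q hq
  simp [hq]

theorem exists_vectorField_chart {φ : OpenPartialHomeomorph M E}
    (hφ : φ ∈ IsManifold.maximalAtlas 𝓘(ℝ, E) ∞ M) {V : Set M} (hV : IsOpen V)
    (hVφ : V ⊆ φ.source) {p : M} (hp : p ∈ V) {f : M → E}
    (hf : ContMDiffOn 𝓘(ℝ, E) 𝓘(ℝ, E) ∞ f V) :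
    ∃ X : VF E M, ∀ᶠ q in 𝓝 p, X q = chartDerivInv φ q (f q) :=
  exists_vectorField_eventuallyEq hV hp (contMDiffOn_chartDerivInv hφ hVφ hf)

theorem exists_vectorField_apply (p : M) (v : TangentSpace 𝓘(ℝ, E) p) :
    ∃ X : VF E M, X p = v := by
  have hφ := IsManifold.chart_mem_maximalAtlas (I := 𝓘(ℝ, E)) (n := ∞) p
  obtain ⟨X, hX⟩ := exists_vectorField_chart hφ (chartAt E p).open_source subset_rfl
    (mem_chart_source E p) (contMDiffOn_const (c := chartDeriv (chartAt E p) p v))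
  exact ⟨X, hX.self_of_nhds.trans (chartDerivInv_chartDeriv hφ (mem_chart_source E p) v)⟩

theorem exists_smooth_eventuallyEq {V : Set M} (hV : IsOpen V) {p : M} (hp : p ∈ V)
    {G : Type*} [NormedAddCommGroup G] [NormedSpace ℝ G] {f : M → G}
    (hf : ContMDiffOn 𝓘(ℝ, E) 𝓘(ℝ, G) ∞ f V) :
    ∃ g : M → G, ContMDiff 𝓘(ℝ, E) 𝓘(ℝ, G) ∞ g ∧ ∀ᶠ q in 𝓝 p, g q = f q := by
  obtain ⟨ρ, hρ, hρV, h1⟩ := exists_smooth_cutoff E (hV.mem_nhds hp)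
  refine ⟨fun q => ρ q • f q, ?_, ?_⟩
  · refine contMDiff_of_tsupport fun x hx => ?_
    have hx : x ∈ V := hρV (tsupport_smul_subset_left ρ f hx)
    exact hρ.contMDiffAt.smul (hf.contMDiffAt (hV.mem_nhds hx))
  · filter_upwards [h1] with q hq
    simp [hq]

end Extension

/-! ### Tensors of type (1, 0) are vectors -/

section VectorTensor

variable {V : Type*} [AddCommGroup V] [Module ℝ V]

theorem vecTensor_add (v w : V) : vecTensor (v + w) = vecTensor v + vecTensor w := by
  ext α x
  exact map_add (α 0) v w

theorem vecTensor_sub (v w : V) : vecTensor (v - w) = vecTensor v - vecTensor w := by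
  ext α x
  exact map_sub (α 0) v w

theorem vecTensor_smul (c : ℝ) (v : V) : vecTensor (c • v) = c • vecTensor v := by
  ext α x
  exact map_smul (α 0) c v

theorem vecTensor_zero : vecTensor (0 : V) = 0 := by
  ext α x
  exact map_zero (α 0)

/-- The evaluation of a tensor of type `(1, 0)` on covectors, as an element of the double dual. -/
def tensorDual (T : Tensor V 1 0) : Dual ℝ (Dual ℝ V) where
  toFun α := T (fun _ => α) ![]
  map_add' α β := by
    have := T.map_update_add (fun _ => α) 0 α β
    simp only [Function.update_eq_const_of_subsingleton] at this
    exact congrArg (fun S => S ![]) this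
  map_smul' c α := by
    have := T.map_update_smul (fun _ => α) 0 c α
    simp only [Function.update_eq_const_of_subsingleton] at this
    exact congrArg (fun S => S ![]) this

variable [FiniteDimensional ℝ V]

/-- The vector that corresponds to a tensor of type `(1, 0)`. -/
def tensorVec (T : Tensor V 1 0) : V := (evalEquiv ℝ V).symm (tensorDual T)

theorem apply_tensorVec (T : Tensor V 1 0) (α : Dual ℝ V) :
    α (tensorVec T) = T (fun _ => α) ![] :=
  apply_evalEquiv_symm_apply ℝ V α (tensorDual T)

/-- Reflexivity of a finite-dimensional space. -/
theorem vecTensor_tensorVec (T : Tensor V 1 0) : vecTensor (tensorVec T) = T := by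
  ext α v
  obtain rfl : v = ![] := Subsingleton.elim _ _
  have : (fun _ => α 0) = α := by ext i; rw [Subsingleton.elim i 0]
  exact (apply_tensorVec T (α 0)).trans (by rw [this])

theorem tensorVec_vecTensor (v : V) : tensorVec (vecTensor v) = v := by
  refine (Module.eval_apply_injective ℝ) ?_
  ext α
  exact apply_tensorVec _ α

theorem vecTensor_injective : Function.Injective (vecTensor : V → Tensor V 1 0) :=
  Function.LeftInverse.injective tensorVec_vecTensor

end VectorTensor

/-! ### Tensor fields of type (1, 0) are vector fields -/

section FieldOfTensor

variable {E : Type*} [NormedAddCommGroup E] [NormedSpace ℝ E] [FiniteDimensional ℝ E]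
  {M : Type*} [TopologicalSpace M] [ChartedSpace E M] [IsManifold 𝓘(ℝ, E) ∞ M] [T2Space M]

/-- A coordinate covector field, cut off by a smooth function supported in the chart. -/
def cutoffCovector {φ : OpenPartialHomeomorph M E}
    (hφ : φ ∈ IsManifold.maximalAtlas 𝓘(ℝ, E) ∞ M) {ρ : M → ℝ}
    (hρ : ContMDiff 𝓘(ℝ, E) 𝓘(ℝ, ℝ) ∞ ρ) (hρφ : tsupport ρ ⊆ φ.source) (l : E →L[ℝ] ℝ) :
    CovectorField E M :=
  ⟨fun p => (ρ p • l.comp (chartDeriv φ p) : E →L[ℝ] ℝ).toLinearMap, fun X => by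
    refine contMDiff_of_tsupport fun x hx => ?_
    have hx : x ∈ φ.source :=
      hρφ (tsupport_smul_subset_left ρ (fun p => l (chartDeriv φ p (X p))) hx)
    exact hρ.contMDiffAt.smul
      (l.contMDiff.contMDiffAt.comp x (contMDiffAt_chartRep hφ hx X.contMDiff.contMDiffAt))⟩

/-- The vector field that corresponds to a tensor field of type `(1, 0)`. -/
def fieldOfTensor (T : TensorField E M 1 0) : VF E M where
  toFun p := tensorVec (T.1 p)
  contMDiff_toFun := by
    intro p
    have hφ := IsManifold.chart_mem_maximalAtlas (I := 𝓘(ℝ, E)) (n := ∞) p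
    set φ := chartAt E p
    have hp : p ∈ φ.source := mem_chart_source E p
    obtain ⟨ρ, hρ, hρφ, h1⟩ := exists_smooth_cutoff E (φ.open_source.mem_nhds hp)
    obtain ⟨V, hV, hVo, hpV⟩ := eventually_nhds_iff.1 h1
    have hc : ContMDiffOn 𝓘(ℝ, E) 𝓘(ℝ, E) ∞
        (chartRep φ fun q => tensorVec (T.1 q)) (V ∩ φ.source) := by
      -- Smoothness of a tensor field is known only through its evaluations on global covector
      -- fields. Where ρ = 1, the coordinates of the vector field are the evaluations on the cut-off
      -- coordinate covectors.
      let b := finBasis ℝ E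
      have : ContMDiffOn 𝓘(ℝ, E) 𝓘(ℝ, E) ∞ (fun q => ∑ j,
          T.1 q (fun _ => (cutoffCovector hφ hρ hρφ (b.coord j).toContinuousLinearMap).1 q) ![] • b j)
          (V ∩ φ.source) := by
        refine contMDiffOn_finsetSum fun j _ => ?_
        have h := T.2 (fun _ => cutoffCovector hφ hρ hρφ (b.coord j).toContinuousLinearMap) ![]
        refine (h.contMDiffOn.congr fun q _ => ?_).smul
          (contMDiffOn_const : ContMDiffOn 𝓘(ℝ, E) 𝓘(ℝ, E) ∞ (fun _ => b j) _)
        congr 1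
        exact Subsingleton.elim _ _
      refine this.congr fun q hq => ?_
      conv_lhs => rw [← b.sum_repr (chartRep φ _ q)]
      refine Finset.sum_congr rfl fun j _ => ?_
      rw [← apply_tensorVec]
      have h := hV q hq.1
      simp only [cutoffCovector, h, one_smul]
      rfl
    have h2 := contMDiffOn_chartDerivInv hφ inter_subset_right hc
    have h3 : ContMDiffAt _ _ _ _ p :=
      h2.contMDiffAt ((hVo.inter φ.open_source).mem_nhds ⟨hpV, hp⟩)
    refine h3.congr_of_eventuallyEq ?_
    filter_upwards [φ.open_source.mem_nhds hp] with q hq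
    exact congrArg (fun v : E => (⟨q, v⟩ : TangentBundle 𝓘(ℝ, E) M))
      (chartDerivInv_chartDeriv hφ hq _).symm

theorem vfTensor_fieldOfTensor (T : TensorField E M 1 0) : vfTensor (fieldOfTensor T) = T :=
  Subtype.ext (funext fun p => vecTensor_tensorVec (T.1 p))

end FieldOfTensor

/-! ### Derivatives of vector-valued functions in a chart -/

section Derivative

variable {E : Type*} [NormedAddCommGroup E] [NormedSpace ℝ E]
  {M : Type*} [TopologicalSpace M] [ChartedSpace E M]
  {G : Type*} [NormedAddCommGroup G] [NormedSpace ℝ G]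

/-- The derivative of a vector-valued function along a tangent vector. -/
def vderiv (f : M → G) (p : M) : E →L[ℝ] G := mfderiv 𝓘(ℝ, E) 𝓘(ℝ, G) f p

theorem vderiv_congr {f g : M → G} {p : M} (h : ∀ᶠ q in 𝓝 p, f q = g q) :
    vderiv (E := E) f p = vderiv g p :=
  Filter.EventuallyEq.mfderiv_eq h

variable {φ : OpenPartialHomeomorph M E} (hφ : φ ∈ IsManifold.maximalAtlas 𝓘(ℝ, E) ∞ M)
include hφ

theorem vderiv_eq_fderiv {g : M → G} {p : M} (hp : p ∈ φ.source)
    (hg : ContMDiffAt 𝓘(ℝ, E) 𝓘(ℝ, G) ∞ g p) :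
    vderiv g p = (fderiv ℝ (g ∘ φ.symm) (φ p)).comp (chartDeriv φ p) := by
  have hx := φ.map_source hp
  have h1 : ContMDiffAt 𝓘(ℝ, E) 𝓘(ℝ, G) ∞ (g ∘ φ.symm) (φ p) :=
    ContMDiffAt.comp (φ p) (by rwa [φ.left_inv hp])
      (contMDiffAt_symm_of_mem_maximalAtlas hφ hx)
  have h2 := mfderiv_comp p (h1.mdifferentiableAt (by simp))
    ((contMDiffAt_of_mem_maximalAtlas hφ hp).mdifferentiableAt (by simp))
  rw [mfderiv_eq_fderiv] at h2
  rw [← vderiv_congr (f := (g ∘ φ.symm) ∘ φ)]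
  · exact h2
  · filter_upwards [φ.open_source.mem_nhds hp] with q hq
    simp [φ.left_inv hq]

theorem contDiffAt_comp_symm {g : M → G} {x : E} (hx : x ∈ φ.target)
    (hg : ContMDiffAt 𝓘(ℝ, E) 𝓘(ℝ, G) ∞ g (φ.symm x)) : ContDiffAt ℝ ∞ (g ∘ φ.symm) x :=
  (hg.comp x (contMDiffAt_symm_of_mem_maximalAtlas hφ hx)).contDiffAt

theorem contMDiffAt_comp_chart {h : E → G} {p : M} (hp : p ∈ φ.source)
    (hh : ContDiffAt ℝ ∞ h (φ p)) : ContMDiffAt 𝓘(ℝ, E) 𝓘(ℝ, G) ∞ (h ∘ φ) p :=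
  hh.contMDiffAt.comp p (contMDiffAt_of_mem_maximalAtlas hφ hp)

theorem vderiv_comp_chart {h : E → G} {p : M} (hp : p ∈ φ.source)
    (hh : DifferentiableAt ℝ h (φ p)) :
    vderiv (h ∘ φ) p = (fderiv ℝ h (φ p)).comp (chartDeriv φ p) := by
  have h2 := mfderiv_comp p hh.mdifferentiableAt
    ((contMDiffAt_of_mem_maximalAtlas hφ hp).mdifferentiableAt (by simp))
  rw [mfderiv_eq_fderiv] at h2
  exact h2

end Derivative

/-! ### The Lie bracket in coordinates -/

section Bracket

variable {E : Type*} [NormedAddCommGroup E] [NormedSpace ℝ E]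
  {M : Type*} [TopologicalSpace M] [ChartedSpace E M] [IsManifold 𝓘(ℝ, E) ∞ M]
  {G : Type*} [NormedAddCommGroup G] [NormedSpace ℝ G]

/-- The derivative `X f` of a vector-valued function in the direction of a vector field. -/
def along (X : VF E M) (f : M → G) (p : M) : G := vderiv (E := E) f p (X p)

theorem mlieBracket_eq_lieBracket (V W : (x : E) → TangentSpace 𝓘(ℝ, E) x) :
    VectorField.mlieBracket 𝓘(ℝ, E) V W = VectorField.lieBracket ℝ V W := by
  rw [← VectorField.mlieBracketWithin_univ, VectorField.mlieBracketWithin_eq_lieBracketWithin]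
  exact VectorField.lieBracketWithin_univ

theorem along_congr {X : VF E M} {f g : M → G} {p : M} (h : ∀ᶠ q in 𝓝 p, f q = g q) :
    along X f p = along X g p := by
  rw [along, vderiv_congr h, along]

variable {φ : OpenPartialHomeomorph M E} (hφ : φ ∈ IsManifold.maximalAtlas 𝓘(ℝ, E) ∞ M)

include hφ

theorem along_eq_fderiv (X : VF E M) {g : M → G} {p : M} (hp : p ∈ φ.source)
    (hg : ContMDiffAt 𝓘(ℝ, E) 𝓘(ℝ, G) ∞ g p) :
    along X g p = fderiv ℝ (g ∘ φ.symm) (φ p) (chartRep φ X p) := by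
  rw [along, vderiv_eq_fderiv hφ hp hg]
  rfl

theorem along_comp_chart (X : VF E M) {h : E → G} {p : M} (hp : p ∈ φ.source)
    (hh : DifferentiableAt ℝ h (φ p)) :
    along X (h ∘ φ) p = fderiv ℝ h (φ p) (chartRep φ X p) := by
  rw [along, vderiv_comp_chart hφ hp hh]
  rfl

theorem contMDiffAt_chartRep_field (X : VF E M) {p : M} (hp : p ∈ φ.source) :
    ContMDiffAt 𝓘(ℝ, E) 𝓘(ℝ, E) ∞ (chartRep φ X) p :=
  contMDiffAt_chartRep hφ hp X.contMDiff.contMDiffAt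

theorem contDiffAt_chartRep_symm (X : VF E M) {x : E} (hx : x ∈ φ.target) :
    ContDiffAt ℝ ∞ (chartRep φ X ∘ φ.symm) x :=
  contDiffAt_comp_symm hφ hx (contMDiffAt_chartRep_field hφ X (φ.map_target hx))

variable [FiniteDimensional ℝ E]

/-- The bracket is natural under pullback by `φ.symm`, and the pulled back fields are the coordinate
representations, so the formula of the model space applies. -/
theorem chartRep_bracket (X Y : VF E M) {p : M} (hp : p ∈ φ.source) :
    chartRep φ (bracket X Y) p =
      along X (chartRep φ Y) p - along Y (chartRep φ X) p := by
  have : CompleteSpace E := FiniteDimensional.complete ℝ E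
  have : IsManifold 𝓘(ℝ, E) (minSmoothness ℝ 2) M :=
    IsManifold.of_le (n := ∞)
      (by simpa [minSmoothness_of_isRCLikeNormedField] using
        (WithTop.coe_le_coe.2 (le_top : (2 : ℕ∞) ≤ ⊤)))
  have : IsManifold 𝓘(ℝ, E) (minSmoothness ℝ 2) E := inferInstance
  have hx := φ.map_source hp
  have hl := φ.left_inv hp
  have hrep : ∀ (Z : (p : M) → TangentSpace 𝓘(ℝ, E) p), ∀ x ∈ φ.target,
      VectorField.mpullback 𝓘(ℝ, E) 𝓘(ℝ, E) φ.symm Z x = (chartRep φ Z ∘ φ.symm) x := by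
    intro Z x hx
    have hs := φ.map_target hx
    have h1 := chartDerivInv_eq hφ hs
    rw [φ.right_inv hx] at h1
    have h2 : (chartDerivInv φ (φ.symm x)).inverse = chartDeriv φ (φ.symm x) :=
      ContinuousLinearMap.inverse_eq (chartDerivInv_chartDeriv hφ hs |> fun h => by ext w; exact h w)
        (by ext w; exact chartDeriv_chartDerivInv hφ hs w)
    rw [h1] at h2
    exact DFunLike.congr_fun h2 (Z (φ.symm x))
  have key := VectorField.mpullback_mlieBracket (I := 𝓘(ℝ, E)) (I' := 𝓘(ℝ, E)) (f := φ.symm)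
    (V := X) (W := Y) (x₀ := φ p) X.mdifferentiableAt Y.mdifferentiableAt
    (contMDiffAt_symm_of_mem_maximalAtlas hφ hx) (n := ∞)
      (by simpa [minSmoothness_of_isRCLikeNormedField] using
        (WithTop.coe_le_coe.2 (le_top : (2 : ℕ∞) ≤ ⊤)))
  have hev : ∀ Z : VF E M, VectorField.mpullback 𝓘(ℝ, E) 𝓘(ℝ, E) φ.symm Z =ᶠ[𝓝 (φ p)]
      (chartRep φ Z ∘ φ.symm) := fun Z => by
    filter_upwards [φ.open_target.mem_nhds hx] with x hx using hrep Z x hx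
  have key2 := (key.trans ((hev X).mlieBracket_vectorField_eq (hev Y))).trans
    (congrFun (mlieBracket_eq_lieBracket _ _) _)
  have h0 := (hrep (VectorField.mlieBracket 𝓘(ℝ, E) X Y) (φ p) hx).symm.trans key2
  simp only [Function.comp, hl] at h0
  rw [along_eq_fderiv hφ X hp (contMDiffAt_chartRep_field hφ Y hp),
    along_eq_fderiv hφ Y hp (contMDiffAt_chartRep_field hφ X hp)]
  refine h0.trans ?_
  simp only [VectorField.lieBracket, Function.comp, hl]
  rfl

/-- In the commutator of the two derivatives the second derivatives of f cancel by symmetry. What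
remains is Df applied to the coordinate form of the bracket. -/
theorem along_bracket (X Y : VF E M) {p : M} (hp : p ∈ φ.source) {f : M → G} {V : Set M}
    (hV : V ∈ 𝓝 p) (hf : ContMDiffOn 𝓘(ℝ, E) 𝓘(ℝ, G) ∞ f V) :
    along (bracket X Y) f p = along X (along Y f) p - along Y (along X f) p := by
  have hx := φ.map_source hp
  have hl := φ.left_inv hp
  have hfp : ∀ᶠ q in 𝓝 p, ContMDiffAt 𝓘(ℝ, E) 𝓘(ℝ, G) ∞ f q := by
    filter_upwards [eventually_mem_nhds_iff.2 hV] with q hq using hf.contMDiffAt hq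
  have hF : ContDiffAt ℝ ∞ (f ∘ φ.symm) (φ p) :=
    contDiffAt_comp_symm hφ hx (by rw [hl]; exact hfp.self_of_nhds)
  have hF' : DifferentiableAt ℝ (fderiv ℝ (f ∘ φ.symm)) (φ p) :=
    (hF.fderiv_right (m := 1) (by exact WithTop.coe_le_coe.2 le_top)).differentiableAt (by simp)
  have hd : ∀ Z : VF E M, DifferentiableAt ℝ (chartRep φ Z ∘ φ.symm) (φ p) := fun Z =>
    (contDiffAt_chartRep_symm hφ Z hx).differentiableAt (by simp)
  have hrw : ∀ Z : VF E M, ∀ᶠ q in 𝓝 p, along Z f q =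
      ((fun x => fderiv ℝ (f ∘ φ.symm) x ((chartRep φ Z ∘ φ.symm) x)) ∘ φ) q := by
    intro Z
    filter_upwards [φ.open_source.mem_nhds hp, hfp] with q hq hfq
    rw [along_eq_fderiv hφ Z hq hfq]
    simp [Function.comp, φ.left_inv hq]
  have hdd : ∀ Z W : VF E M, along W (along Z f) p =
      fderiv ℝ (fderiv ℝ (f ∘ φ.symm)) (φ p) (chartRep φ W p) (chartRep φ Z p) +
        fderiv ℝ (f ∘ φ.symm) (φ p) (fderiv ℝ (chartRep φ Z ∘ φ.symm) (φ p) (chartRep φ W p)) := by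
    intro Z W
    rw [along_congr (hrw Z), along_comp_chart hφ W hp (hF'.clm_apply (hd Z)),
      fderiv_clm_apply hF' (hd Z)]
    simp only [ContinuousLinearMap.comp_apply, add_apply,
      ContinuousLinearMap.flip_apply, Function.comp, hl]
    rw [add_comm]
  have hb := chartRep_bracket hφ X Y hp
  rw [along_eq_fderiv hφ X hp (contMDiffAt_chartRep_field hφ Y hp),
    along_eq_fderiv hφ Y hp (contMDiffAt_chartRep_field hφ X hp)] at hb
  have hs := (hF.isSymmSndFDerivAt (by
    simpa [minSmoothness_of_isRCLikeNormedField] using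
      (WithTop.coe_le_coe.2 (le_top : (2 : ℕ∞) ≤ ⊤)))).eq
    (chartRep φ X p) (chartRep φ Y p)
  rw [hdd, hdd, along_eq_fderiv hφ _ hp hfp.self_of_nhds, hb, hs, add_sub_add_left_eq_sub,
    ← map_sub]

end Bracket

/-! ### The operators D_X on vector fields -/

section Cov

variable {E : Type*} [NormedAddCommGroup E] [NormedSpace ℝ E]
  {M : Type*} [TopologicalSpace M] [ChartedSpace E M] [IsManifold 𝓘(ℝ, E) ∞ M]

/-- The product of a smooth function and a vector field. -/
def smulField (f : M → ℝ) (hf : ContMDiff 𝓘(ℝ, E) 𝓘(ℝ, ℝ) ∞ f) (Y : VF E M) : VF E M :=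
  ⟨f • ⇑Y, hf.smul_section Y.contMDiff⟩

/-- A smooth function as a tensor field of type `(0, 0)`. -/
def funTensor (f : M → ℝ) (hf : ContMDiff 𝓘(ℝ, E) 𝓘(ℝ, ℝ) ∞ f) : TensorField E M 0 0 :=
  ⟨fun p => MultilinearMap.constOfIsEmpty ℝ _ (MultilinearMap.constOfIsEmpty ℝ _ (f p)),
    fun _ _ => hf⟩

theorem vfTensor_add (Y Z : VF E M) : vfTensor (Y + Z) = vfTensor Y + vfTensor Z :=
  Subtype.ext (funext fun p => vecTensor_add (Y p) (Z p))

theorem vfTensor_smul (c : ℝ) (Y : VF E M) : vfTensor (c • Y) = c • vfTensor Y :=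
  Subtype.ext (funext fun p => vecTensor_smul c (Y p))

/-- Makes the Leibniz rule for tensor products applicable to products of functions and vector
fields. -/
theorem tfMul_vfTensor_funTensor {f : M → ℝ} (hf : ContMDiff 𝓘(ℝ, E) 𝓘(ℝ, ℝ) ∞ f) (Y : VF E M) :
    (tfMul (vfTensor Y) (funTensor f hf) : TensorField E M 1 0) = vfTensor (smulField f hf Y) := by
  refine Subtype.ext (funext fun p => ?_)
  ext α v
  have : (α 0) (f p • Y p) = (α 0) (Y p) * f p := by rw [map_smul, smul_eq_mul, mul_comm]
  exact this.symm

namespace DerivationAlongVF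

variable [FiniteDimensional ℝ E] [T2Space M] (D : DerivationAlongVF E M)

/-- `D_X Y` as a vector field. -/
def cov (X Y : VF E M) : VF E M := fieldOfTensor (D.act X Y)

theorem vfTensor_cov (X Y : VF E M) : vfTensor (D.cov X Y) = D.act X Y :=
  vfTensor_fieldOfTensor _

theorem act_apply (X Y : VF E M) (p : M) : (D.act X Y).1 p = vecTensor (D.cov X Y p) := by
  rw [← vfTensor_cov]
  rfl

theorem act_eq_iff (X Y : VF E M) (p : M) (v : TangentSpace 𝓘(ℝ, E) p) :
    (D.act X Y).1 p = vecTensor v ↔ D.cov X Y p = v := by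
  rw [act_apply]
  exact vecTensor_injective.eq_iff

theorem cov_add (X Y Z : VF E M) : D.cov X (Y + Z) = D.cov X Y + D.cov X Z := by
  ext p
  refine (D.act_eq_iff X (Y + Z) p _).1 ?_
  rw [act, vfTensor_add, map_add]
  change (D.act X Y).1 p + (D.act X Z).1 p = _
  rw [act_apply, act_apply, ← vecTensor_add]
  rfl

theorem cov_const_smul (X : VF E M) (c : ℝ) (Y : VF E M) :
    D.cov X (c • Y) = c • D.cov X Y := by
  ext p
  refine (D.act_eq_iff X (c • Y) p _).1 ?_
  rw [act, vfTensor_smul, map_smul]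
  change c • (D.act X Y).1 p = _
  rw [act_apply, ← vecTensor_smul]
  rfl

theorem cov_smulField (X Y : VF E M) {f : M → ℝ} (hf : ContMDiff 𝓘(ℝ, E) 𝓘(ℝ, ℝ) ∞ f) (p : M) :
    D.cov X (smulField f hf Y) p = along X f p • Y p + f p • D.cov X Y p := by
  refine (D.act_eq_iff X _ p _).1 ?_
  have h := (D.der X).leibniz (vfTensor Y) (funTensor f hf)
  have h2 := congrFun (congrArg Subtype.val h) p
  rw [act, ← tfMul_vfTensor_funTensor]
  refine h2.trans ?_
  ext α v
  have hd := D.der_fun X (funTensor f hf) p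
  have ha : ((D.der X).toFun 1 0 (vfTensor Y)).1 p (fun i => α (Fin.castAdd 0 i)) ![] =
      α 0 (D.cov X Y p) := by
    have := D.act_apply X Y p
    rw [act] at this
    rw [this]
    rfl
  have hl : (((D.der X).toFun 1 0 (vfTensor Y)).1 p (fun i => α (Fin.castAdd 0 i)) ![]) * f p +
      α 0 (Y p) * (((D.der X).toFun 0 0 (funTensor f hf)).1 p ![] ![]) =
      α 0 (along X f p • Y p + f p • D.cov X Y p) := by
    rw [ha, hd, map_add, map_smul, map_smul, smul_eq_mul, smul_eq_mul, add_comm, mul_comm,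
      mul_comm _ (f p)]
    rfl
  refine Eq.trans ?_ hl
  change (_ : ℝ) * _ + (_ : ℝ) * _ = _
  congr 1
  · congr 1
    congr 1
    exact Subsingleton.elim _ _
  · congr 1
    congr 1
    · congr 1
      exact Subsingleton.elim _ _
    · exact Subsingleton.elim _ _

/-- The difference W of the fields vanishes on the support of a cutoff ρ that is 1 near p, so W = (1
- ρ)W. In the Leibniz rule for this product one term contains W(p) = 0, the other 1 - ρ(p) = 0. -/
theorem cov_congr (X : VF E M) {Y Z : VF E M} {p : M} (h : ∀ᶠ q in 𝓝 p, Y q = Z q) :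
    D.cov X Y p = D.cov X Z p := by
  obtain ⟨ρ, hρ, hρV, h1⟩ := exists_smooth_cutoff E h
  have hσ : ContMDiff 𝓘(ℝ, E) 𝓘(ℝ, ℝ) ∞ (fun q => 1 - ρ q) := contMDiff_const.sub hρ
  have hW : smulField _ hσ (Y - Z) = Y - Z := by
    ext q
    by_cases hq : q ∈ tsupport ρ
    · have : (Y - Z) q = 0 := by
        rw [ContMDiffSection.coe_sub, Pi.sub_apply, hρV hq, sub_self]
      change (1 - ρ q) • (Y - Z) q = (Y - Z) q
      rw [this, smul_zero]
    · change (1 - ρ q) • (Y - Z) q = (Y - Z) q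
      rw [image_eq_zero_of_notMem_tsupport hq, sub_zero, one_smul]
  have h0 : D.cov X (Y - Z) p = 0 := by
    have h2 := D.cov_smulField X (Y - Z) hσ p
    have h3 : (Y - Z) p = 0 := by
      rw [ContMDiffSection.coe_sub, Pi.sub_apply, h.self_of_nhds, sub_self]
    rw [hW, h3, h1.self_of_nhds, smul_zero, sub_self, zero_smul, add_zero] at h2
    exact h2
  have h4 : D.cov X Y = D.cov X (Y - Z) + D.cov X Z := by
    rw [← cov_add, sub_add_cancel]
  rw [h4, ContMDiffSection.coe_add, Pi.add_apply, h0, zero_add]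

theorem cov_sum {ι : Type*} (s : Finset ι) (X : VF E M) (Y : ι → VF E M) (p : M) :
    D.cov X (∑ j ∈ s, Y j) p = ∑ j ∈ s, D.cov X (Y j) p := by
  classical
  induction s using Finset.induction_on with
  | empty =>
    have h := D.cov_const_smul X 0 0
    rw [zero_smul, zero_smul] at h
    simp [h]
  | insert a s ha ih =>
    rw [Finset.sum_insert ha, Finset.sum_insert ha, cov_add, ContMDiffSection.coe_add,
      Pi.add_apply, ih]

/-- By locality the coefficients, smooth on `V` only, may be replaced by global functions with the
same germs at p. The fields `Z j` need not form a frame, which lets the formula serve for partitions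
of unity too. -/
theorem cov_expand {ι : Type*} [Fintype ι] (X Y : VF E M) (Z : ι → VF E M) (c : ι → M → ℝ)
    {V : Set M} (hV : IsOpen V) {p : M} (hp : p ∈ V)
    (hc : ∀ j, ContMDiffOn 𝓘(ℝ, E) 𝓘(ℝ, ℝ) ∞ (c j) V)
    (hY : ∀ᶠ q in 𝓝 p, Y q = ∑ j, c j q • Z j q) :
    D.cov X Y p = ∑ j, (along X (c j) p • Z j p + c j p • D.cov X (Z j) p) := by
  choose g hg hgc using fun j => exists_smooth_eventuallyEq hV hp (hc j)
  have h1 : D.cov X Y p = D.cov X (∑ j, smulField (g j) (hg j) (Z j)) p := by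
    refine D.cov_congr X ?_
    filter_upwards [hY, eventually_all.2 hgc] with q hq hgq
    rw [hq, ← ContMDiffSection.coeAddHom_apply, map_sum, Finset.sum_apply]
    refine Finset.sum_congr rfl fun j _ => ?_
    change _ = g j q • Z j q
    rw [hgq j]
  rw [h1, cov_sum]
  refine Finset.sum_congr rfl fun j _ => ?_
  rw [cov_smulField, along_congr (hgc j), (hgc j).self_of_nhds]

/-- At `p`, the operator `D_X` depends linearly on the value of `X` at `p`. -/
def PointLinear (p : M) : Prop :=
  ∀ Y : VF E M, ∃ l : E →ₗ[ℝ] E, ∀ X : VF E M, D.cov X Y p = l (X p)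

/-- Γ is assembled from the fields D_{C_k} C_j, where the C_k extend the coordinate fields, hence it
is smooth whether or not `D` is linear. Linearity enters only at the point p in question, to expand
D_X C_j in the components of X(p). Thus one smooth Γ serves an arbitrary set of points of linearity.
-/
theorem exists_connectionForm {φ : OpenPartialHomeomorph M E}
    (hφ : φ ∈ IsManifold.maximalAtlas 𝓘(ℝ, E) ∞ M) {p₀ : M} (hp₀ : p₀ ∈ φ.source) :
    ∃ (Γ : M → E →L[ℝ] E →L[ℝ] E) (V : Set M), IsOpen V ∧ p₀ ∈ V ∧ V ⊆ φ.source ∧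
      ContMDiffOn 𝓘(ℝ, E) 𝓘(ℝ, E →L[ℝ] E →L[ℝ] E) ∞ Γ V ∧
      ∀ p ∈ V, D.PointLinear p → ∀ X Y : VF E M, chartRep φ (D.cov X Y) p =
        along X (chartRep φ Y) p + Γ p (chartRep φ X p) (chartRep φ Y p) := by
  let b := finBasis ℝ E
  let β : Idx E → E →L[ℝ] ℝ := fun j => (b.coord j).toContinuousLinearMap
  have hβ : ∀ v : E, ∑ j, β j v • b j = v := fun v => b.sum_repr v
  choose C hC using fun j : Idx E => exists_vectorField_chart hφ φ.open_source subset_rfl hp₀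
    (contMDiffOn_const (c := b j))
  obtain ⟨V, hVC, hVo, hpV⟩ := eventually_nhds_iff.1
    ((eventually_all.2 hC).and (φ.open_source.mem_nhds hp₀))
  have hCd : ∀ q ∈ V, ∀ k, chartRep φ (C k) q = b k := fun q hq k => by
    have h := (hVC q hq).1 k
    rw [chartRep, h, chartDeriv_chartDerivInv hφ (hVC q hq).2]
  have hex : ∀ (Y : VF E M), ∀ q ∈ V, Y q = ∑ j, β j (chartRep φ Y q) • C j q := by
    intro Y q hq
    have hqs := (hVC q hq).2
    have h : chartDeriv φ q (Y q) = chartDeriv φ q (∑ j, β j (chartRep φ Y q) • C j q : E) := by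
      refine Eq.trans ?_ (map_sum (chartDeriv φ q) _ _).symm
      refine ((hβ _).symm).trans (Finset.sum_congr rfl fun j _ => ?_)
      refine Eq.trans ?_ (map_smul (chartDeriv φ q) _ _).symm
      exact congrArg _ (hCd q hq j).symm
    exact ((isInvertible_chartDeriv hφ hqs).injective h)
  -- `T k j z` is the bilinear map (v, w) ↦ β_k(v) β_j(w) z.
  let T : Idx E → Idx E → E →L[ℝ] E →L[ℝ] E →L[ℝ] E := fun k j =>
    (ContinuousLinearMap.smulRightL ℝ E (E →L[ℝ] E) (β k)).comp
      (ContinuousLinearMap.smulRightL ℝ E E (β j))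
  refine ⟨fun p => ∑ k, ∑ j, T k j (chartRep φ (D.cov (C k) (C j)) p), V, hVo, hpV,
    fun q hq => (hVC q hq).2, ?_, ?_⟩
  · refine contMDiffOn_finsetSum fun k _ => contMDiffOn_finsetSum fun j _ => ?_
    intro q hq
    have hT : ContDiff ℝ ∞ (fun x => T k j x) := by fun_prop
    exact (hT.contMDiff.contMDiffAt.comp q
      (contMDiffAt_chartRep_field hφ _ (hVC q hq).2)).contMDiffWithinAt
  · intro p hp hlin X Y
    have hps := (hVC p hp).2
    have hYd := contMDiffAt_chartRep_field hφ Y hps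
    have h1 := D.cov_expand X Y C (fun j q => β j (chartRep φ Y q)) hVo hp
      (fun j q hq => ((β j).contMDiff.contMDiffAt.comp q
        (contMDiffAt_chartRep_field hφ Y (hVC q hq).2)).contMDiffWithinAt)
      (by filter_upwards [hVo.mem_nhds hp] with q hq using hex Y q hq)
    have hal : ∀ j, along X (fun q => β j (chartRep φ Y q)) p = β j (along X (chartRep φ Y) p) := by
      intro j
      change along X (β j ∘ chartRep φ Y) p = _
      have hd : DifferentiableAt ℝ (chartRep φ Y ∘ φ.symm) (φ p) :=
        (contDiffAt_chartRep_symm hφ Y (φ.map_source hps)).differentiableAt (by simp)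
      rw [along_eq_fderiv hφ X hps ((β j).contMDiff.contMDiffAt.comp p hYd),
        along_eq_fderiv hφ X hps hYd]
      have := (β j).hasFDerivAt.comp (φ p) hd.hasFDerivAt
      exact DFunLike.congr_fun this.fderiv _
    have h2 : ∀ j, chartRep φ (D.cov X (C j)) p =
        ∑ k, β k (chartRep φ X p) • chartRep φ (D.cov (C k) (C j)) p := by
      intro j
      obtain ⟨l, hl⟩ := hlin (C j)
      have h3 : D.cov X (C j) p = ∑ k, β k (chartRep φ X p) • D.cov (C k) (C j) p := by
        rw [hl, hex X p hp]
        refine (map_sum l _ _).trans (Finset.sum_congr rfl fun k _ => ?_)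
        rw [hl]
        exact map_smul l _ _
      rw [chartRep, h3]
      refine (map_sum (chartDeriv φ p) _ _).trans (Finset.sum_congr rfl fun k _ => ?_)
      exact map_smul (chartDeriv φ p) _ _
    have h4 : chartRep φ (D.cov X Y) p = ∑ j, (β j (along X (chartRep φ Y) p) • b j +
        β j (chartRep φ Y p) • chartRep φ (D.cov X (C j)) p) := by
      rw [chartRep, h1]
      refine (map_sum (chartDeriv φ p) _ _).trans (Finset.sum_congr rfl fun j _ => ?_)
      refine (map_add (chartDeriv φ p) _ _).trans ?_
      congr 1
      · rw [hal, ← hCd p hp j]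
        exact map_smul (chartDeriv φ p) _ _
      · exact map_smul (chartDeriv φ p) _ _
    rw [h4, Finset.sum_add_distrib, hβ]
    congr 1
    simp only [h2, sum_apply, T, ContinuousLinearMap.comp_apply,
      ContinuousLinearMap.smulRightL_apply_apply, Finset.smul_sum]
    rw [Finset.sum_comm]
    refine Finset.sum_congr rfl fun k _ => Finset.sum_congr rfl fun j _ => ?_
    exact smul_comm _ _ _

end DerivationAlongVF

end Cov

/-! ### The equation dA = -ηA with flat coefficients -/

section FlatEquation

variable {F : Type*} [NormedAddCommGroup F] [NormedSpace ℝ F]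
  {𝒜 : Type*} [NormedRing 𝒜] [NormedAlgebra ℝ 𝒜]

theorem hasDerivWithinAt_Ici_of_Icc {G : Type*} [NormedAddCommGroup G] [NormedSpace ℝ G]
    {f : ℝ → G} {f' : G} {a b t : ℝ} (ht : t ∈ Ico a b) (h : HasDerivWithinAt f f' (Icc a b) t) :
    HasDerivWithinAt f f' (Ici t) t :=
  h.mono_of_mem_nhdsWithin (Icc_mem_nhdsGE_of_mem ht)

/-- Together with `exp_half_lt_two` this bounds by 2ε whatever grows from zero on the unit interval
at rate 1/2 with error ε. -/
theorem gronwallBound_zero_half_le {ε t : ℝ} (hε : 0 ≤ ε) (ht : t ≤ 1) :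
    gronwallBound 0 (1 / 2) ε t ≤ 2 * ε * (Real.exp (1 / 2) - 1) := by
  rw [gronwallBound_of_K_ne_0 (by norm_num)]
  have : Real.exp (1 / 2 * t) ≤ Real.exp (1 / 2) := Real.exp_le_exp.2 (by linarith)
  have h2 : ε / (1 / 2) = 2 * ε := by ring
  simp only [h2, zero_mul, zero_add]
  gcongr

theorem exp_half_lt_two : Real.exp (1 / 2) < 2 := by
  have h1 : Real.exp (1 / 2) * Real.exp (1 / 2) = Real.exp 1 := by
    rw [← Real.exp_add]; norm_num
  have h2 := Real.exp_one_lt_d9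
  nlinarith [Real.exp_pos (1 / 2)]

/-- On the ball of radius 1 about 1 the right-hand side has norm at most (1/2)·2 = 1, so
Picard–Lindelöf reaches time 1. The last bound is Grönwall's inequality for a - 1, whose derivative
has norm at most ‖a - 1‖/2 + 1/2; it makes a(t) invertible later. -/
theorem exists_radial_solution [CompleteSpace 𝒜] {c : ℝ → 𝒜} (hc : ContinuousOn c (Icc 0 1))
    (hb : ∀ t ∈ Icc (0 : ℝ) 1, ‖c t‖ ≤ 1 / 2) (h1 : ‖(1 : 𝒜)‖ ≤ 1) :
    ∃ a : ℝ → 𝒜, a 0 = 1 ∧ (∀ t ∈ Icc (0 : ℝ) 1, HasDerivWithinAt a (-(c t * a t)) (Icc 0 1) t) ∧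
      ∀ t ∈ Icc (0 : ℝ) 1, ‖a t - 1‖ < 1 := by
  -- The four constants are the radius of the ball, the radius of the set of initial values, the
  -- bound of the right-hand side and its Lipschitz constant.
  have hP : IsPicardLindelof (fun t x => -(c t * x)) (⟨0, by simp⟩ : Icc (0 : ℝ) 1) (1 : 𝒜)
      1 0 1 (1 / 2) := by
    refine ⟨fun t ht => ?_, fun x _ => (hc.mul continuousOn_const).neg, fun t ht x hx => ?_, ?_⟩
    · refine LipschitzWith.lipschitzOnWith (LipschitzWith.of_dist_le_mul fun x y => ?_)
      rw [dist_neg_neg, dist_eq_norm, dist_eq_norm, ← mul_sub]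
      refine (norm_mul_le _ _).trans ?_
      have := hb t ht
      simp only [NNReal.coe_div, NNReal.coe_one, NNReal.coe_ofNat]
      gcongr
    · have hx' : ‖x‖ ≤ 2 := by
        have h2 := norm_add_le (x - 1) 1
        rw [sub_add_cancel] at h2
        have h3 := mem_closedBall_iff_norm.1 hx
        simp only [NNReal.coe_one] at h3
        linarith
      rw [norm_neg]
      refine (norm_mul_le _ _).trans ?_
      calc ‖c t‖ * ‖x‖ ≤ 1 / 2 * 2 := by gcongr; exact hb t ht
        _ = ((1 : NNReal) : ℝ) := by norm_num
    · simp
  obtain ⟨a, ha0, ha⟩ := hP.exists_eq_forall_mem_Icc_hasDerivWithinAt₀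
  refine ⟨a, ha0, ha, fun t ht => ?_⟩
  have hg := norm_le_gronwallBound_of_norm_deriv_right_le (f := fun t => a t - 1)
    (f' := fun t => -(c t * a t)) (δ := 0) (K := 1 / 2) (ε := 1 / 2) (a := 0) (b := 1)
    (fun t ht => ((ha t ht).sub_const 1).continuousWithinAt)
    (fun t ht => hasDerivWithinAt_Ici_of_Icc ht ((ha t (Ico_subset_Icc_self ht)).sub_const 1))
    (by simp [ha0]) (fun t ht => ?_) t ht
  · refine hg.trans_lt ?_
    rw [sub_zero]
    refine (gronwallBound_zero_half_le (by norm_num) ht.2).trans_lt ?_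
    linarith [exp_half_lt_two]
  · rw [norm_neg]
    refine (norm_mul_le _ _).trans ?_
    have h2 := norm_add_le (a t - 1) 1
    rw [sub_add_cancel] at h2
    calc ‖c t‖ * ‖a t‖ ≤ 1 / 2 * (‖a t - 1‖ + 1) := by
          gcongr
          · exact hb t (Ico_subset_Icc_self ht)
          · linarith
      _ = _ := by ring

/-- The mean value inequality on the segment, where the derivative differs from its value at x by at
most K‖y - x‖. -/
theorem norm_sub_sub_le_of_lipschitzOn_fderiv {G : Type*} [NormedAddCommGroup G] [NormedSpace ℝ G]
    {f : F → G} {s : Set F} (hs : Convex ℝ s) (hso : IsOpen s) (hf : DifferentiableOn ℝ f s)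
    {K : NNReal} (hK : LipschitzOnWith K (fderiv ℝ f) s) {x y : F} (hx : x ∈ s) (hy : y ∈ s) :
    ‖f y - f x - fderiv ℝ f x (y - x)‖ ≤ K * ‖y - x‖ * ‖y - x‖ := by
  have hseg : segment ℝ x y ⊆ s := hs.segment_subset hx hy
  refine (convex_segment x y).norm_image_sub_le_of_norm_hasFDerivWithin_le'
    (f' := fderiv ℝ f) (fun z hz => ?_) (fun z hz => ?_) (left_mem_segment ℝ x y)
    (right_mem_segment ℝ x y)
  · exact ((hf z (hseg hz)).differentiableAt (hso.mem_nhds (hseg hz))).hasFDerivAt.hasFDerivWithinAt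
  · refine (hK.norm_sub_le (hseg hz) hx).trans ?_
    gcongr
    obtain ⟨θ, hθ, rfl⟩ := (segment_eq_image' ℝ x y) ▸ hz
    rw [add_sub_cancel_left, norm_smul, Real.norm_of_nonneg hθ.1]
    exact mul_le_of_le_one_left (norm_nonneg _) hθ.2

/-- The expected variation of the transport along the ray through u, when u moves by h, is -t
η(tu)(h) a₁(t). Flatness makes the error Q of this guess solve a linear equation with inhomogeneity
of order ‖h‖² and Q(0) = 0, and Grönwall's inequality gives the bound at t = 1. This identifies the
derivative of the endpoint map. -/
theorem radial_difference_le {η : F → F →L[ℝ] 𝒜} {s : Set F} (hs : Convex ℝ s) (hso : IsOpen s)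
    (h0 : (0 : F) ∈ s) (hη : DifferentiableOn ℝ η s) {K K' : NNReal} {C : ℝ}
    (hK' : LipschitzOnWith K' η s) (hK : LipschitzOnWith K (fderiv ℝ η) s)
    (hC : ∀ x ∈ s, ‖η x‖ ≤ C) (hdC : ∀ x ∈ s, ‖fderiv ℝ η x‖ ≤ C) (hs1 : ∀ x ∈ s, ‖x‖ ≤ 1)
    (hhalf : ∀ x ∈ s, ∀ y ∈ s, ‖η x y‖ ≤ 1 / 2)
    (hflat : ∀ x ∈ s, ∀ v w, fderiv ℝ η x v w - fderiv ℝ η x w v + η x v * η x w -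
      η x w * η x v = 0)
    {u h : F} (hu : u ∈ s) (huh : u + h ∈ s) {a₁ a₂ : ℝ → 𝒜}
    (h01 : a₁ 0 = 1) (h02 : a₂ 0 = 1) (hb : ∀ t ∈ Icc (0 : ℝ) 1, ‖a₁ t‖ ≤ 2)
    (h1 : ∀ t ∈ Icc (0 : ℝ) 1, HasDerivWithinAt a₁ (-(η (t • u) u * a₁ t)) (Icc 0 1) t)
    (h2 : ∀ t ∈ Icc (0 : ℝ) 1,
      HasDerivWithinAt a₂ (-(η (t • (u + h)) (u + h) * a₂ t)) (Icc 0 1) t) :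
    ‖a₂ 1 - a₁ 1 + η u h * a₁ 1‖ ≤ 4 * (C + K + C * C + K' * C) * ‖h‖ ^ 2 := by
  have hC0 : 0 ≤ C := (norm_nonneg _).trans (hC u hu)
  have hmem : ∀ z ∈ s, ∀ t ∈ Icc (0 : ℝ) 1, t • z ∈ s := fun z hz t ht =>
    hs.smul_mem_of_zero_mem h0 hz ht
  -- One summand for each of the four terms of `R` below; the factor 2 bounds ‖a₁‖. Grönwall's
  -- inequality contributes another 2, whence the 4 in the conclusion.
  set M : ℝ := 2 * (C + K + C * C + K' * C) with hM
  have hM0 : 0 ≤ M := by positivity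
  let R : ℝ → 𝒜 := fun t => (-(t • fderiv ℝ η (t • u) h h) -
    (η (t • (u + h)) - η (t • u) - fderiv ℝ η (t • u) (t • h)) (u + h) +
    t • (η (t • u) h * η (t • u) h) +
    t • ((η (t • (u + h)) - η (t • u)) (u + h) * η (t • u) h)) * a₁ t
  have hR : ∀ t ∈ Icc (0 : ℝ) 1, ‖R t‖ ≤ M * ‖h‖ ^ 2 := by
    intro t ht
    have hx := hmem u hu t ht
    have hy := hmem _ huh t ht
    have hyx : t • (u + h) - t • u = t • h := by rw [smul_add, add_sub_cancel_left]
    have hth : ‖t • h‖ ≤ ‖h‖ := by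
      rw [norm_smul, Real.norm_of_nonneg ht.1]
      exact mul_le_of_le_one_left (norm_nonneg _) ht.2
    have ht' : ∀ z : 𝒜, ‖t • z‖ ≤ ‖z‖ := fun z => by
      rw [norm_smul, Real.norm_of_nonneg ht.1]
      exact mul_le_of_le_one_left (norm_nonneg _) ht.2
    have huh1 := hs1 _ huh
    have e1 : ‖-(t • fderiv ℝ η (t • u) h h)‖ ≤ C * ‖h‖ ^ 2 := by
      rw [norm_neg]
      refine (ht' _).trans ((((fderiv ℝ η (t • u)) h).le_opNorm h).trans ?_)
      rw [pow_two, ← mul_assoc]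
      gcongr
      exact ((fderiv ℝ η (t • u)).le_opNorm h).trans (by gcongr; exact hdC _ hx)
    have e2 : ‖(η (t • (u + h)) - η (t • u) - fderiv ℝ η (t • u) (t • h)) (u + h)‖ ≤
        K * ‖h‖ ^ 2 := by
      refine (ContinuousLinearMap.le_opNorm _ _).trans ?_
      have := norm_sub_sub_le_of_lipschitzOn_fderiv hs hso hη hK hx hy
      rw [hyx] at this
      calc _ ≤ (K * ‖t • h‖ * ‖t • h‖) * 1 := by gcongr
        _ ≤ (K * ‖h‖ * ‖h‖) * 1 := by gcongr
        _ = _ := by ring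
    have ewh : ‖η (t • u) h‖ ≤ C * ‖h‖ :=
      ((η (t • u)).le_opNorm h).trans (by gcongr; exact hC _ hx)
    have e3 : ‖t • (η (t • u) h * η (t • u) h)‖ ≤ C * C * ‖h‖ ^ 2 := by
      refine (ht' _).trans ((norm_mul_le _ _).trans ?_)
      calc _ ≤ (C * ‖h‖) * (C * ‖h‖) := by gcongr
        _ = _ := by ring
    have e4 : ‖t • ((η (t • (u + h)) - η (t • u)) (u + h) * η (t • u) h)‖ ≤
        K' * C * ‖h‖ ^ 2 := by
      refine (ht' _).trans ((norm_mul_le _ _).trans ?_)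
      have h5 : ‖(η (t • (u + h)) - η (t • u)) (u + h)‖ ≤ K' * ‖h‖ := by
        refine (ContinuousLinearMap.le_opNorm _ _).trans ?_
        have := hK'.norm_sub_le hy hx
        rw [hyx] at this
        calc _ ≤ (K' * ‖t • h‖) * 1 := by gcongr
          _ ≤ (K' * ‖h‖) * 1 := by gcongr
          _ = _ := by ring
      calc _ ≤ (K' * ‖h‖) * (C * ‖h‖) := by gcongr
        _ = _ := by ring
    refine (norm_mul_le _ _).trans ?_
    calc _ ≤ (C * ‖h‖ ^ 2 + K * ‖h‖ ^ 2 + C * C * ‖h‖ ^ 2 + K' * C * ‖h‖ ^ 2) * 2 := by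
          gcongr
          · exact (norm_add_le _ _).trans (add_le_add ((norm_add_le _ _).trans (add_le_add
              ((norm_sub_le _ _).trans (add_le_add e1 e2)) e3)) e4)
          · exact hb t ht
      _ = _ := by rw [hM]; ring
  let Q : ℝ → 𝒜 := fun t => a₂ t - a₁ t + t • (η (t • u) h * a₁ t)
  have hQ : ∀ t ∈ Icc (0 : ℝ) 1, HasDerivWithinAt Q
      (-(η (t • (u + h)) (u + h) * Q t) + R t) (Icc 0 1) t := by
    intro t ht
    have hx := hmem u hu t ht
    have hηd : HasDerivWithinAt (fun t : ℝ => η (t • u) h) (fderiv ℝ η (t • u) u h) (Icc 0 1) t := by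
      have hd := ((hη _ hx).differentiableAt (hso.mem_nhds hx)).hasFDerivAt
      have hl : HasDerivAt (fun t : ℝ => t • u) u t := by
        simpa using (hasDerivAt_id t).smul_const u
      have h3 := hd.comp_hasDerivAt t hl
      exact (h3.clm_apply (hasDerivAt_const t h)).hasDerivWithinAt.congr_deriv (by simp)
    have h3 := ((h2 t ht).sub (h1 t ht)).add
      ((hasDerivWithinAt_id t (Icc 0 1)).smul (hηd.mul (h1 t ht)))
    refine h3.congr_deriv ?_
    -- The only use of flatness: the derivative of η(·)h in the radial direction u is traded for
    -- that of η(·)u in the direction h, which the Taylor expansion of η(t(u + h)) then cancels up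
    -- to second order.
    have hf := hflat _ hx u h
    have hf' : fderiv ℝ η (t • u) u h = fderiv ℝ η (t • u) h u - η (t • u) u * η (t • u) h +
      η (t • u) h * η (t • u) u := by
      rw [← sub_eq_zero, ← hf]; abel
    simp only [Q, R, hf', id, map_add, map_smul, smul_apply, sub_apply, one_smul]
    simp only [mul_add, add_mul, mul_sub, sub_mul, smul_add, smul_sub, mul_neg, neg_mul, smul_neg,
      smul_mul_assoc, mul_smul_comm, mul_assoc, neg_add, neg_sub]
    abel
  have hg := norm_le_gronwallBound_of_norm_deriv_right_le (f := Q)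
    (f' := fun t => -(η (t • (u + h)) (u + h) * Q t) + R t) (δ := 0) (K := 1 / 2)
    (ε := M * ‖h‖ ^ 2) (a := 0) (b := 1)
    (fun t ht => (hQ t ht).continuousWithinAt)
    (fun t ht => hasDerivWithinAt_Ici_of_Icc ht (hQ t (Ico_subset_Icc_self ht)))
    (by simp [Q, h01, h02]) (fun t ht => ?_) 1 (by simp)
  · have h5 : Q 1 = a₂ 1 - a₁ 1 + η u h * a₁ 1 := by simp [Q]
    rw [← h5]
    refine (hg.trans (gronwallBound_zero_half_le (by positivity) (by norm_num))).trans ?_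
    have := exp_half_lt_two
    have h6 : 0 ≤ M * ‖h‖ ^ 2 := by positivity
    rw [show 4 * (C + K + C * C + K' * C) * ‖h‖ ^ 2 = 2 * (M * ‖h‖ ^ 2) * 1 by rw [hM]; ring]
    gcongr
    linarith
  · have ht' := Ico_subset_Icc_self ht
    refine (norm_add_le _ _).trans (add_le_add ?_ (hR t ht'))
    rw [norm_neg]
    refine (norm_mul_le _ _).trans ?_
    gcongr
    exact hhalf _ (hmem _ huh t ht') _ huh

theorem hasFDerivAt_of_norm_sub_le_sq {G : Type*} [NormedAddCommGroup G] [NormedSpace ℝ G]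
    {f : F → G} {f' : F →L[ℝ] G} {x : F} {C : ℝ}
    (h : ∀ᶠ v in 𝓝 (0 : F), ‖f (x + v) - f x - f' v‖ ≤ C * ‖v‖ ^ 2) : HasFDerivAt f f' x := by
  rw [hasFDerivAt_iff_isLittleO_nhds_zero]
  have h1 : (fun v : F => f (x + v) - f x - f' v) =O[𝓝 0] fun v => ‖v‖ ^ 2 :=
    Asymptotics.IsBigO.of_bound C (by
      filter_upwards [h] with v hv
      simpa using hv)
  exact h1.trans_isLittleO (Asymptotics.isLittleO_norm_pow_id one_lt_two)

/-- Bootstrapping: the derivative of A is an expression in A and η, so each order of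
differentiability of A yields the next. -/
theorem contDiffOn_of_parallel {η : F → F →L[ℝ] 𝒜} {s : Set F} (hs : IsOpen s)
    (hη : ContDiffOn ℝ ∞ η s) {A : F → 𝒜}
    (hA : ∀ x ∈ s, HasFDerivAt A (-(((ContinuousLinearMap.mul ℝ 𝒜).flip (A x)).comp (η x))) x) :
    ContDiffOn ℝ ∞ A s := by
  refine contDiffOn_infty.2 fun n => ?_
  induction n with
  | zero =>
    exact contDiffOn_zero.2 fun x hx => (hA x hx).continuousAt.continuousWithinAt
  | succ n ih =>
    push_cast
    rw [contDiffOn_succ_iff_fderiv_of_isOpen hs]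
    refine ⟨fun x hx => (hA x hx).differentiableAt.differentiableWithinAt, by simp, ?_⟩
    have h1 : ContDiffOn ℝ n
        (fun x => -(((ContinuousLinearMap.mul ℝ 𝒜).flip (A x)).comp (η x))) s := by
      refine (ContDiffOn.clm_comp ?_ (hη.of_le (by exact_mod_cast le_top))).neg
      exact ((ContinuousLinearMap.mul ℝ 𝒜).flip).contDiff.comp_contDiffOn ih
    exact h1.congr fun x hx => (hA x hx).fderiv

theorem eventually_norm_lt_of_contDiffAt {G : Type*} [NormedAddCommGroup G] [NormedSpace ℝ G]
    {f : F → G} {x : F} (hf : ContDiffAt ℝ 1 f x) {C : ℝ} (hC : ‖f x‖ < C) :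
    ∀ᶠ y in 𝓝 x, ‖f y‖ < C :=
  hf.continuousAt.norm.eventually_lt_const hC

/-- A(u) is the value at time 1 of the transport of 1 along the ray to u. The equation in the radial
direction holds by construction, and `radial_difference_le` gives it in all directions. Smooth
dependence of solutions on parameters is not needed. -/
theorem exists_parallel_of_flat [CompleteSpace 𝒜] (hone : ‖(1 : 𝒜)‖ ≤ 1)
    {η : F → F →L[ℝ] 𝒜} {U : Set F} (hU : U ∈ 𝓝 (0 : F)) (hη : ContDiffOn ℝ ∞ η U)
    (hflat : ∀ x ∈ U, ∀ v w, fderiv ℝ η x v w - fderiv ℝ η x w v + η x v * η x w -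
      η x w * η x v = 0) :
    ∃ r > 0, Metric.ball 0 r ⊆ U ∧ ∃ A : F → 𝒜, ContDiffOn ℝ ∞ A (Metric.ball 0 r) ∧
      ∀ x ∈ Metric.ball (0 : F) r, IsUnit (A x) ∧
        HasFDerivAt A (-(((ContinuousLinearMap.mul ℝ 𝒜).flip (A x)).comp (η x))) x := by
  have hη0 : ContDiffAt ℝ ∞ η 0 := hη.contDiffAt hU
  have hdη0 : ContDiffAt ℝ 1 (fderiv ℝ η) 0 :=
    hη0.fderiv_right (m := 1) (by exact WithTop.coe_le_coe.2 le_top)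
  obtain ⟨K', t', ht', hK'⟩ := (hη0.of_le (by simp)).exists_lipschitzOnWith
  obtain ⟨K, t, ht, hK⟩ := hdη0.exists_lipschitzOnWith
  set C : ℝ := max ‖η 0‖ ‖fderiv ℝ η 0‖ + 1 with hC
  have hC1 : 1 ≤ C := by
    have := (norm_nonneg (η 0)).trans (le_max_left _ ‖fderiv ℝ η 0‖)
    linarith
  have hb1 : ∀ᶠ x in 𝓝 (0 : F), ‖η x‖ < C :=
    eventually_norm_lt_of_contDiffAt (hη0.of_le (by simp)) (by
      have := le_max_left ‖η 0‖ ‖fderiv ℝ η 0‖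
      linarith)
  have hb2 : ∀ᶠ x in 𝓝 (0 : F), ‖fderiv ℝ η x‖ < C :=
    eventually_norm_lt_of_contDiffAt hdη0 (by
      have := le_max_right ‖η 0‖ ‖fderiv ℝ η 0‖
      linarith)
  obtain ⟨r₀, hr₀, hball⟩ := Metric.eventually_nhds_iff_ball.1
    (((hb1.and hb2).and ((eventually_mem_set.2 ht).and (eventually_mem_set.2 ht'))).and
      (eventually_mem_set.2 hU))
  -- With ‖η‖ ≤ C this radius gives ‖η x y‖ ≤ C · 1/(2C) = 1/2 on the ball, and, since C ≥ 1, also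
  -- ‖x‖ ≤ 1.
  set r := min r₀ (1 / (2 * C)) with hr
  have hr0 : 0 < r := lt_min hr₀ (by positivity)
  have hrr : ∀ x ∈ Metric.ball (0 : F) r, x ∈ Metric.ball (0 : F) r₀ := fun x hx =>
    Metric.ball_subset_ball (min_le_left _ _) hx
  have hnorm : ∀ x ∈ Metric.ball (0 : F) r, ‖x‖ ≤ 1 / (2 * C) := fun x hx =>
    (mem_ball_zero_iff.1 hx).le.trans (min_le_right _ _)
  have hhalf : ∀ x ∈ Metric.ball (0 : F) r, ∀ y ∈ Metric.ball (0 : F) r, ‖η x y‖ ≤ 1 / 2 := by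
    intro x hx y hy
    refine ((η x).le_opNorm y).trans ?_
    calc ‖η x‖ * ‖y‖ ≤ C * (1 / (2 * C)) := by
          gcongr
          · exact (hball x (hrr x hx)).1.1.1.le
          · exact hnorm y hy
      _ = 1 / 2 := by field_simp
  have hone' : ∀ x ∈ Metric.ball (0 : F) r, ‖x‖ ≤ 1 := fun x hx => (hnorm x hx).trans (by
    rw [div_le_one (by positivity)]
    linarith)
  have hmem : ∀ u ∈ Metric.ball (0 : F) r, ∀ t ∈ Icc (0 : ℝ) 1, t • u ∈ Metric.ball (0 : F) r :=
    fun u hu t ht => (convex_ball _ _).smul_mem_of_zero_mem (Metric.mem_ball_self hr0) hu ht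
  have hdiff : ContDiffOn ℝ ∞ η (Metric.ball 0 r) := hη.mono fun x hx => (hball x (hrr x hx)).2
  have hex : ∀ u : F, ∃ a : ℝ → 𝒜, u ∈ Metric.ball (0 : F) r → a 0 = 1 ∧
      (∀ t ∈ Icc (0 : ℝ) 1, HasDerivWithinAt a (-(η (t • u) u * a t)) (Icc 0 1) t) ∧
      ∀ t ∈ Icc (0 : ℝ) 1, ‖a t - 1‖ < 1 := by
    intro u
    by_cases hu : u ∈ Metric.ball (0 : F) r
    · have hc : ContinuousOn (fun t : ℝ => η (t • u) u) (Icc 0 1) := by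
        have h1 : ContinuousOn (fun t : ℝ => η (t • u)) (Icc 0 1) :=
          hdiff.continuousOn.comp (by fun_prop) (fun t ht => hmem u hu t ht)
        exact h1.clm_apply continuousOn_const
      obtain ⟨a, ha⟩ := exists_radial_solution hc
        (fun t ht => hhalf _ (hmem u hu t ht) u hu) hone
      exact ⟨a, fun _ => ha⟩
    · exact ⟨0, fun h => absurd h hu⟩
  choose a ha using hex
  have hA : ∀ x ∈ Metric.ball (0 : F) r, HasFDerivAt (fun u => a u 1)
      (-(((ContinuousLinearMap.mul ℝ 𝒜).flip (a x 1)).comp (η x))) x := by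
    intro x hx
    refine hasFDerivAt_of_norm_sub_le_sq (C := 4 * (C + K + C * C + K' * C)) ?_
    have hcont : ContinuousAt (fun v : F => x + v) 0 := by fun_prop
    filter_upwards [hcont.preimage_mem_nhds
      (by simpa using Metric.isOpen_ball.mem_nhds hx : Metric.ball (0 : F) r ∈ 𝓝 (x + 0))] with v hv
    obtain ⟨h01, h1, hb⟩ := ha x hx
    obtain ⟨h02, h2, -⟩ := ha (x + v) hv
    have key := radial_difference_le (convex_ball (0 : F) r) Metric.isOpen_ball
      (Metric.mem_ball_self hr0) (hdiff.differentiableOn (by simp))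
      (hK'.mono fun x hx => (hball x (hrr x hx)).1.2.2)
      (hK.mono fun x hx => (hball x (hrr x hx)).1.2.1)
      (fun x hx => (hball x (hrr x hx)).1.1.1.le) (fun x hx => (hball x (hrr x hx)).1.1.2.le)
      hone' hhalf (fun x hx => hflat x (hball x (hrr x hx)).2) hx hv h01 h02 (fun t ht => by
        have h3 := norm_add_le (a x t - 1) 1
        rw [sub_add_cancel] at h3
        have := hb t ht
        linarith) h1 h2
    simpa using key
  refine ⟨r, hr0, fun x hx => (hball x (hrr x hx)).2, fun u => a u 1,
    contDiffOn_of_parallel Metric.isOpen_ball hdiff hA, fun x hx => ⟨?_, hA x hx⟩⟩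
  -- A(x) = 1 - (1 - A(x)) is a unit by the Neumann series.
  have := (ha x hx).2.2 1 (by simp)
  rw [norm_sub_rev] at this
  simpa using (Units.oneSub (1 - a x 1) this).isUnit

end FlatEquation

/-! ### From solutions on a slice to frames and coordinates around it -/

section Slice

variable {E : Type*} [NormedAddCommGroup E] [NormedSpace ℝ E] 
  {F : Type*} [NormedAddCommGroup F] [NormedSpace ℝ F]
  {G : Type*} [NormedAddCommGroup G] [NormedSpace ℝ G]

/-- In the product rule the derivative of c is multiplied by y(x) = 0. Used for terms that vanish on
the slice. -/
theorem hasFDerivAt_clm_apply_of_eq_zero {c : E → F →L[ℝ] G} {y : E →L[ℝ] F} {x : E}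
    (hc : DifferentiableAt ℝ c x) (hy : y x = 0) :
    HasFDerivAt (fun z => c z (y z)) ((c x).comp y) x := by
  refine (hc.hasFDerivAt.clm_apply y.hasFDerivAt).congr_fderiv ?_
  ext h
  simp [hy]

theorem contDiffOn_fderiv_apply {s : Set F} (hs : IsOpen s) {Q : F → G} (hQ : ContDiffOn ℝ ∞ Q s)
    (v : F) : ContDiffOn ℝ ∞ (fun u => fderiv ℝ Q u v) s :=
  ((contDiffOn_infty_iff_fderiv_of_isOpen hs).1 hQ).2.clm_apply contDiffOn_const

/-- The projection of `E` to a complement of the range of `L`, given a left inverse `π` of `L`. -/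
def complProj (L : F →L[ℝ] E) (π : E →L[ℝ] F) : E →L[ℝ] E :=
  ContinuousLinearMap.id ℝ E - L.comp π

theorem complProj_apply (L : F →L[ℝ] E) (π : E →L[ℝ] F) (x : E) :
    complProj L π x = x - L (π x) := rfl

variable {L : F →L[ℝ] E} {π : E →L[ℝ] F} (hπ : ∀ u, π (L u) = u)

include hπ in
theorem complProj_map (u : F) : complProj L π (L u) = 0 := by
  rw [complProj_apply, hπ, sub_self]

variable [CompleteSpace E] {Γ : E → E →L[ℝ] E →L[ℝ] E} {W : Set E}

include hπ in
/-- Extension of a parallel field of endomorphisms from a slice to a neighborhood so that it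
solves the equation of parallel transport to first order in all directions. -/
theorem exists_first_order_parallel (hW : IsOpen W) (h0 : (0 : E) ∈ W) (hΓ : ContDiffOn ℝ ∞ Γ W)
    {s : Set F} (hs : IsOpen s) (h0s : (0 : F) ∈ s) (hsW : ∀ u ∈ s, L u ∈ W) {A : F → E →L[ℝ] E}
    (hA : ContDiffOn ℝ ∞ A s) (hAu : IsUnit (A 0))
    (hAd : ∀ u ∈ s, ∀ v, fderiv ℝ A u v = -(Γ (L u) (L v) * A u)) :
    ∃ (V : Set E) (B : E → E →L[ℝ] E), IsOpen V ∧ 0 ∈ V ∧ V ⊆ W ∧ ContDiffOn ℝ ∞ B V ∧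
      (∀ x ∈ V, IsUnit (B x)) ∧
      ∀ u, L u ∈ V → ∀ h, fderiv ℝ B (L u) h = -(Γ (L u) h * B (L u)) := by
  let y := complProj L π
  -- The first-order Taylor polynomial in the transverse coordinate y: on the slice B = A, and the
  -- transverse derivative is the required -Γ(y)A.
  let B : E → E →L[ℝ] E := fun x => A (π x) - Γ (L (π x)) (y x) * A (π x)
  let V₀ : Set E := W ∩ π ⁻¹' s
  have hV₀ : IsOpen V₀ := hW.inter (hs.preimage π.continuous)
  have hπV : MapsTo π V₀ s := fun x hx => hx.2
  have hLV : MapsTo (fun x => L (π x)) V₀ W := fun x hx => hsW _ hx.2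
  have hAπ : ContDiffOn ℝ ∞ (fun x => A (π x)) V₀ := hA.comp π.contDiff.contDiffOn hπV
  have hΓπ : ContDiffOn ℝ ∞ (fun x => Γ (L (π x))) V₀ :=
    hΓ.comp (L.contDiff.comp π.contDiff).contDiffOn hLV
  have hB : ContDiffOn ℝ ∞ B V₀ :=
    hAπ.sub ((hΓπ.clm_apply y.contDiff.contDiffOn).clm_comp hAπ)
  have hB0 : B 0 = A 0 := by simp [B]
  have h0V : (0 : E) ∈ V₀ := ⟨h0, by simpa using h0s⟩
  refine ⟨V₀ ∩ B ⁻¹' {a | IsUnit a}, B, hB.continuousOn.isOpen_inter_preimage hV₀ Units.isOpen,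
    ⟨h0V, by simpa [hB0] using hAu⟩, fun x hx => hx.1.1, hB.mono inter_subset_left,
    fun x hx => hx.2, ?_⟩
  intro u hu h
  have hus : u ∈ s := by simpa [hπ] using hu.1.2
  have hy0 : y (L u) = 0 := complProj_map hπ u
  have hd1 : HasFDerivAt (fun x => A (π x)) ((fderiv ℝ A u).comp π) (L u) := by
    have := ((hA.differentiableOn (by simp)) u hus).differentiableAt (hs.mem_nhds hus)
    refine HasFDerivAt.comp (L u) ?_ π.hasFDerivAt
    rw [hπ]
    exact this.hasFDerivAt
  have hd2 : HasFDerivAt (fun x => Γ (L (π x)) (y x)) ((Γ (L (π (L u)))).comp y) (L u) :=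
    hasFDerivAt_clm_apply_of_eq_zero
      (((hΓπ.differentiableOn (by simp)) _ hu.1).differentiableAt (hV₀.mem_nhds hu.1)) hy0
  have hd3 := hd1.sub (hd2.clm_comp hd1)
  have hBu : B (L u) = A u := by simp [B, hπ, hy0]
  rw [show fderiv ℝ B (L u) = _ from hd3.fderiv, hBu]
  have hdec : Γ (L u) h = Γ (L u) (L (π h)) + Γ (L u) (y h) := by
    rw [← map_add]; congr 1; simp [y, complProj_apply]
  rw [hdec]
  ext k
  simp only [ContinuousLinearMap.comp_apply, sub_apply, add_apply, ContinuousLinearMap.compL_apply,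
    ContinuousLinearMap.flip_apply, hπ, hy0, map_zero, hAd u hus, mul_apply_eq_comp,
    neg_apply, zero_apply, zero_add]
  abel

/-- The equation of the dual coframe. The differential of normal coordinates has to be this inverse
matrix. -/
theorem fderiv_ringInverse_parallel {s : Set F} (hs : IsOpen s) {A : F → E →L[ℝ] E}
    {η : F → F →L[ℝ] E →L[ℝ] E} (hA : ContDiffOn ℝ ∞ A s) (hAu : ∀ u ∈ s, IsUnit (A u))
    (hAd : ∀ u ∈ s, ∀ v, fderiv ℝ A u v = -(η u v * A u)) :
    ContDiffOn ℝ ∞ (fun u => Ring.inverse (A u)) s ∧ ∀ u ∈ s, ∀ v,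
      fderiv ℝ (fun u => Ring.inverse (A u)) u v = Ring.inverse (A u) * η u v := by
  refine ⟨fun u hu => ?_, fun u hu v => ?_⟩
  · obtain ⟨a, ha⟩ := hAu u hu
    have h1 : ContDiffAt ℝ ∞ Ring.inverse (A u) := by
      rw [← ha]; exact contDiffAt_ringInverse ℝ a
    exact h1.comp_contDiffWithinAt u (hA u hu)
  · obtain ⟨a, ha⟩ := hAu u hu
    have h1 := hasFDerivAt_ringInverse (𝕜 := ℝ) a
    rw [ha] at h1
    have h2 : HasFDerivAt (fun u => Ring.inverse (A u)) _ u :=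
      h1.comp u ((hA.differentiableOn (by simp) u hu).differentiableAt (hs.mem_nhds hu)).hasFDerivAt
    rw [h2.fderiv]
    simp [hAd u hu, ← ha, mul_assoc]

include hπ in
/-- If the coefficients are symmetric on the slice, the first order parallel coframe is realised
by the differential of a change of coordinates. -/
theorem exists_normal_change (hW : IsOpen W) (h0 : (0 : E) ∈ W) (hΓ : ContDiffOn ℝ ∞ Γ W)
    {r : ℝ} (hr : 0 < r) (hsW : ∀ u ∈ Metric.ball (0 : F) r, L u ∈ W) {A : F → E →L[ℝ] E}
    (hA : ContDiffOn ℝ ∞ A (Metric.ball 0 r)) (hAu : ∀ u ∈ Metric.ball (0 : F) r, IsUnit (A u))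
    (hAd : ∀ u ∈ Metric.ball (0 : F) r, ∀ v, fderiv ℝ A u v = -(Γ (L u) (L v) * A u))
    (hsym : ∀ u ∈ Metric.ball (0 : F) r, ∀ v w, Γ (L u) (L v) (L w) = Γ (L u) (L w) (L v)) :
    ∃ (V : Set E) (ψ : E → E), IsOpen V ∧ 0 ∈ V ∧ V ⊆ W ∧ ContDiffOn ℝ ∞ ψ V ∧
      IsUnit (fderiv ℝ ψ 0) ∧ ∀ u, L u ∈ V → (∀ h k, Γ (L u) h k = Γ (L u) k h) →
        ∀ h k, fderiv ℝ (fderiv ℝ ψ) (L u) h k = fderiv ℝ ψ (L u) (Γ (L u) h k) := by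
  set s := Metric.ball (0 : F) r with hs_def
  have hs : IsOpen s := Metric.isOpen_ball
  have h0s : (0 : F) ∈ s := Metric.mem_ball_self hr
  let y := complProj L π
  have hΓL : ContDiffOn ℝ ∞ (fun u => Γ (L u)) s := hΓ.comp L.contDiff.contDiffOn hsW
  obtain ⟨hB, hBd⟩ := fderiv_ringInverse_parallel (η := fun u => (Γ (L u)).comp L) hs hA hAu hAd
  set B : F → E →L[ℝ] E := fun u => Ring.inverse (A u) with hBdef
  have hBu : ∀ u ∈ s, IsUnit (B u) := fun u hu => (hAu u hu).ringInverse
  have hBdiff : ∀ u ∈ s, DifferentiableAt ℝ B u := fun u hu =>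
    (hB.differentiableOn (by simp) u hu).differentiableAt (hs.mem_nhds hu)
  -- Q = BΓ is the value that the second derivative of ψ must have on the slice if its first
  -- derivative there is B.
  let Q : F → E →L[ℝ] E →L[ℝ] E := fun u =>
    (ContinuousLinearMap.compL ℝ E E E (B u)).comp (Γ (L u))
  have hQ : ContDiffOn ℝ ∞ Q s :=
    ContDiffOn.clm_comp ((ContinuousLinearMap.compL ℝ E E E).contDiff.comp_contDiffOn hB) hΓL
  have hQa : ∀ u h k, Q u h k = B u (Γ (L u) h k) := fun u h k => rfl
  have hBdQ : ∀ u ∈ s, ∀ v k, fderiv ℝ B u v k = Q u (L v) k := fun u hu v k => by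
    rw [hBd u hu]; rfl
  have hBL : DifferentiableOn ℝ (fun u => (B u).comp L) s := fun u hu =>
    ((hBdiff u hu).clm_comp (differentiableAt_const L)).differentiableWithinAt
  -- The Poincaré lemma on the slice. Closedness of B ∘ L involves only tangential arguments of Γ,
  -- so the weaker symmetry `hsym` suffices here; full symmetry is used only at the points where
  -- normality is claimed.
  obtain ⟨f, hf⟩ := (convex_ball (0 : F) r).exists_forall_hasFDerivAt_of_fderiv_symmetric hs
    hBL (by
      intro u hu v w
      have h1 : ∀ v w, fderiv ℝ (fun u => (B u).comp L) u v w = Q u (L v) (L w) := by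
        intro v w
        rw [fderiv_clm_comp (hBdiff u hu) (differentiableAt_const L)]
        simp [hBdQ u hu]
      rw [h1, h1, hQa, hQa, hsym u hu])
  have hfs : ContDiffOn ℝ ∞ f s := by
    rw [contDiffOn_infty_iff_fderiv_of_isOpen hs]
    refine ⟨fun u hu => (hf u hu).differentiableAt.differentiableWithinAt, ?_⟩
    exact (hB.clm_comp contDiffOn_const).congr fun u hu => (hf u hu).fderiv
  let V : Set E := W ∩ π ⁻¹' s
  have hV : IsOpen V := hW.inter (hs.preimage π.continuous)
  have hπV : MapsTo π V s := fun x hx => hx.2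
  have hBπ : ContDiffOn ℝ ∞ (fun x => B (π x)) V := hB.comp π.contDiff.contDiffOn hπV
  have hQπ : ContDiffOn ℝ ∞ (fun x => Q (π x)) V := hQ.comp π.contDiff.contDiffOn hπV
  have hdQπ : ∀ v, ContDiffOn ℝ ∞ (fun x => fderiv ℝ Q (π x) v) V := fun v =>
    (contDiffOn_fderiv_apply hs hQ v).comp π.contDiff.contDiffOn hπV
  -- The second-order Taylor polynomial in y of a function with first derivative B and second
  -- derivative Q on the slice.
  let ψ : E → E := fun x => f (π x) + B (π x) (y x) + (1 / 2 : ℝ) • Q (π x) (y x) (y x)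
  have hψ : ContDiffOn ℝ ∞ ψ V := by
    refine ((hfs.comp π.contDiff.contDiffOn hπV).add
      (hBπ.clm_apply y.contDiff.contDiffOn)).add (contDiffOn_const.smul ?_)
    exact (hQπ.clm_apply y.contDiff.contDiffOn).clm_apply y.contDiff.contDiffOn
  have h0V : (0 : E) ∈ V := ⟨h0, by simpa using h0s⟩
  have hDψ : ∀ x ∈ V, ∀ k, fderiv ℝ ψ x k = B (π x) k + Q (π x) (L (π k)) (y x) +
      (1 / 2 : ℝ) • (fderiv ℝ Q (π x) (π k) (y x) (y x) + Q (π x) (y k) (y x) +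
        Q (π x) (y x) (y k)) := by
    intro x hx k
    have hxs := hx.2
    have d1 : HasFDerivAt (fun x => f (π x)) _ x := (hf (π x) hxs).comp x π.hasFDerivAt
    have d2 : HasFDerivAt (fun x => B (π x)) _ x :=
      (hBdiff (π x) hxs).hasFDerivAt.comp x π.hasFDerivAt
    have d3 : HasFDerivAt (fun x => Q (π x)) _ x :=
      ((hQ.differentiableOn (by simp) (π x) hxs).differentiableAt
        (hs.mem_nhds hxs)).hasFDerivAt.comp x π.hasFDerivAt
    have d4 := ((d1.add (d2.clm_apply y.hasFDerivAt)).add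
      (((d3.clm_apply y.hasFDerivAt).clm_apply y.hasFDerivAt).const_smul (1 / 2 : ℝ)))
    rw [show fderiv ℝ ψ x = _ from d4.fderiv]
    have hk : k = L (π k) + y k := by simp [y, complProj_apply]
    have hBk : B (π x) k = B (π x) (L (π k)) + B (π x) (y k) := by
      rw [← map_add, ← hk]
    simp only [add_apply, ContinuousLinearMap.comp_apply, ContinuousLinearMap.flip_apply,
      smul_apply, hBdQ (π x) hxs, hBk]
    module
  refine ⟨V, ψ, hV, h0V, inter_subset_left, hψ, ?_, ?_⟩
  · have : fderiv ℝ ψ 0 = B 0 := by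
      ext k
      rw [hDψ 0 h0V]
      simp
    rw [this]
    exact hBu 0 h0s
  · intro u hu hsu h k
    have hus : u ∈ s := by simpa [hπ] using hu.2
    have hy0 : y (L u) = 0 := complProj_map hπ u
    have hdψ : DifferentiableAt ℝ (fderiv ℝ ψ) (L u) :=
      (((contDiffOn_infty_iff_fderiv_of_isOpen hV).1 hψ).2.differentiableOn (by simp)
        _ hu).differentiableAt (hV.mem_nhds hu)
    have h1 : fderiv ℝ (fderiv ℝ ψ) (L u) h k = fderiv ℝ (fun x => fderiv ℝ ψ x k) (L u) h := by
      rw [fderiv_clm_apply hdψ (differentiableAt_const k)]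
      simp
    have h2 : (fun x => fderiv ℝ ψ x k) =ᶠ[𝓝 (L u)] fun x =>
        B (π x) k + Q (π x) (L (π k)) (y x) +
      (1 / 2 : ℝ) • (fderiv ℝ Q (π x) (π k) (y x) (y x) + Q (π x) (y k) (y x) +
        (Q (π x)).flip (y k) (y x)) := by
      filter_upwards [hV.mem_nhds hu] with x hx using hDψ x hx k
    have hat : ∀ {G : Type _} [NormedAddCommGroup G] [NormedSpace ℝ G] {c : E → G},
        ContDiffOn ℝ ∞ c V → DifferentiableAt ℝ c (L u) := fun hc =>
      (hc.differentiableOn (by simp) _ hu).differentiableAt (hV.mem_nhds hu)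
    have e1 : HasFDerivAt (fun x => B (π x) k) (((fderiv ℝ B u).flip k).comp π) (L u) := by
      have : HasFDerivAt (fun x => B (π x)) ((fderiv ℝ B u).comp π) (L u) := by
        refine HasFDerivAt.comp (g := B) (f := fun x => π x) (L u) ?_ π.hasFDerivAt
        rw [hπ]
        exact (hBdiff u hus).hasFDerivAt
      refine (this.clm_apply (hasFDerivAt_const k _)).congr_fderiv ?_
      ext; simp
    have e2 := hasFDerivAt_clm_apply_of_eq_zero (c := fun x => Q (π x) (L (π k))) (y := y)
      (hat (hQπ.clm_apply contDiffOn_const)) hy0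
    have e3 := hasFDerivAt_clm_apply_of_eq_zero
      (c := fun x => fderiv ℝ Q (π x) (π k) (y x)) (y := y)
      (hat ((hdQπ (π k)).clm_apply y.contDiff.contDiffOn)) hy0
    have e4 := hasFDerivAt_clm_apply_of_eq_zero (c := fun x => Q (π x) (y k)) (y := y)
      (hat (hQπ.clm_apply contDiffOn_const)) hy0
    have hflip : ContDiffOn ℝ ∞ (fun x => (Q (π x)).flip) V :=
      (ContinuousLinearMap.flipₗᵢ ℝ E E E).toContinuousLinearEquiv.toContinuousLinearMap.contDiff.comp_contDiffOn hQπ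
    have e5 := hasFDerivAt_clm_apply_of_eq_zero (c := fun x => (Q (π x)).flip (y k)) (y := y)
      (hat (hflip.clm_apply contDiffOn_const)) hy0
    have e6 := (e1.add e2).add (((e3.add e4).add e5).const_smul (1 / 2 : ℝ))
    have hval : fderiv ℝ ψ (L u) (Γ (L u) h k) = Q u h k := by
      rw [hDψ _ hu]
      simp [hπ, hy0, hQa]
    rw [h1, h2.fderiv_eq, hval]
    refine (congrArg (fun T : E →L[ℝ] E => T h) e6.fderiv).trans ?_
    simp only [add_apply, ContinuousLinearMap.comp_apply, ContinuousLinearMap.flip_apply,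
      smul_apply, hBdQ u hus, hπ, hy0, map_zero, zero_apply, zero_add]
    have hsQ : ∀ h k, Q u h k = Q u k h := fun h k => by rw [hQa, hQa, hsu]
    have hh : h = L (π h) + y h := by simp [y, complProj_apply]
    have hk : k = L (π k) + y k := by simp [y, complProj_apply]
    -- By symmetry the tangential, mixed and transverse parts of the second derivative recombine to
    -- Q(h, k).
    have hd : Q u h k = Q u (L (π h)) k + (Q u (L (π k)) (y h) + Q u (y k) (y h)) := by
      rw [hsQ (L (π k)), hsQ (y k), ← map_add, ← hk, ← add_apply, ← map_add, ← hh]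
    rw [hd, hsQ (y h) (y k)]
    module

end Slice

/-! ### Coefficients in a frame -/

section Frames

variable {E : Type*} [NormedAddCommGroup E] [NormedSpace ℝ E] [FiniteDimensional ℝ E]
  {M : Type*} [TopologicalSpace M] [ChartedSpace E M] [IsManifold 𝓘(ℝ, E) ∞ M]
  {e : Idx E → (p : M) → TangentSpace 𝓘(ℝ, E) p} {V : Set M} (he : IsFrame e V)

/-- The coordinates of a tangent vector with respect to a frame. -/
def frameCoeff (j : Idx E) (p : M) : TangentSpace 𝓘(ℝ, E) p →ₗ[ℝ] ℝ := he.2.coeff j p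

/-- The values of a frame at a point as a basis of the tangent space. -/
def frameBasis {p : M} (hp : p ∈ V) : Basis (Idx E) ℝ (TangentSpace 𝓘(ℝ, E) p) := he.2.toBasisAt hp

omit [FiniteDimensional ℝ E] in
theorem frameBasis_apply {p : M} (hp : p ∈ V) (j : Idx E) : frameBasis he hp j = e j p :=
  he.2.toBasisAt_coe hp j

omit [FiniteDimensional ℝ E] in
theorem frameCoeff_eq {p : M} (hp : p ∈ V) (j : Idx E) (v : TangentSpace 𝓘(ℝ, E) p) :
    frameCoeff he j p v = (frameBasis he hp).repr v j := by
  simp only [frameCoeff, frameBasis, IsLocalFrameOn.coeff, dif_pos hp]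
  rfl

omit [FiniteDimensional ℝ E] in
theorem sum_frameCoeff {p : M} (hp : p ∈ V) (v : TangentSpace 𝓘(ℝ, E) p) :
    ∑ j, frameCoeff he j p v • e j p = v := by
  refine Eq.trans (Finset.sum_congr rfl fun j _ => ?_) ((frameBasis he hp).sum_repr v)
  rw [frameCoeff_eq he hp, frameBasis_apply]

omit [FiniteDimensional ℝ E] in
theorem frameCoeff_sum {p : M} (hp : p ∈ V) (c : Idx E → ℝ) (i : Idx E) :
    frameCoeff he i p (∑ j, c j • e j p) = c i := by
  rw [frameCoeff_eq he hp]
  have : ∑ j, c j • e j p = ∑ j, c j • frameBasis he hp j :=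
    Finset.sum_congr rfl fun j _ => by rw [frameBasis_apply]
  rw [this, Basis.repr_sum_self]

omit [FiniteDimensional ℝ E] in
include he in
theorem frame_sum_injective {p : M} (hp : p ∈ V) {c d : Idx E → ℝ}
    (h : ∑ j, c j • e j p = ∑ j, d j • e j p) : c = d := by
  funext i
  rw [← frameCoeff_sum he hp c, h, frameCoeff_sum he hp d]

/-- In a chart, let B(q) map the fixed basis to the frame at q. The coefficients of s are the
coordinates of B⁻¹s, and inversion of operators is smooth. -/
theorem contMDiffOn_frameCoeff {s : (p : M) → TangentSpace 𝓘(ℝ, E) p}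
    (hs : ContMDiffOn 𝓘(ℝ, E) (𝓘(ℝ, E).prod 𝓘(ℝ, E)) ∞
      (fun q => (⟨q, s q⟩ : TangentBundle 𝓘(ℝ, E) M)) V) (j : Idx E) :
    ContMDiffOn 𝓘(ℝ, E) 𝓘(ℝ, ℝ) ∞ (fun q => frameCoeff he j q (s q)) V := by
  have : CompleteSpace E := FiniteDimensional.complete ℝ E
  intro p hp
  refine ContMDiffAt.contMDiffWithinAt ?_
  let φ := chartAt E p
  have hφ : φ ∈ IsManifold.maximalAtlas 𝓘(ℝ, E) ∞ M := IsManifold.chart_mem_maximalAtlas p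
  have hpφ : p ∈ φ.source := mem_chart_source E p
  let b := finBasis ℝ E
  let β : Idx E → E →L[ℝ] ℝ := fun j => (b.coord j).toContinuousLinearMap
  have hβ : ∀ i j, β i (b j) = if j = i then 1 else 0 := fun i j => by
    change b.repr (b j) i = _
    rw [b.repr_self, Finsupp.single_apply]
  let B : M → E →L[ℝ] E := fun q => ∑ j, (β j).smulRight (chartRep φ (e j) q)
  have hBb : ∀ q j, B q (b j) = chartRep φ (e j) q := fun q j => by
    simp [B, hβ]
  have hBs : ∀ q ∈ V, ∀ v : TangentSpace 𝓘(ℝ, E) q, B q (∑ j, frameCoeff he j q v • b j) = chartDeriv φ q v := by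
    intro q hq v
    rw [map_sum]
    refine Eq.trans ?_ (congrArg (chartDeriv φ q) (sum_frameCoeff he hq v))
    refine Eq.trans ?_ (map_sum (chartDeriv φ q) _ _).symm
    refine Finset.sum_congr rfl fun j _ => ?_
    rw [map_smul, hBb]
    exact ((chartDeriv φ q).map_smul _ _).symm
  have hBu : ∀ q ∈ V ∩ φ.source, IsUnit (B q) := by
    intro q hq
    have hsurj : Function.Surjective (B q) := fun w =>
      ⟨_, (hBs q hq.1 (chartDerivInv φ q w)).trans (chartDeriv_chartDerivInv hφ hq.2 w)⟩
    have hinj : Function.Injective (B q) :=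
      (LinearMap.injective_iff_surjective (f := (B q).toLinearMap)).2 hsurj
    exact ContinuousLinearMap.isUnit_iff_bijective.2 ⟨hinj, hsurj⟩
  have hco : ∀ q ∈ V ∩ φ.source, frameCoeff he j q (s q) =
      β j (Ring.inverse (B q) (chartRep φ s q)) := by
    intro q hq
    have h1 : Ring.inverse (B q) (chartRep φ s q) = ∑ j, frameCoeff he j q (s q) • b j := by
      rw [chartRep, ← hBs q hq.1]
      exact DFunLike.congr_fun (Ring.inverse_mul_cancel _ (hBu q hq)) _
    rw [h1, map_sum]
    simp [hβ]
  have hBsm : ContMDiffAt 𝓘(ℝ, E) 𝓘(ℝ, E →L[ℝ] E) ∞ B p := by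
    refine ContMDiffAt.sum fun j _ => ?_
    have h2 := contMDiffAt_chartRep hφ hpφ ((he.2.contMDiffOn j).contMDiffAt (he.1.mem_nhds hp))
    have h3 : ContDiff ℝ ∞ (fun v : E => (β j).smulRight v) := by fun_prop
    exact h3.contMDiff.contMDiffAt.comp p h2
  have hinv : ContMDiffAt 𝓘(ℝ, E) 𝓘(ℝ, E →L[ℝ] E) ∞ (fun q => Ring.inverse (B q)) p := by
    obtain ⟨a, ha⟩ := hBu p ⟨hp, hpφ⟩
    have h1 : ContDiffAt ℝ ∞ Ring.inverse (B p) := by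
      rw [← ha]; exact contDiffAt_ringInverse ℝ a
    exact h1.contMDiffAt.comp p hBsm
  have hfin : ContMDiffAt 𝓘(ℝ, E) 𝓘(ℝ, ℝ) ∞
      (fun q => β j (Ring.inverse (B q) (chartRep φ s q))) p :=
    (β j).contDiff.contMDiff.contMDiffAt.comp p
      (hinv.clm_apply (contMDiffAt_chartRep hφ hpφ (hs.contMDiffAt (he.1.mem_nhds hp))))
  refine hfin.congr_of_eventuallyEq ?_
  filter_upwards [(he.1.inter φ.open_source).mem_nhds ⟨hp, hpφ⟩] with q hq using hco q hq

theorem contMDiffOn_frameCoeff_field (X : VF E M) (j : Idx E) :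
    ContMDiffOn 𝓘(ℝ, E) 𝓘(ℝ, ℝ) ∞ (fun q => frameCoeff he j q (X q)) V :=
  contMDiffOn_frameCoeff he X.contMDiff.contMDiffOn j

end Frames

/-! ### Components, linearity and normality in frames -/

namespace DerivationAlongVF

variable {E : Type*} [NormedAddCommGroup E] [NormedSpace ℝ E] [FiniteDimensional ℝ E]
  {M : Type*} [TopologicalSpace M] [ChartedSpace E M] [IsManifold 𝓘(ℝ, E) ∞ M] [T2Space M]
  (D : DerivationAlongVF E M)
  {e : Idx E → (p : M) → TangentSpace 𝓘(ℝ, E) p} {V : Set M} (he : IsFrame e V)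

theorem hasComponents_iff {X : VF E M} {p : M} {W : Matrix (Idx E) (Idx E) ℝ} :
    D.HasComponents e X p W ↔ ∀ (j : Idx E) (Y : VF E M), (∀ᶠ q in 𝓝 p, Y q = e j q) →
      D.cov X Y p = ∑ i, W i j • e i p :=
  forall₂_congr fun _ Y => imp_congr_right fun _ => D.act_eq_iff X Y p _

theorem normalOn_iff {S : Set M} : D.NormalOn e S ↔ ∀ p ∈ S, ∀ (X : VF E M) (j : Idx E)
    (Y : VF E M), (∀ᶠ q in 𝓝 p, Y q = e j q) → D.cov X Y p = 0 := by
  refine forall₃_congr fun p _ X => ?_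
  rw [hasComponents_iff]
  simp

include he in
theorem exists_frame_fields {p : M} (hp : p ∈ V) :
    ∃ Z : Idx E → VF E M, ∀ j, ∀ᶠ q in 𝓝 p, Z j q = e j q := by
  choose Z hZ using fun j => exists_vectorField_eventuallyEq he.1 hp (he.2.contMDiffOn j)
  exact ⟨Z, hZ⟩

-- By locality one choice of global extensions of the frame fields decides about all of them.
variable {D} in
theorem hasComponents_of_fields {p : M} {Z : Idx E → VF E M}
    (hZ : ∀ j, ∀ᶠ q in 𝓝 p, Z j q = e j q) {X : VF E M} {W : Matrix (Idx E) (Idx E) ℝ} :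
    D.HasComponents e X p W ↔ ∀ j, D.cov X (Z j) p = ∑ i, W i j • e i p := by
  rw [hasComponents_iff]
  refine ⟨fun h j => h j _ (hZ j), fun h j Y hY => ?_⟩
  rw [← h j]
  refine D.cov_congr X ?_
  filter_upwards [hY, hZ j] with q h1 h2
  rw [h1, h2]

/-- The expansion of `D_X s` in a frame, for a field with given components. -/
theorem cov_frame_expand {p : M} (hp : p ∈ V) {Z : Idx E → VF E M}
    (hZ : ∀ j, ∀ᶠ q in 𝓝 p, Z j q = e j q) (X Y : VF E M) {c : Idx E → M → ℝ} (hV : IsOpen V)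
    (hc : ∀ j, ContMDiffOn 𝓘(ℝ, E) 𝓘(ℝ, ℝ) ∞ (c j) V)
    (hY : ∀ᶠ q in 𝓝 p, Y q = ∑ j, c j q • e j q) :
    D.cov X Y p = ∑ j, (along X (c j) p • e j p + c j p • D.cov X (Z j) p) := by
  rw [D.cov_expand X Y Z c hV hp hc]
  · exact Finset.sum_congr rfl fun j _ => by rw [(hZ j).self_of_nhds]
  · filter_upwards [hY, eventually_all.2 hZ] with q h1 h2
    rw [h1]
    exact Finset.sum_congr rfl fun j _ => by rw [h2 j]

theorem cov_frame {p : M} (hp : p ∈ V) {Z : Idx E → VF E M}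
    (hZ : ∀ j, ∀ᶠ q in 𝓝 p, Z j q = e j q) (X Y : VF E M) :
    D.cov X Y p = ∑ j, (along X (fun q => frameCoeff he j q (Y q)) p • e j p +
      frameCoeff he j p (Y p) • D.cov X (Z j) p) := by
  refine D.cov_frame_expand hp hZ X Y he.1 (contMDiffOn_frameCoeff_field he Y) ?_
  filter_upwards [he.1.mem_nhds hp] with q hq
  exact (sum_frameCoeff he hq (Y q)).symm

theorem pointLinear_iff {p : M} : D.PointLinear p ↔
    ∀ Y : VF E M, ∃ l : TangentSpace 𝓘(ℝ, E) p →ₗ[ℝ] TangentSpace 𝓘(ℝ, E) p,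
      ∀ X : VF E M, D.cov X Y p = l (X p) := Iff.rfl

-- Linearity does not depend on the frame: expanding Y in `e`, the homogeneous part of D_X Y is
-- controlled by the components and the inhomogeneous part X(Y^j) is linear in X(p) by itself.
include he in
theorem linearInFrameAt_iff {p : M} (hp : p ∈ V) : D.LinearInFrameAt e p ↔ D.PointLinear p := by
  obtain ⟨Z, hZ⟩ := exists_frame_fields he hp
  constructor
  · rintro ⟨Γ, hΓ⟩ Y
    let T := TangentSpace 𝓘(ℝ, E) p
    let m : Idx E → T →ₗ[ℝ] T := fun j => ∑ i, ∑ k,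
      (frameCoeff he k p).smulRight (Γ k i j • e i p)
    have hm : ∀ (X : VF E M) j, D.cov X (Z j) p = m j (X p) := by
      intro X j
      have h1 := hasComponents_of_fields hZ |>.1 (hΓ X (fun k => frameCoeff he k p (X p))
        (sum_frameCoeff he hp (X p)).symm) j
      rw [h1]
      simp only [m, LinearMap.sum_apply, LinearMap.smulRight_apply]
      refine Finset.sum_congr rfl fun i _ => ?_
      rw [Matrix.sum_apply, Finset.sum_smul]
      refine Finset.sum_congr rfl fun k _ => ?_
      rw [Matrix.smul_apply, smul_eq_mul, mul_smul]
    let δ : Idx E → T →ₗ[ℝ] ℝ := fun j =>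
      { toFun := fun v => vderiv (E := E) (fun q => frameCoeff he j q (Y q)) p v
        map_add' := fun v w => (vderiv (E := E) _ p).map_add v w
        map_smul' := fun a v => (vderiv (E := E) _ p).map_smul a v }
    let l : T →ₗ[ℝ] T := ∑ j, ((δ j).smulRight (e j p) + frameCoeff he j p (Y p) • m j)
    have hl : ∀ v : T, l v = ∑ j, ((δ j).smulRight (e j p) + frameCoeff he j p (Y p) • m j) v :=
      fun v => LinearMap.sum_apply _ _ _
    refine ⟨l, fun X => ?_⟩
    rw [D.cov_frame he hp hZ X Y]
    refine Eq.trans ?_ (hl (X p)).symm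
    refine Finset.sum_congr rfl fun j _ => ?_
    rw [hm]
    rfl
  · intro h
    choose l hl using fun j => D.pointLinear_iff.1 h (Z j)
    refine ⟨fun k i j => frameCoeff he i p (l j (e k p)), fun X c hX => ?_⟩
    rw [hasComponents_of_fields hZ]
    intro j
    have h2 : D.cov X (Z j) p = ∑ k, c k • l j (e k p) := by
      rw [hl, hX, map_sum]
      exact Finset.sum_congr rfl fun k _ => by rw [map_smul]
    refine (sum_frameCoeff he hp (D.cov X (Z j) p)).symm.trans ?_
    refine Finset.sum_congr rfl fun i _ => ?_
    congr 1
    rw [h2, map_sum, Matrix.sum_apply]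
    exact Finset.sum_congr rfl fun k _ => by rw [map_smul]; rfl

omit [T2Space M] in
theorem linearInFrameAt_of_normalOn {S : Set M} (hn : D.NormalOn e S) {p : M} (hp : p ∈ S) :
    D.LinearInFrameAt e p :=
  ⟨0, fun X c _ => by simpa using hn p hp X⟩

include he in
theorem pointLinear_of_normalOn {S : Set M} (hSV : S ⊆ V) (hn : D.NormalOn e S) {p : M}
    (hp : p ∈ S) : D.PointLinear p :=
  (D.linearInFrameAt_iff he (hSV hp)).1 (D.linearInFrameAt_of_normalOn hn hp)

theorem pointLinear_of_linearAt {p : M} (h : D.LinearAt p) : D.PointLinear p := by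
  obtain ⟨V, e, hp, he, hl⟩ := h
  exact (D.linearInFrameAt_iff he hp).1 hl

/-- The operator `D_X` in a normal frame differentiates components. -/
theorem cov_of_normalOn {S : Set M} (hn : D.NormalOn e S) {p : M} (hp : p ∈ S) (hpV : p ∈ V)
    (X Y : VF E M) :
    D.cov X Y p = ∑ j, along X (fun q => frameCoeff he j q (Y q)) p • e j p := by
  obtain ⟨Z, hZ⟩ := exists_frame_fields he hpV
  rw [D.cov_frame he hpV hZ]
  refine Finset.sum_congr rfl fun j _ => ?_
  rw [D.normalOn_iff.1 hn p hp X j (Z j) (hZ j), smul_zero, add_zero]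

/-! ### Transition between frames -/

section Transition

variable {e' : Idx E → (p : M) → TangentSpace 𝓘(ℝ, E) p} (he' : IsFrame e' V)
  {A : M → Matrix (Idx E) (Idx E) ℝ} (hA : ∀ p ∈ V, ∀ j, e' j p = ∑ i, A p i j • e i p)

-- The Leibniz rule for e'_j = ∑ A^i_j e_i. The coefficients of e'_j relative to e are smooth as
-- frame coefficients; smoothness of A is not assumed.
include he he' hA in
theorem cov_transition {p : M} (hp : p ∈ V) {X : VF E M} {W : Matrix (Idx E) (Idx E) ℝ}
    (hW : D.HasComponents e X p W) {j : Idx E} {Y : VF E M} (hY : ∀ᶠ q in 𝓝 p, Y q = e' j q) :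
    D.cov X Y p = ∑ i, (dirDeriv X (fun q => A q i j) p + (W * A p) i j) • e i p := by
  obtain ⟨Z, hZ⟩ := exists_frame_fields he hp
  have hAs : ∀ i, ContMDiffOn 𝓘(ℝ, E) 𝓘(ℝ, ℝ) ∞ (fun q => A q i j) V := fun i =>
    (contMDiffOn_frameCoeff he (he'.2.contMDiffOn j) i).congr fun q hq => by
      rw [hA q hq]
      exact (frameCoeff_sum he hq (fun i => A q i j) i).symm
  rw [D.cov_frame_expand hp hZ X Y he.1 hAs]
  · have h1 : ∀ k, D.cov X (Z k) p = ∑ i, W i k • e i p := (hasComponents_of_fields hZ).1 hW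
    rw [Finset.sum_add_distrib]
    simp only [add_smul, Finset.sum_add_distrib, h1]
    congr 1
    simp only [Finset.smul_sum, Matrix.mul_apply, Finset.sum_smul]
    rw [Finset.sum_comm]
    refine Finset.sum_congr rfl fun i _ => Finset.sum_congr rfl fun k _ => ?_
    rw [smul_smul, mul_comm]
  · filter_upwards [hY, he.1.mem_nhds hp] with q h1 h2
    rw [h1, hA q h2]

include he in
theorem exists_hasComponents {p : M} (hp : p ∈ V) (X : VF E M) :
    ∃ W, D.HasComponents e X p W := by
  obtain ⟨Z, hZ⟩ := exists_frame_fields he hp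
  exact ⟨fun i j => frameCoeff he i p (D.cov X (Z j) p), (hasComponents_of_fields hZ).2 fun j =>
    (sum_frameCoeff he hp (D.cov X (Z j) p)).symm⟩

include he he' hA in
theorem normalOn_transition_iff {S : Set M} (hSV : S ⊆ V) : D.NormalOn e' S ↔
    ∀ p ∈ S, ∀ (X : VF E M) (W : Matrix (Idx E) (Idx E) ℝ), D.HasComponents e X p W →
      ∀ i j, dirDeriv X (fun q => A q i j) p + (W * A p) i j = 0 := by
  rw [normalOn_iff]
  constructor
  · intro h p hp X W hW i j
    obtain ⟨Z, hZ⟩ := exists_frame_fields he' (hSV hp)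
    have h1 := D.cov_transition he he' hA (hSV hp) hW (hZ j)
    rw [h p hp X j (Z j) (hZ j)] at h1
    refine congrFun (frame_sum_injective he (hSV hp) (d := 0)
      (c := fun i => dirDeriv X (fun q => A q i j) p + (W * A p) i j) ?_) i
    refine h1.symm.trans ?_
    simp
  · intro h p hp X j Y hY
    obtain ⟨W, hW⟩ := D.exists_hasComponents he (hSV hp) X
    rw [D.cov_transition he he' hA (hSV hp) hW hY]
    exact Finset.sum_eq_zero fun i _ => by rw [h p hp X W hW i j, zero_smul]

include he he' hA in
theorem normalOn_transition_iff_of_normalOn {S : Set M} (hSV : S ⊆ V) (hn : D.NormalOn e S) :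
    D.NormalOn e' S ↔
      ∀ p ∈ S, ∀ i j, mfderiv 𝓘(ℝ, E) 𝓘(ℝ, ℝ) (fun q => A q i j) p = 0 := by
  rw [D.normalOn_transition_iff he he' hA hSV]
  constructor
  · intro h p hp i j
    ext v
    obtain ⟨X, hX⟩ := exists_vectorField_apply p v
    have := h p hp X 0 (hn p hp X) i j
    rw [zero_mul, Matrix.zero_apply, add_zero, dirDeriv, hX] at this
    exact this
  · intro h p hp X W hW i j
    obtain ⟨Z, hZ⟩ := exists_frame_fields he (hSV hp)
    have h0 : W = 0 := by
      ext i j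
      have h1 := (hasComponents_of_fields hZ).1 hW j
      rw [(hasComponents_of_fields hZ).1 (hn p hp X) j] at h1
      exact (congrFun (frame_sum_injective he (hSV hp) h1) i).symm
    rw [h0, zero_mul, Matrix.zero_apply, add_zero, dirDeriv, h p hp i j]
    rfl

end Transition

end DerivationAlongVF

/-! ### Necessity of flatness -/

namespace DerivationAlongVF

variable {E : Type*} [NormedAddCommGroup E] [NormedSpace ℝ E] [FiniteDimensional ℝ E]
  {M : Type*} [TopologicalSpace M] [ChartedSpace E M] [IsManifold 𝓘(ℝ, E) ∞ M] [T2Space M]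
  (D : DerivationAlongVF E M)

theorem curvature_eq_zero_iff {X Y Z : VF E M} {p : M} : D.curvature X Y Z p = 0 ↔
    D.cov X (D.cov Y Z) p - D.cov Y (D.cov X Z) p = D.cov (bracket X Y) Z p := by
  have h : ∀ X Y, (D.der X).toFun 1 0 (D.act Y Z) = D.act X (D.cov Y Z) := fun X Y => by
    rw [← vfTensor_cov D Y Z, act]
  rw [curvature, h, h, act_apply, act_apply, act_apply, ← vecTensor_sub, ← vecTensor_sub,
    ← vecTensor_zero, vecTensor_injective.eq_iff, sub_eq_zero]

theorem torsion_eq_zero_iff {X Y : VF E M} {p : M} : D.torsion X Y p = 0 ↔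
    D.cov X Y p - D.cov Y X p = bracket X Y p := by
  rw [torsion, act_apply, act_apply, ← vecTensor_sub, ← vecTensor_sub,
    ← vecTensor_zero, vecTensor_injective.eq_iff, sub_eq_zero]

section Forward

variable {F : Type*} [NormedAddCommGroup F] [NormedSpace ℝ F] {N : Type*} [TopologicalSpace N]
  [ChartedSpace F N] {γ : N → M} {q : N}

omit [FiniteDimensional ℝ E] [IsManifold 𝓘(ℝ, E) ∞ M] [T2Space M] in
theorem vderiv_comp_map {G : Type*} [NormedAddCommGroup G] [NormedSpace ℝ G] {g : M → G}
    (hγ : MDifferentiableAt 𝓘(ℝ, F) 𝓘(ℝ, E) γ q)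
    (hg : MDifferentiableAt 𝓘(ℝ, E) 𝓘(ℝ, G) g (γ q)) (v : TangentSpace 𝓘(ℝ, F) q) :
    vderiv (E := F) (g ∘ γ) q v = vderiv (E := E) g (γ q) (mfderiv 𝓘(ℝ, F) 𝓘(ℝ, E) γ q v) := by
  rw [vderiv, mfderiv_comp q hg hγ]
  rfl

omit [FiniteDimensional ℝ E] [T2Space M] in
/-- Functions agreeing along `γ` have the same derivative in the directions tangent to `γ`. -/
theorem along_congr_of_tangent {G : Type*} [NormedAddCommGroup G] [NormedSpace ℝ G] {g g' : M → G}
    (hγ : MDifferentiableAt 𝓘(ℝ, F) 𝓘(ℝ, E) γ q)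
    (hg : MDifferentiableAt 𝓘(ℝ, E) 𝓘(ℝ, G) g (γ q))
    (hg' : MDifferentiableAt 𝓘(ℝ, E) 𝓘(ℝ, G) g' (γ q))
    (h : ∀ᶠ q' in 𝓝 q, g (γ q') = g' (γ q')) {X : VF E M}
    (hX : ∃ v, mfderiv 𝓘(ℝ, F) 𝓘(ℝ, E) γ q v = X (γ q)) : along X g (γ q) = along X g' (γ q) := by
  obtain ⟨v, hv⟩ := hX
  rw [along, along, ← hv]
  refine (vderiv_comp_map hγ hg v).symm.trans (Eq.trans ?_ (vderiv_comp_map hγ hg' v))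
  exact DFunLike.congr_fun (vderiv_congr (E := F) (f := g ∘ γ) (g := g' ∘ γ) h) v

omit [FiniteDimensional ℝ E] [T2Space M] in
theorem contMDiffOn_along [FiniteDimensional ℝ E] (X : VF E M) {G : Type*} [NormedAddCommGroup G]
    [NormedSpace ℝ G] {f : M → G} {V : Set M} (hV : IsOpen V)
    (hf : ContMDiffOn 𝓘(ℝ, E) 𝓘(ℝ, G) ∞ f V) :
    ContMDiffOn 𝓘(ℝ, E) 𝓘(ℝ, G) ∞ (along X f) V := by
  intro p hp
  refine ContMDiffAt.contMDiffWithinAt ?_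
  let φ := chartAt E p
  have hφ : φ ∈ IsManifold.maximalAtlas 𝓘(ℝ, E) ∞ M := IsManifold.chart_mem_maximalAtlas p
  have hpφ : p ∈ φ.source := mem_chart_source E p
  have h1 : ∀ᶠ q in 𝓝 p, along X f q =
      fderiv ℝ (f ∘ φ.symm) (φ q) (chartRep φ X q) := by
    filter_upwards [(hV.inter φ.open_source).mem_nhds ⟨hp, hpφ⟩] with q hq
    exact along_eq_fderiv hφ X hq.2 (hf.contMDiffAt (hV.mem_nhds hq.1))
  have h2 : ContDiffAt ℝ ∞ (fderiv ℝ (f ∘ φ.symm)) (φ p) := by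
    refine ContDiffAt.fderiv_right (m := ∞) (n := ∞) ?_ (by simp)
    refine contDiffAt_comp_symm hφ (φ.map_source hpφ) ?_
    rw [φ.left_inv hpφ]
    exact hf.contMDiffAt (hV.mem_nhds hp)
  refine ContMDiffAt.congr_of_eventuallyEq ?_ h1
  exact (contMDiffAt_comp_chart hφ hpφ h2).clm_apply
    (contMDiffAt_chartRep_field hφ X hpφ)

/-- The curvature vanishes, in the directions tangent to `γ`, if there is a frame normal
along `γ`. -/
theorem curvature_eq_zero_of_normalOn {e : Idx E → (p : M) → TangentSpace 𝓘(ℝ, E) p} {V : Set M}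
    (he : IsFrame e V) {S : Set M} (hSV : S ⊆ V) (hn : D.NormalOn e S)
    (hγ : MDifferentiableAt 𝓘(ℝ, F) 𝓘(ℝ, E) γ q) (hS : ∀ᶠ q' in 𝓝 q, γ q' ∈ S) {X Y : VF E M}
    (hX : ∃ v, mfderiv 𝓘(ℝ, F) 𝓘(ℝ, E) γ q v = X (γ q))
    (hY : ∃ v, mfderiv 𝓘(ℝ, F) 𝓘(ℝ, E) γ q v = Y (γ q)) (Z : VF E M) :
    D.curvature X Y Z (γ q) = 0 := by
  have hqS : γ q ∈ S := hS.self_of_nhds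
  have hqV := hSV hqS
  have hVn := he.1.mem_nhds hqV
  -- The components of D_Y Z are Y(Z^j) only at the points of S. As X is tangent to γ at q, its
  -- derivative of these components sees only their values along γ.
  have key : ∀ {X : VF E M} (Y : VF E M),
      (∃ v, mfderiv 𝓘(ℝ, F) 𝓘(ℝ, E) γ q v = X (γ q)) → D.cov X (D.cov Y Z) (γ q) =
        ∑ j, along X (along Y fun p => frameCoeff he j p (Z p)) (γ q) • e j (γ q) := by
    intro X Y hX
    rw [D.cov_of_normalOn he hn hqS hqV]
    refine Finset.sum_congr rfl fun j _ => ?_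
    congr 1
    refine along_congr_of_tangent hγ
      (((contMDiffOn_frameCoeff_field he _ j).contMDiffAt hVn).mdifferentiableAt (by simp))
      (((contMDiffOn_along Y he.1 (contMDiffOn_frameCoeff_field he Z j)).contMDiffAt
        hVn).mdifferentiableAt (by simp)) ?_ hX
    filter_upwards [hS] with q' hq'
    rw [D.cov_of_normalOn he hn hq' (hSV hq') Y Z]
    exact frameCoeff_sum he (hSV hq')
      (fun j => along Y (fun p => frameCoeff he j p (Z p)) (γ q')) j
  rw [curvature_eq_zero_iff, key Y hX, key X hY, D.cov_of_normalOn he hn hqS hqV,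
    ← Finset.sum_sub_distrib]
  refine Finset.sum_congr rfl fun j _ => ?_
  rw [← sub_smul, along_bracket (IsManifold.chart_mem_maximalAtlas (γ q)) X Y
    (mem_chart_source E (γ q)) hVn (contMDiffOn_frameCoeff_field he Z j)]

end Forward

end DerivationAlongVF

/-! ### Frames given by matrices in a chart -/

section ChartFrames

variable {E : Type*} [NormedAddCommGroup E] [NormedSpace ℝ E] [FiniteDimensional ℝ E]
  {M : Type*} [TopologicalSpace M] [ChartedSpace E M] [IsManifold 𝓘(ℝ, E) ∞ M]
  {φ : OpenPartialHomeomorph M E} (hφ : φ ∈ IsManifold.maximalAtlas 𝓘(ℝ, E) ∞ M)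

/-- The frame whose coordinate representation in the chart `φ` is the field of matrices `B`. -/
def chartFrame (φ : OpenPartialHomeomorph M E) (B : E → E →L[ℝ] E) (j : Idx E) (p : M) :
    TangentSpace 𝓘(ℝ, E) p :=
  chartDerivInv φ p (B (φ p) (finBasis ℝ E j))

include hφ in
theorem isFrame_chartFrame {B : E → E →L[ℝ] E} {W : Set E} (hW : IsOpen W)
    (hB : ContDiffOn ℝ ∞ B W) (hBu : ∀ x ∈ W, IsUnit (B x)) :
    IsFrame (chartFrame φ B) (φ.source ∩ φ ⁻¹' W) := by
  have : CompleteSpace E := FiniteDimensional.complete ℝ E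
  have hb : ∀ p ∈ φ.source ∩ φ ⁻¹' W, ∃ b : Basis (Idx E) ℝ (TangentSpace 𝓘(ℝ, E) p),
      ∀ j, b j = chartFrame φ B j p := by
    intro p hp
    have h1 : Function.Bijective ((chartDerivInv φ p).comp (B (φ p))) := by
      refine Function.Bijective.comp (g := chartDerivInv φ p) ⟨?_, ?_⟩
        (ContinuousLinearMap.isUnit_iff_bijective.1 (hBu _ hp.2))
      · exact Function.LeftInverse.injective (chartDeriv_chartDerivInv hφ hp.1)
      · exact Function.LeftInverse.surjective (chartDerivInv_chartDeriv hφ hp.1)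
    exact ⟨(finBasis ℝ E).map (LinearEquiv.ofBijective
      ((chartDerivInv φ p).comp (B (φ p))).toLinearMap h1), fun j => rfl⟩
  refine ⟨φ.continuousOn.isOpen_inter_preimage φ.open_source hW, ⟨?_, ?_, ?_⟩⟩
  · intro p hp
    obtain ⟨b, hb⟩ := hb p hp
    have := b.linearIndependent
    rwa [show (b : Idx E → TangentSpace 𝓘(ℝ, E) p) = fun j => chartFrame φ B j p from funext hb]
      at this
  · intro p hp
    obtain ⟨b, hb⟩ := hb p hp
    have := b.span_eq
    rw [show (b : Idx E → TangentSpace 𝓘(ℝ, E) p) = fun j => chartFrame φ B j p from funext hb]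
      at this
    exact this.ge
  · intro j
    refine contMDiffOn_chartDerivInv (f := fun p => B (φ p) (finBasis ℝ E j)) hφ
      inter_subset_left fun p hp => ?_
    refine (contMDiffAt_comp_chart hφ (h := fun x => B x (finBasis ℝ E j)) hp.1
      ?_).contMDiffWithinAt
    exact ((hB.clm_apply contDiffOn_const).contDiffAt (hW.mem_nhds hp.2))

include hφ in
theorem isFrame_coordFrame : IsFrame (coordFrame φ) φ.source := by
  have h := isFrame_chartFrame hφ (B := fun _ => 1) isOpen_univ contDiffOn_const
    fun _ _ => isUnit_one
  rwa [preimage_univ, inter_univ] at h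

end ChartFrames

/-! ### Normality as an equation for the coefficients -/

namespace DerivationAlongVF

variable {E : Type*} [NormedAddCommGroup E] [NormedSpace ℝ E] [FiniteDimensional ℝ E]
  {M : Type*} [TopologicalSpace M] [ChartedSpace E M] [IsManifold 𝓘(ℝ, E) ∞ M] [T2Space M]
  (D : DerivationAlongVF E M)

theorem linearAt_iff {p : M} : D.LinearAt p ↔ D.PointLinear p := by
  refine ⟨D.pointLinear_of_linearAt, fun h => ?_⟩
  have he := isFrame_coordFrame (IsManifold.chart_mem_maximalAtlas (I := 𝓘(ℝ, E)) (n := ∞) p)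
  exact ⟨_, _, mem_chart_source E p, he, (D.linearInFrameAt_iff he (mem_chart_source E p)).2 h⟩

/-- Coefficients of `D`, in the chart `φ`, at the points of `W` where it is linear. -/
structure IsConnectionForm (φ : OpenPartialHomeomorph M E) (W : Set E)
    (Γ : E → E →L[ℝ] E →L[ℝ] E) : Prop where
  isOpen : IsOpen W
  subset_target : W ⊆ φ.target
  contDiffOn : ContDiffOn ℝ ∞ Γ W
  chartRep_cov : ∀ x ∈ W, D.PointLinear (φ.symm x) → ∀ X Y : VF E M,
    chartRep φ (D.cov X Y) (φ.symm x) = along X (chartRep φ Y) (φ.symm x) +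
      Γ x (chartRep φ X (φ.symm x)) (chartRep φ Y (φ.symm x))

theorem exists_isConnectionForm {φ : OpenPartialHomeomorph M E}
    (hφ : φ ∈ IsManifold.maximalAtlas 𝓘(ℝ, E) ∞ M) {x₀ : E} (hx₀ : x₀ ∈ φ.target) :
    ∃ W Γ, D.IsConnectionForm φ W Γ ∧ x₀ ∈ W := by
  obtain ⟨Γ, V, hV, hpV, hVφ, hΓ, h⟩ := D.exists_connectionForm hφ (φ.map_target hx₀)
  refine ⟨φ.target ∩ φ.symm ⁻¹' V, Γ ∘ φ.symm,
    ⟨φ.symm.continuousOn.isOpen_inter_preimage φ.open_target hV, inter_subset_left,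
      fun x hx => ?_, fun x hx => h _ hx.2⟩, hx₀, hpV⟩
  exact (contDiffAt_comp_symm hφ hx.1 (hΓ.contMDiffAt (hV.mem_nhds hx.2))).contDiffWithinAt

variable {D} {φ : OpenPartialHomeomorph M E} (hφ : φ ∈ IsManifold.maximalAtlas 𝓘(ℝ, E) ∞ M)
  {W : Set E} {Γ : E → E →L[ℝ] E →L[ℝ] E} (hΓ : D.IsConnectionForm φ W Γ)
include hφ hΓ

theorem IsConnectionForm.cov_eq_zero {p : M} (hp : p ∈ φ.source) (hpW : φ p ∈ W)
    (hl : D.PointLinear p) {X Y : VF E M}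
    (h : along X (chartRep φ Y) p + Γ (φ p) (chartRep φ X p) (chartRep φ Y p) = 0) :
    D.cov X Y p = 0 := by
  have h1 := hΓ.chartRep_cov (φ p) hpW
  rw [φ.left_inv hp] at h1
  have h2 : chartDeriv φ p (D.cov X Y p) = 0 := (h1 hl X Y).trans h
  rw [← chartDerivInv_chartDeriv hφ hp (D.cov X Y p), h2]
  exact map_zero (chartDerivInv φ p)

/-- The coordinates of D_X e_j are (DB(X) + Γ(X)B) b_j. Only the first derivative of B at the points
of S matters, so B need not solve the equation elsewhere. -/
theorem IsConnectionForm.normalOn_chartFrame {B : E → E →L[ℝ] E} {S : Set M} (hS : S ⊆ φ.source)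
    (hSW : ∀ p ∈ S, φ p ∈ W) (hl : ∀ p ∈ S, D.PointLinear p)
    (hB : ∀ p ∈ S, DifferentiableAt ℝ B (φ p))
    (h : ∀ p ∈ S, ∀ v, fderiv ℝ B (φ p) v = -(Γ (φ p) v * B (φ p))) :
    D.NormalOn (chartFrame φ B) S := by
  rw [normalOn_iff]
  intro p hp X j Y hY
  have hpφ := hS hp
  refine hΓ.cov_eq_zero hφ hpφ (hSW p hp) (hl p hp) ?_
  have h1 : ∀ᶠ q in 𝓝 p, chartRep φ Y q = ((fun x => B x (finBasis ℝ E j)) ∘ φ) q := by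
    filter_upwards [hY, φ.open_source.mem_nhds hpφ] with q hq hqφ
    rw [chartRep, hq]
    exact chartDeriv_chartDerivInv hφ hqφ _
  rw [along_congr h1, h1.self_of_nhds, along_comp_chart hφ X hpφ
    ((hB p hp).clm_apply (differentiableAt_const _)),
    fderiv_clm_apply (hB p hp) (differentiableAt_const _)]
  simp [h p hp]

/-- The transformed coordinates are normal where the Hessian of the transformation compensates the
coefficients. -/
theorem IsConnectionForm.normalOn_coordFrame {φ' : OpenPartialHomeomorph M E}
    (hφ' : φ' ∈ IsManifold.maximalAtlas 𝓘(ℝ, E) ∞ M) {ψ : E → E}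
    (hsub : φ'.source ⊆ φ.source) (hφψ : ∀ q ∈ φ'.source, φ' q = ψ (φ q))
    (hψ : ∀ q ∈ φ'.source, ContDiffAt ℝ ∞ ψ (φ q)) {S : Set M} (hS : S ⊆ φ'.source)
    (hSW : ∀ p ∈ S, φ p ∈ W) (hl : ∀ p ∈ S, D.PointLinear p)
    (h : ∀ p ∈ S, ∀ v w,
      fderiv ℝ (fderiv ℝ ψ) (φ p) v w = fderiv ℝ ψ (φ p) (Γ (φ p) v w)) :
    D.NormalOn (coordFrame φ') S := by
  have hder : ∀ q ∈ φ'.source, ∀ v, chartDeriv φ' q v = fderiv ℝ ψ (φ q) (chartDeriv φ q v) := by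
    intro q hq v
    have h1 : vderiv (E := E) φ' q = vderiv (E := E) (ψ ∘ φ) q := by
      refine vderiv_congr ?_
      filter_upwards [φ'.open_source.mem_nhds hq] with q' hq' using hφψ q' hq'
    have h2 := vderiv_comp_chart hφ (hsub hq) ((hψ q hq).differentiableAt (by simp))
    exact DFunLike.congr_fun (h1.trans h2) v
  rw [normalOn_iff]
  intro p hp X j Y hY
  have hpφ' := hS hp
  have hpφ := hsub hpφ'
  refine hΓ.cov_eq_zero hφ hpφ (hSW p hp) (hl p hp) ?_
  -- A coordinate field of the new chart satisfies Dψ(Y) = const. Differentiating along X gives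
  -- D²ψ(X, Y) + Dψ(X(Y)) = 0, which by hypothesis is Dψ applied to the coordinates of D_X Y, and Dψ
  -- is injective.
  have h1 : ∀ᶠ q in 𝓝 p, ((fderiv ℝ ψ ∘ φ) q) (chartRep φ Y q) = finBasis ℝ E j := by
    filter_upwards [hY, φ'.open_source.mem_nhds hpφ'] with q hq hqφ
    refine (hder q hqφ (Y q)).symm.trans ?_
    rw [hq]
    exact chartDeriv_chartDerivInv hφ' hqφ _
  have hx := φ.map_source hpφ
  have hk := contDiffAt_chartRep_symm hφ Y hx
  have h2 : ∀ᶠ x in 𝓝 (φ p), fderiv ℝ ψ x ((chartRep φ Y ∘ φ.symm) x) = finBasis ℝ E j := by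
    have h3 : Tendsto φ.symm (𝓝 (φ p)) (𝓝 p) := by
      have := φ.symm.continuousAt hx
      rwa [ContinuousAt, φ.left_inv hpφ] at this
    filter_upwards [h3.eventually h1, φ.open_target.mem_nhds hx] with x h4 h5
    rwa [Function.comp, φ.right_inv h5] at h4
  have hdψ : DifferentiableAt ℝ (fderiv ℝ ψ) (φ p) :=
    ((hψ p hpφ').fderiv_right (m := 1)
      (by exact WithTop.coe_le_coe.2 le_top)).differentiableAt (by simp)
  have h6 : fderiv ℝ ψ (φ p) (along X (chartRep φ Y) p +
      Γ (φ p) (chartRep φ X p) (chartRep φ Y p)) = 0 := by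
    have h7 := fderiv_clm_apply hdψ (hk.differentiableAt (by simp))
    rw [EventuallyEq.fderiv_eq (h2 : _ =ᶠ[𝓝 (φ p)] fun _ => finBasis ℝ E j)] at h7
    have h8 := DFunLike.congr_fun h7 (chartRep φ X p)
    simp only [fderiv_const_apply, zero_apply, add_apply, ContinuousLinearMap.comp_apply,
      ContinuousLinearMap.flip_apply, Function.comp_apply, φ.left_inv hpφ, h p hp] at h8
    rw [map_add, along_eq_fderiv hφ X hpφ (contMDiffAt_chartRep_field hφ Y hpφ)]
    exact h8.symm
  have h9 : ∀ w, fderiv ℝ ψ (φ p) w = 0 → w = 0 := by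
    intro w hw
    have h10 := hder p hpφ' (chartDerivInv φ p w)
    rw [chartDeriv_chartDerivInv hφ hpφ, hw] at h10
    have h11 := chartDerivInv_chartDeriv hφ' hpφ' (chartDerivInv φ p w)
    rw [h10, map_zero] at h11
    rw [← chartDeriv_chartDerivInv hφ hpφ w, ← h11, map_zero]
  exact h9 _ h6

end DerivationAlongVF

/-! ### Changes of coordinates -/

section LocalDiffeomorphisms

variable {E : Type*} [NormedAddCommGroup E] [NormedSpace ℝ E] [CompleteSpace E]

/-- The inverse function theorem. The source is restricted to the points where the derivative is
invertible, so that the inverse is smooth on the whole target and not just at the image of a. -/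
theorem exists_localDiffeo {ψ : E → E} {V : Set E} (hV : IsOpen V) (hψ : ContDiffOn ℝ ∞ ψ V)
    {a : E} (ha : a ∈ V) (hu : IsUnit (fderiv ℝ ψ a)) :
    ∃ Ψ : OpenPartialHomeomorph E E, a ∈ Ψ.source ∧ Ψ.source ⊆ V ∧ (∀ x, Ψ x = ψ x) ∧
      ContDiffOn ℝ ∞ Ψ Ψ.source ∧ ContDiffOn ℝ ∞ Ψ.symm Ψ.target := by
  have hda : ∀ x ∈ V, HasFDerivAt ψ (fderiv ℝ ψ x) x := fun x hx =>
    ((hψ.contDiffAt (hV.mem_nhds hx)).differentiableAt (by simp)).hasFDerivAt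
  have hequiv : ∀ x, IsUnit (fderiv ℝ ψ x) → ∃ f' : E ≃L[ℝ] E, (f' : E →L[ℝ] E) = fderiv ℝ ψ x := by
    rintro x ⟨u, hu⟩
    exact ⟨ContinuousLinearEquiv.ofUnit u, by rw [← hu]; rfl⟩
  have hopen : IsOpen (V ∩ fderiv ℝ ψ ⁻¹' {T | IsUnit T}) :=
    (((contDiffOn_infty_iff_fderiv_of_isOpen hV).1 hψ).2.continuousOn).isOpen_inter_preimage hV
      Units.isOpen
  obtain ⟨f', hf'⟩ := hequiv a hu
  have hfa : HasFDerivAt ψ (f' : E →L[ℝ] E) a := hf' ▸ hda a ha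
  let Ψ := ((hψ.contDiffAt (hV.mem_nhds ha)).toOpenPartialHomeomorph ψ hfa (by simp)).restrOpen
    _ hopen
  have hsub : Ψ.source ⊆ V ∩ fderiv ℝ ψ ⁻¹' {T | IsUnit T} := fun x hx => hx.2
  refine ⟨Ψ, ⟨ContDiffAt.mem_toOpenPartialHomeomorph_source _ hfa _, ha, hu⟩,
    fun x hx => (hsub hx).1, fun x => rfl, hψ.mono fun x hx => (hsub hx).1, fun y hy => ?_⟩
  have hx := hsub (Ψ.map_target hy)
  obtain ⟨g', hg'⟩ := hequiv _ hx.2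
  exact (Ψ.contDiffAt_symm (f₀' := g') hy (hg' ▸ hda _ hx.1)
    (hψ.contDiffAt (hV.mem_nhds hx.1))).contDiffWithinAt

variable {M : Type*} [TopologicalSpace M] [ChartedSpace E M] [IsManifold 𝓘(ℝ, E) ∞ M]
  {φ : OpenPartialHomeomorph M E} (hφ : φ ∈ IsManifold.maximalAtlas 𝓘(ℝ, E) ∞ M)

omit [CompleteSpace E] in
include hφ in
theorem trans_mem_maximalAtlas {Ψ : OpenPartialHomeomorph E E}
    (h : ContDiffOn ℝ ∞ Ψ Ψ.source) (h' : ContDiffOn ℝ ∞ Ψ.symm Ψ.target) :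
    φ.trans Ψ ∈ IsManifold.maximalAtlas 𝓘(ℝ, E) ∞ M := by
  refine OpenPartialHomeomorph.mem_maximalAtlas_of_contMDiffOn _ ?_ ?_
  · exact h.contMDiffOn.comp ((contMDiffOn_of_mem_maximalAtlas hφ).mono fun x hx => hx.1)
      fun x hx => hx.2
  · exact (contMDiffOn_symm_of_mem_maximalAtlas hφ).comp
      (h'.contMDiffOn.mono fun x hx => hx.1) fun x hx => hx.2

include hφ in
theorem exists_chart_comp {p : M} (hp : p ∈ φ.source) {ψ : E → E} {V : Set E} (hV : IsOpen V)
    (hψ : ContDiffOn ℝ ∞ ψ V) (hpV : φ p ∈ V) (hu : IsUnit (fderiv ℝ ψ (φ p))) :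
    ∃ φ' ∈ IsManifold.maximalAtlas 𝓘(ℝ, E) ∞ M, p ∈ φ'.source ∧
      φ'.source ⊆ φ.source ∩ φ ⁻¹' V ∧ ∀ q ∈ φ'.source, φ' q = ψ (φ q) := by
  obtain ⟨Ψ, h1, h2, h3, h4, h5⟩ := exists_localDiffeo hV hψ hpV hu
  exact ⟨φ.trans Ψ, trans_mem_maximalAtlas hφ h4 h5, ⟨hp, h1⟩, fun q hq => ⟨hq.1, h2 hq.2⟩,
    fun q _ => h3 _⟩

end LocalDiffeomorphisms

/-! ### Straightening an immersion -/

section SliceCharts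

variable {E : Type*} [NormedAddCommGroup E] [NormedSpace ℝ E] [FiniteDimensional ℝ E]
  {M : Type*} [TopologicalSpace M] [ChartedSpace E M] [IsManifold 𝓘(ℝ, E) ∞ M]
  {F : Type*} [NormedAddCommGroup F] [NormedSpace ℝ F] [FiniteDimensional ℝ F]
  {N : Type*} [TopologicalSpace N] [ChartedSpace F N] [IsManifold 𝓘(ℝ, F) ∞ N]
  {γ : N → M} {q : N}

omit [FiniteDimensional ℝ F] in
/-- An immersion is linear in suitable coordinates. -/
theorem exists_slice_chart {O : Set N} (hO : IsOpen O) (hq : q ∈ O)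
    (hγ : ContMDiffOn 𝓘(ℝ, F) 𝓘(ℝ, E) ∞ γ O)
    (hinj : Function.Injective (mfderiv 𝓘(ℝ, F) 𝓘(ℝ, E) γ q)) :
    ∃ φ ∈ IsManifold.maximalAtlas 𝓘(ℝ, E) ∞ M, ∃ (L : F →L[ℝ] E) (π : E →L[ℝ] F),
      (∀ u, π (L u) = u) ∧ ∃ ε > 0, ∀ u ∈ Metric.ball (0 : F) ε,
        chartAt F q q + u ∈ (chartAt F q).target ∧ (chartAt F q).symm (chartAt F q q + u) ∈ O ∧
        L u ∈ φ.target ∧ φ.symm (L u) = γ ((chartAt F q).symm (chartAt F q q + u)) := by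
  have : CompleteSpace E := FiniteDimensional.complete ℝ E
  set χ := chartAt F q with hχdef
  have hχ : χ ∈ IsManifold.maximalAtlas 𝓘(ℝ, F) ∞ N := IsManifold.chart_mem_maximalAtlas q
  have hqχ : q ∈ χ.source := mem_chart_source F q
  set φ₀ := chartAt E (γ q) with hφ₀def
  have hφ₀ : φ₀ ∈ IsManifold.maximalAtlas 𝓘(ℝ, E) ∞ M := IsManifold.chart_mem_maximalAtlas (γ q)
  have hpφ₀ : γ q ∈ φ₀.source := mem_chart_source E (γ q)
  have hγq : ContMDiffAt 𝓘(ℝ, F) 𝓘(ℝ, E) ∞ γ q := hγ.contMDiffAt (hO.mem_nhds hq)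
  -- the coordinate representation of the map
  let c : F → N := fun u => χ.symm (χ q + u)
  let g : F → E := fun u => φ₀ (γ (c u))
  have hc0 : c 0 = q := by simp [c, χ.left_inv hqχ]
  have htgt : IsOpen ((fun u => χ q + u) ⁻¹' χ.target) :=
    χ.open_target.preimage (by fun_prop)
  have hcs : ContMDiffOn 𝓘(ℝ, F) 𝓘(ℝ, F) ∞ c ((fun u => χ q + u) ⁻¹' χ.target) := by
    have h1 : ContDiff ℝ ∞ fun u : F => χ q + u := by fun_prop
    exact (contMDiffOn_symm_of_mem_maximalAtlas hχ).comp h1.contMDiff.contMDiffOn fun u hu => hu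
  have h0t : (0 : F) ∈ (fun u => χ q + u) ⁻¹' χ.target := by
    simpa using χ.map_source hqχ
  obtain ⟨O₁, hO₁, hqO₁, hO₁o⟩ : ∃ O₁ : Set N, O₁ ⊆ O ∩ γ ⁻¹' φ₀.source ∧ q ∈ O₁ ∧ IsOpen O₁ :=
    ⟨O ∩ γ ⁻¹' φ₀.source, subset_rfl, ⟨hq, hpφ₀⟩,
      hγ.continuousOn.isOpen_inter_preimage hO φ₀.open_source⟩
  let T : Set F := (fun u => χ q + u) ⁻¹' χ.target ∩ c ⁻¹' O₁
  have hT : IsOpen T := hcs.continuousOn.isOpen_inter_preimage htgt hO₁o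
  have h0T : (0 : F) ∈ T := ⟨h0t, by rw [mem_preimage, hc0]; exact hqO₁⟩
  have hg : ContDiffOn ℝ ∞ g T := by
    refine ContMDiffOn.contDiffOn ?_
    exact (contMDiffOn_of_mem_maximalAtlas hφ₀).comp (hγ.comp (hcs.mono inter_subset_left)
      fun u hu => (hO₁ hu.2).1) fun u hu => (hO₁ hu.2).2
  -- The linear model is the derivative at q of γ in coordinates centred at q; it is injective
  -- because γ is immersive there, and it has a left inverse π since E has finite dimension.
  let L : F →L[ℝ] E := fderiv ℝ g 0
  have hL : Function.Injective L := by
    have h1 : ∀ᶠ q' in 𝓝 q, (φ₀ ∘ γ) q' = ((fun x => g (x - χ q)) ∘ χ) q' := by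
      filter_upwards [χ.open_source.mem_nhds hqχ] with q' hq'
      simp [g, c, χ.left_inv hq']
    have hgd : DifferentiableAt ℝ g (χ q - χ q) := by
      rw [sub_self]
      exact (hg.contDiffAt (hT.mem_nhds h0T)).differentiableAt (by simp)
    have hd : HasFDerivAt (fun x => g (x - χ q)) L (χ q) := by
      have h2 : HasFDerivAt (fun x => x - χ q) (ContinuousLinearMap.id ℝ F) (χ q) :=
        (hasFDerivAt_id _).sub_const _
      have h3 := HasFDerivAt.comp (g := g) (f := fun x => x - χ q) (χ q) hgd.hasFDerivAt h2
      rw [sub_self] at h3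
      exact h3
    have h4 : ∀ v, chartDeriv φ₀ (γ q) (mfderiv 𝓘(ℝ, F) 𝓘(ℝ, E) γ q v) =
        L (chartDeriv χ q v) := by
      intro v
      have h5 := DerivationAlongVF.vderiv_comp_map (hγq.mdifferentiableAt (by simp))
        ((mdifferentiable_of_mem_maximalAtlas hφ₀).mdifferentiableAt hpφ₀) v
      have h6 := vderiv_comp_chart hχ hqχ hd.differentiableAt
      rw [hd.fderiv] at h6
      refine h5.symm.trans ?_
      exact DFunLike.congr_fun ((vderiv_congr h1).trans h6) v
    intro v w hvw
    have h7 : mfderiv 𝓘(ℝ, F) 𝓘(ℝ, E) γ q (chartDerivInv χ q v) =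
        mfderiv 𝓘(ℝ, F) 𝓘(ℝ, E) γ q (chartDerivInv χ q w) := by
      refine (Function.LeftInverse.injective (chartDerivInv_chartDeriv hφ₀ hpφ₀)) ?_
      refine (h4 _).trans (Eq.trans ?_ (h4 _).symm)
      rw [chartDeriv_chartDerivInv hχ hqχ, chartDeriv_chartDerivInv hχ hqχ, hvw]
    exact Function.LeftInverse.injective (chartDeriv_chartDerivInv hχ hqχ) (hinj h7)
  obtain ⟨π₀, hπ₀⟩ := LinearMap.exists_leftInverse_of_injective L.toLinearMap
    (LinearMap.ker_eq_bot.2 hL)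
  let π : E →L[ℝ] F := π₀.toContinuousLinearMap
  have hπ : ∀ u, π (L u) = u := fun u => LinearMap.congr_fun hπ₀ u
  -- f has derivative Lπ + (1 - Lπ) = 1 at 0 and f(Lu) = g(u), so its local inverse carries the
  -- image of γ to the range of L.
  let f : E → E := fun x => g (π x) + complProj L π x
  have hV : IsOpen (π ⁻¹' T) := hT.preimage π.continuous
  have h0V : (0 : E) ∈ π ⁻¹' T := by simpa using h0T
  have hf : ContDiffOn ℝ ∞ f (π ⁻¹' T) :=
    (hg.comp π.contDiff.contDiffOn fun x hx => hx).add (complProj L π).contDiff.contDiffOn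
  have hf0 : fderiv ℝ f 0 = 1 := by
    have h1 : HasFDerivAt g L (π 0) := by
      rw [map_zero]
      exact ((hg.contDiffAt (hT.mem_nhds h0T)).differentiableAt (by simp)).hasFDerivAt
    have h2 : HasFDerivAt f _ 0 :=
      (HasFDerivAt.comp 0 h1 π.hasFDerivAt).add (complProj L π).hasFDerivAt
    rw [h2.fderiv]
    ext x
    simp [complProj_apply]
  obtain ⟨Ψ, hΨ0, hΨV, hΨf, hΨ, hΨ'⟩ := exists_localDiffeo hV hf h0V (by rw [hf0]; exact isUnit_one)
  have hfL : ∀ u, Ψ (L u) = g u := fun u => by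
    rw [hΨf]
    simp [f, hπ, complProj_map hπ]
  have hnear : T ∩ L ⁻¹' Ψ.source ∈ 𝓝 (0 : F) :=
    (hT.inter (Ψ.open_source.preimage L.continuous)).mem_nhds ⟨h0T, by simpa using hΨ0⟩
  obtain ⟨ε, hε, hball⟩ := Metric.mem_nhds_iff.1 hnear
  refine ⟨φ₀.trans Ψ.symm, trans_mem_maximalAtlas hφ₀ hΨ' (by simpa using hΨ), L, π, hπ, ε, hε,
    fun u hu => ?_⟩
  obtain ⟨huT, huΨ⟩ := hball hu
  have hcu := hO₁ huT.2
  refine ⟨huT.1, hcu.1, ⟨huΨ, ?_⟩, ?_⟩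
  · change Ψ (L u) ∈ φ₀.target
    rw [hfL]
    exact φ₀.map_source hcu.2
  · change φ₀.symm (Ψ (L u)) = _
    rw [hfL]
    exact φ₀.left_inv hcu.2

end SliceCharts

/-! ### Torsion and curvature as conditions on the coefficients; normal slices -/

namespace DerivationAlongVF

variable {E : Type*} [NormedAddCommGroup E] [NormedSpace ℝ E] [FiniteDimensional ℝ E]
  {M : Type*} [TopologicalSpace M] [ChartedSpace E M] [IsManifold 𝓘(ℝ, E) ∞ M] [T2Space M]
  {D : DerivationAlongVF E M} {F : Type*} [NormedAddCommGroup F] [NormedSpace ℝ F]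
  {φ : OpenPartialHomeomorph M E} (hφ : φ ∈ IsManifold.maximalAtlas 𝓘(ℝ, E) ∞ M)
  {W : Set E} {Γ : E → E →L[ℝ] E →L[ℝ] E} (hΓ : D.IsConnectionForm φ W Γ)

theorem exists_constant_field {p : M} (hp : p ∈ φ.source)
    (hφ : φ ∈ IsManifold.maximalAtlas 𝓘(ℝ, E) ∞ M) (v : E) :
    ∃ X : VF E M, ∀ᶠ q in 𝓝 p, chartRep φ X q = v := by
  obtain ⟨X, hX⟩ := exists_vectorField_chart hφ φ.open_source subset_rfl hp
    (contMDiffOn_const (c := v))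
  refine ⟨X, ?_⟩
  filter_upwards [hX, φ.open_source.mem_nhds hp] with q hq hqφ
  rw [chartRep, hq]
  exact chartDeriv_chartDerivInv hφ hqφ v

omit [FiniteDimensional ℝ E] [T2Space M] in
theorem along_eq_zero_of_eventually_const {G : Type*} [NormedAddCommGroup G] [NormedSpace ℝ G]
    {X : VF E M} {f : M → G} {p : M} {c : G} (h : ∀ᶠ q in 𝓝 p, f q = c) : along X f p = 0 := by
  rw [along_congr h, along, vderiv, mfderiv_const]
  rfl

include hφ hΓ

/-- For fields with constant coordinates v and w near p the bracket and the derivative terms vanish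
at p, so the torsion is Γ(v, w) - Γ(w, v). -/
theorem IsConnectionForm.symm_of_torsion {p : M} (hp : p ∈ φ.source) (hpW : φ p ∈ W)
    (hl : D.PointLinear p) (ht : ∀ X Y : VF E M, D.torsion X Y p = 0) (v w : E) :
    Γ (φ p) v w = Γ (φ p) w v := by
  obtain ⟨X, hX⟩ := exists_constant_field hp hφ v
  obtain ⟨Y, hY⟩ := exists_constant_field hp hφ w
  have h1 := fun X Y => hΓ.chartRep_cov (φ p) hpW (by rwa [φ.left_inv hp]) X Y
  simp only [φ.left_inv hp] at h1
  have h2 : chartRep φ (D.cov X Y) p - chartRep φ (D.cov Y X) p = chartRep φ (bracket X Y) p := by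
    have := congrArg (chartDeriv φ p) (torsion_eq_zero_iff D |>.1 (ht X Y))
    exact (map_sub (chartDeriv φ p) _ _).symm.trans this
  rw [h1, h1, chartRep_bracket hφ X Y hp, along_eq_zero_of_eventually_const hX,
    along_eq_zero_of_eventually_const hY, hX.self_of_nhds, hY.self_of_nhds, zero_add, zero_add,
    sub_zero, sub_eq_zero] at h2
  exact h2

/-- For fields with constant coordinates, the first two tangent to the slice, the bracket term drops
out and the remaining curvature is the curvature of the restricted form. -/
theorem IsConnectionForm.flat_of_curvature {L : F →L[ℝ] E} {u₀ : F} (hu₀ : L u₀ ∈ W)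
    (hlin : ∀ᶠ u in 𝓝 u₀, D.PointLinear (φ.symm (L u))) {v w : F}
    (hflat : ∀ X Y Z : VF E M, (∀ᶠ q in 𝓝 (φ.symm (L u₀)), chartRep φ X q = L v) →
      (∀ᶠ q in 𝓝 (φ.symm (L u₀)), chartRep φ Y q = L w) →
        D.curvature X Y Z (φ.symm (L u₀)) = 0) :
    fderiv ℝ (fun u => (Γ (L u)).comp L) u₀ v w - fderiv ℝ (fun u => (Γ (L u)).comp L) u₀ w v +
      (Γ (L u₀)).comp L v * (Γ (L u₀)).comp L w - (Γ (L u₀)).comp L w * (Γ (L u₀)).comp L v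
        = 0 := by
  set p := φ.symm (L u₀) with hp
  have hut : L u₀ ∈ φ.target := hΓ.subset_target hu₀
  have hpφ : p ∈ φ.source := φ.map_target hut
  have hpx : φ p = L u₀ := φ.right_inv hut
  have hcont : ContinuousAt (fun u => φ.symm (L u)) u₀ :=
    (φ.symm.continuousAt hut).comp (f := L) L.continuous.continuousAt
  have hWn : ∀ᶠ u in 𝓝 u₀, L u ∈ W :=
    L.continuous.continuousAt.eventually (hΓ.isOpen.mem_nhds hu₀)
  have hΓL : DifferentiableAt ℝ (fun u => Γ (L u)) u₀ :=
    ((hΓ.contDiffOn.contDiffAt (hΓ.isOpen.mem_nhds hu₀)).comp u₀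
      L.contDiff.contDiffAt).differentiableAt (by simp)
  have hηd : DifferentiableAt ℝ (fun u => (Γ (L u)).comp L) u₀ :=
    hΓL.clm_comp (differentiableAt_const L)
  -- Γ describes D_Y Z only at points of linearity, that is, on the slice. The outer derivative is
  -- taken in the direction L v, so the chain rule along L needs only these values.
  have key : ∀ {X Y Z : VF E M} {v w : F} {z : E}, (∀ᶠ q in 𝓝 p, chartRep φ X q = L v) →
      (∀ᶠ q in 𝓝 p, chartRep φ Y q = L w) → (∀ᶠ q in 𝓝 p, chartRep φ Z q = z) →
        chartRep φ (D.cov X (D.cov Y Z)) p =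
          fderiv ℝ (fun u => (Γ (L u)).comp L) u₀ v w z + Γ (L u₀) (L v) (Γ (L u₀) (L w) z) := by
    intro X Y Z v w z hX hY hZ
    have h1 : ∀ᶠ u in 𝓝 u₀, chartRep φ (D.cov Y Z) (φ.symm (L u)) =
        ((Γ (L u)).comp L) w z := by
      have hZ' : ∀ᶠ q in 𝓝 p, along Y (chartRep φ Z) q = 0 := by
        filter_upwards [eventually_eventually_nhds.2 hZ] with q hq
        exact along_eq_zero_of_eventually_const hq
      filter_upwards [hlin, hWn, hcont.eventually hY, hcont.eventually hZ, hcont.eventually hZ']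
        with u h2 h3 h4 h5 h6
      rw [hΓ.chartRep_cov _ h3 h2, h4, h5, h6, zero_add]
      rfl
    rw [hΓ.chartRep_cov _ hu₀ hlin.self_of_nhds, h1.self_of_nhds, hX.self_of_nhds]
    congr 1
    rw [along_eq_fderiv hφ X hpφ (contMDiffAt_chartRep_field hφ _ hpφ), hX.self_of_nhds, hpx]
    have h7 : HasFDerivAt (chartRep φ (D.cov Y Z) ∘ φ.symm)
        (fderiv ℝ (chartRep φ (D.cov Y Z) ∘ φ.symm) (L u₀)) (L u₀) :=
      ((contDiffAt_chartRep_symm hφ _ hut).differentiableAt (by simp)).hasFDerivAt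
    have h8 := h7.comp u₀ L.hasFDerivAt
    have h9 : fderiv ℝ ((chartRep φ (D.cov Y Z) ∘ φ.symm) ∘ L) u₀ =
        fderiv ℝ (fun u => (Γ (L u)).comp L w z) u₀ := EventuallyEq.fderiv_eq h1
    rw [h8.fderiv] at h9
    have h10 := DFunLike.congr_fun h9 v
    rw [fderiv_clm_apply (hηd.clm_apply (differentiableAt_const w)) (differentiableAt_const z),
      fderiv_clm_apply hηd (differentiableAt_const w)] at h10
    simpa using h10
  ext z
  obtain ⟨X, hX⟩ := exists_constant_field hpφ hφ (L v)
  obtain ⟨Y, hY⟩ := exists_constant_field hpφ hφ (L w)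
  obtain ⟨Z, hZ⟩ := exists_constant_field hpφ hφ z
  have h1 := congrArg (chartDeriv φ p) ((curvature_eq_zero_iff D).1 (hflat X Y Z hX hY))
  have h2 : chartRep φ (D.cov X (D.cov Y Z)) p - chartRep φ (D.cov Y (D.cov X Z)) p =
      chartRep φ (D.cov (bracket X Y) Z) p := (map_sub (chartDeriv φ p) _ _).symm.trans h1
  have h3 : chartRep φ (D.cov (bracket X Y) Z) p = 0 := by
    rw [hΓ.chartRep_cov _ hu₀ hlin.self_of_nhds, chartRep_bracket hφ X Y hpφ,
      along_eq_zero_of_eventually_const hX, along_eq_zero_of_eventually_const hY,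
      along_eq_zero_of_eventually_const hZ]
    simp
  rw [h3, key hX hY hZ, key hY hX hZ] at h2
  refine Eq.trans ?_ h2
  simp only [sub_apply, add_apply, mul_apply_eq_comp, ContinuousLinearMap.comp_apply]
  abel

/-- Frames and coordinates normal along the part of a slice, with flat coefficients, where `D` is
linear. -/
theorem IsConnectionForm.exists_normal_slice (h0 : (0 : E) ∈ W) {L : F →L[ℝ] E} {π : E →L[ℝ] F}
    (hπ : ∀ u, π (L u) = u) {s : Set F} (hs : s ∈ 𝓝 0) (hsW : ∀ u ∈ s, L u ∈ W)
    {K : Set F} (hlin : ∀ u ∈ s ∩ K, D.PointLinear (φ.symm (L u)))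
    (hflat : ∀ u ∈ s, ∀ v w, fderiv ℝ (fun u => (Γ (L u)).comp L) u v w -
      fderiv ℝ (fun u => (Γ (L u)).comp L) u w v + (Γ (L u)).comp L v * (Γ (L u)).comp L w -
        (Γ (L u)).comp L w * (Γ (L u)).comp L v = 0) :
    (∃ r > 0, D.HasNormalFrame ((fun u => φ.symm (L u)) '' (Metric.ball 0 r ∩ K))) ∧
    ((∀ u ∈ s, ∀ v w, Γ (L u) (L v) (L w) = Γ (L u) (L w) (L v)) →
      (∀ u ∈ s ∩ K, ∀ v w, Γ (L u) v w = Γ (L u) w v) →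
        ∃ r > 0, D.HasNormalCoords ((fun u => φ.symm (L u)) '' (Metric.ball 0 r ∩ K))) := by
  have : CompleteSpace E := FiniteDimensional.complete ℝ E
  have hη : ContDiffOn ℝ ∞ (fun u => (Γ (L u)).comp L) s :=
    (hΓ.contDiffOn.comp L.contDiff.contDiffOn hsW).clm_comp contDiffOn_const
  -- The algebra is that of the endomorphisms of E. The norm of the identity is only bounded by 1,
  -- which covers E = 0.
  obtain ⟨r, hr, hrs, A, hA, hA'⟩ := exists_parallel_of_flat
    (ContinuousLinearMap.norm_id_le (𝕜 := ℝ) (E := E)) hs hη hflat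
  have hAd : ∀ u ∈ Metric.ball (0 : F) r, ∀ v, fderiv ℝ A u v = -(Γ (L u) (L v) * A u) := by
    intro u hu v
    rw [(hA' u hu).2.fderiv]
    rfl
  have h0r : (0 : F) ∈ Metric.ball 0 r := Metric.mem_ball_self hr
  have hsmall : ∀ {V : Set E}, IsOpen V → (0 : E) ∈ V → ∃ r' > 0, Metric.ball (0 : F) r' ⊆
      Metric.ball 0 r ∩ L ⁻¹' V := fun {V} hV h0V =>
    Metric.mem_nhds_iff.1 ((Metric.isOpen_ball.inter (hV.preimage L.continuous)).mem_nhds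
      ⟨h0r, by simpa using h0V⟩)
  constructor
  · obtain ⟨V, B, hV, h0V, hVW, hB, hBu, hBd⟩ := exists_first_order_parallel hπ hΓ.isOpen h0
      hΓ.contDiffOn Metric.isOpen_ball h0r (fun u hu => hsW u (hrs hu)) hA (hA' 0 h0r).1 hAd
    obtain ⟨r', hr', hr'V⟩ := hsmall hV h0V
    have hx : ∀ u ∈ Metric.ball (0 : F) r', φ (φ.symm (L u)) = L u := fun u hu =>
      φ.right_inv (hΓ.subset_target (hVW (hr'V hu).2))
    refine ⟨r', hr', φ.source ∩ φ ⁻¹' V, chartFrame φ B, ?_, isFrame_chartFrame hφ hV hB hBu, ?_⟩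
    · rintro _ ⟨u, ⟨hu, huK⟩, rfl⟩
      refine ⟨φ.map_target (hΓ.subset_target (hVW (hr'V hu).2)), ?_⟩
      rw [mem_preimage, hx u hu]
      exact (hr'V hu).2
    · refine hΓ.normalOn_chartFrame hφ ?_ ?_ ?_ ?_ ?_ <;> rintro _ ⟨u, ⟨hu, huK⟩, rfl⟩ <;>
        simp only [hx u hu]
      · exact φ.map_target (hΓ.subset_target (hVW (hr'V hu).2))
      · exact hVW (hr'V hu).2
      · exact hlin u ⟨hrs (hr'V hu).1, huK⟩
      · exact (hB.contDiffAt (hV.mem_nhds (hr'V hu).2)).differentiableAt (by simp)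
      · exact hBd u (hr'V hu).2
  · intro hsymT hsym
    obtain ⟨V, ψ, hV, h0V, hVW, hψ, hψ0, hψd⟩ := exists_normal_change hπ hΓ.isOpen h0
      hΓ.contDiffOn hr (fun u hu => hsW u (hrs hu)) hA (fun u hu => (hA' u hu).1) hAd
      (fun u hu => hsymT u (hrs hu))
    have h0t := hΓ.subset_target h0
    have h00 : φ (φ.symm 0) = 0 := φ.right_inv h0t
    obtain ⟨φ', hφ', h0φ', hsub, hφψ⟩ := exists_chart_comp hφ (φ.map_target h0t) hV hψ
      (by rwa [h00]) (by rwa [h00])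
    have hV' : IsOpen (V ∩ (φ.target ∩ φ.symm ⁻¹' φ'.source)) :=
      hV.inter (φ.symm.continuousOn.isOpen_inter_preimage φ.open_target φ'.open_source)
    obtain ⟨r', hr', hr'V⟩ := hsmall hV' ⟨h0V, h0t, h0φ'⟩
    have hx : ∀ u ∈ Metric.ball (0 : F) r', φ (φ.symm (L u)) = L u := fun u hu =>
      φ.right_inv (hr'V hu).2.2.1
    have hsrc : (fun u => φ.symm (L u)) '' (Metric.ball 0 r' ∩ K) ⊆ φ'.source := by
      rintro _ ⟨u, ⟨hu, huK⟩, rfl⟩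
      exact (hr'V hu).2.2.2
    refine ⟨r', hr', φ', hφ', hsrc, hΓ.normalOn_coordFrame hφ hφ' (fun q hq => (hsub hq).1) hφψ
      (fun q hq => hψ.contDiffAt (hV.mem_nhds (hsub hq).2)) hsrc ?_ ?_ ?_⟩ <;>
      rintro _ ⟨u, ⟨hu, huK⟩, rfl⟩ <;> simp only [hx u hu]
    · exact hVW (hr'V hu).2.1
    · exact hlin u ⟨hrs (hr'V hu).1, huK⟩
    · exact hψd u (hr'V hu).2.1 (hsym u ⟨hrs (hr'V hu).1, huK⟩)

end DerivationAlongVF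

/-! ### Restriction of normality, and the general local existence theorem -/

namespace DerivationAlongVF

variable {E : Type*} [NormedAddCommGroup E] [NormedSpace ℝ E] [FiniteDimensional ℝ E]
  {M : Type*} [TopologicalSpace M] [ChartedSpace E M] [IsManifold 𝓘(ℝ, E) ∞ M]

section Mono

variable {D : DerivationAlongVF E M} {S S' : Set M}

theorem NormalOn.mono {e : Idx E → (p : M) → TangentSpace 𝓘(ℝ, E) p} (h : D.NormalOn e S)
    (hS : S' ⊆ S) : D.NormalOn e S' := fun p hp => h p (hS hp)

theorem HasNormalFrame.mono (h : D.HasNormalFrame S) (hS : S' ⊆ S) : D.HasNormalFrame S' := by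
  obtain ⟨V, e, hV, he, hn⟩ := h
  exact ⟨V, e, hS.trans hV, he, hn.mono hS⟩

theorem HasNormalCoords.mono (h : D.HasNormalCoords S) (hS : S' ⊆ S) : D.HasNormalCoords S' := by
  obtain ⟨φ, hφ, hSφ, hn⟩ := h
  exact ⟨φ, hφ, hS.trans hSφ, hn.mono hS⟩

theorem HasNormalCoords.hasNormalFrame (h : D.HasNormalCoords S) : D.HasNormalFrame S := by
  obtain ⟨φ, hφ, hSφ, hn⟩ := h
  exact ⟨φ.source, coordFrame φ, hSφ, isFrame_coordFrame hφ, hn⟩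

variable [T2Space M]

theorem HasNormalFrame.pointLinear (h : D.HasNormalFrame S) {p : M} (hp : p ∈ S) :
    D.PointLinear p := by
  obtain ⟨V, e, hV, he, hn⟩ := h
  exact D.pointLinear_of_normalOn he hV hn hp

theorem HasNormalFrame.linearOn (h : D.HasNormalFrame S) : D.LinearOn S := fun _ hp =>
  D.linearAt_iff.2 (h.pointLinear hp)

/-- In normal coordinates D_X Y has the coordinates X(Y) on S, so D_X Y - D_Y X is the coordinate
expression of the bracket. -/
theorem HasNormalCoords.torsionlessOn (h : D.HasNormalCoords S) : D.TorsionlessOn S := by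
  obtain ⟨φ, hφ, hSφ, hn⟩ := h
  intro p hp X Y
  have hpφ := hSφ hp
  have he := isFrame_coordFrame hφ
  have hc : ∀ X Y : VF E M, chartRep φ (D.cov X Y) p = along X (chartRep φ Y) p := by
    intro X Y
    let b := finBasis ℝ E
    have h1 := congrArg (chartDeriv φ p) (D.cov_of_normalOn he hn hp hpφ X Y)
    refine h1.trans ?_
    refine (map_sum (chartDeriv φ p) _ _).trans ?_
    have h2 : ∀ᶠ q in 𝓝 p, chartRep φ Y q = ∑ j, frameCoeff he j q (Y q) • b j := by
      filter_upwards [φ.open_source.mem_nhds hpφ] with q hq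
      have h3 := congrArg (chartDeriv φ q) (sum_frameCoeff he hq (Y q))
      refine h3.symm.trans ((map_sum (chartDeriv φ q) _ _).trans ?_)
      refine Finset.sum_congr rfl fun j _ => ((chartDeriv φ q).map_smul _ _).trans ?_
      exact congrArg _ (chartDeriv_chartDerivInv hφ hq (b j))
    have hco : ∀ j, ContMDiffAt 𝓘(ℝ, E) 𝓘(ℝ, ℝ) ∞ (fun q => frameCoeff he j q (Y q)) p :=
      fun j => (contMDiffOn_frameCoeff_field he Y j).contMDiffAt (he.1.mem_nhds hpφ)
    have hd : ∀ j, HasFDerivAt ((fun q => frameCoeff he j q (Y q)) ∘ φ.symm)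
        (fderiv ℝ ((fun q => frameCoeff he j q (Y q)) ∘ φ.symm) (φ p)) (φ p) := fun j =>
      ((contDiffAt_comp_symm hφ (φ.map_source hpφ)
        (by rw [φ.left_inv hpφ]; exact hco j)).differentiableAt (by simp)).hasFDerivAt
    have h4 : along X (fun q => ∑ j, frameCoeff he j q (Y q) • b j) p =
        ∑ j, along X (fun q => frameCoeff he j q (Y q)) p • b j := by
      rw [along_eq_fderiv hφ X hpφ]
      · have h5 := HasFDerivAt.fun_sum fun j (_ : j ∈ Finset.univ) => (hd j).smul_const (b j)
        refine (congrArg (fun T : E →L[ℝ] E => T (chartRep φ X p)) h5.fderiv).trans ?_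
        rw [sum_apply]
        refine Finset.sum_congr rfl fun j _ => ?_
        rw [along_eq_fderiv hφ X hpφ (hco j)]
        rfl
      · exact ContMDiffAt.sum fun j _ => (hco j).smul contMDiffAt_const
    rw [along_congr h2, h4]
    refine Finset.sum_congr rfl fun j _ => ((chartDeriv φ p).map_smul _ _).trans ?_
    exact congrArg _ (chartDeriv_chartDerivInv hφ hpφ (b j))
  rw [torsion_eq_zero_iff]
  refine Function.LeftInverse.injective (chartDerivInv_chartDeriv hφ hpφ) ?_
  refine (map_sub (chartDeriv φ p) _ _).trans ?_
  exact ((congrArg₂ _ (hc X Y) (hc Y X))).trans (chartRep_bracket hφ X Y hpφ).symm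

end Mono

variable [T2Space M] (D : DerivationAlongVF E M)
  {F : Type*} [NormedAddCommGroup F] [NormedSpace ℝ F]
  {N : Type*} [TopologicalSpace N] [ChartedSpace F N] [IsManifold 𝓘(ℝ, F) ∞ N]
  {γ : N → M} {q : N} {O K : Set N}

omit [FiniteDimensional ℝ E] [T2Space M] [IsManifold 𝓘(ℝ, F) ∞ N] in
/-- Fields whose coordinates are tangent to the slice are tangent to the map. -/
theorem tangent_of_slice {φ : OpenPartialHomeomorph M E}
    (hφ : φ ∈ IsManifold.maximalAtlas 𝓘(ℝ, E) ∞ M) {χ : OpenPartialHomeomorph N F}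
    (hχ : χ ∈ IsManifold.maximalAtlas 𝓘(ℝ, F) ∞ N) {L : F →L[ℝ] E} {x₀ : F} {q : N}
    (hq : q ∈ χ.source) (hγφ : γ q ∈ φ.source) (hγ : MDifferentiableAt 𝓘(ℝ, F) 𝓘(ℝ, E) γ q)
    (h : ∀ᶠ q' in 𝓝 q, φ (γ q') = L (χ q' - x₀)) {X : VF E M} {v : F}
    (hX : chartRep φ X (γ q) = L v) : ∃ w, mfderiv 𝓘(ℝ, F) 𝓘(ℝ, E) γ q w = X (γ q) := by
  refine ⟨chartDerivInv χ q v, ?_⟩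
  refine Function.LeftInverse.injective (chartDerivInv_chartDeriv hφ hγφ) ?_
  refine Eq.trans ?_ hX.symm
  have hd : HasFDerivAt (fun x => L (x - x₀)) L (χ q) := by
    have h2 : HasFDerivAt (fun x => x - x₀) (ContinuousLinearMap.id ℝ F) (χ q) :=
      (hasFDerivAt_id _).sub_const _
    exact HasFDerivAt.comp (g := L) (χ q) L.hasFDerivAt h2
  have h1 := vderiv_comp_map hγ ((mdifferentiable_of_mem_maximalAtlas hφ).mdifferentiableAt hγφ)
    (chartDerivInv χ q v)
  refine h1.symm.trans ?_
  have h2 := vderiv_comp_chart hχ hq hd.differentiableAt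
  rw [hd.fderiv] at h2
  have h3 : vderiv (E := F) (φ ∘ γ) q = vderiv ((fun x => L (x - x₀)) ∘ χ) q := vderiv_congr h
  refine (DFunLike.congr_fun (h3.trans h2) _).trans ?_
  exact congrArg L (chartDeriv_chartDerivInv hχ hq v)

/-- Frames and coordinates normal along the part `K`, where `D` is linear, of an immersed
submanifold. If the submanifold is not a curve then `K` has to be all of it. -/
theorem exists_normal_along [FiniteDimensional ℝ F] (hO : IsOpen O) (hq : q ∈ O)
    (hγ : ContMDiffOn 𝓘(ℝ, F) 𝓘(ℝ, E) ∞ γ O)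
    (hinj : Function.Injective (mfderiv 𝓘(ℝ, F) 𝓘(ℝ, E) γ q))
    (hlin : ∀ q' ∈ O ∩ K, D.PointLinear (γ q')) (hOK : 1 < finrank ℝ F → O ⊆ K)
    (hflat : 1 < finrank ℝ F → ∀ q' ∈ O, ∀ X Y Z : VF E M,
      (∀ᶠ q'' in 𝓝 q', ∃ v, mfderiv 𝓘(ℝ, F) 𝓘(ℝ, E) γ q'' v = X (γ q'')) →
      (∀ᶠ q'' in 𝓝 q', ∃ v, mfderiv 𝓘(ℝ, F) 𝓘(ℝ, E) γ q'' v = Y (γ q'')) →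
        D.curvature X Y Z (γ q') = 0) :
    (∃ O' ⊆ O, IsOpen O' ∧ q ∈ O' ∧ D.HasNormalFrame (γ '' (K ∩ O'))) ∧
    (D.TorsionlessOn (γ '' (O ∩ K)) →
      ∃ O' ⊆ O, IsOpen O' ∧ q ∈ O' ∧ D.HasNormalCoords (γ '' (K ∩ O'))) := by
  obtain ⟨φ, hφ, L, π, hπ, ε, hε, hslice⟩ := exists_slice_chart hO hq hγ hinj
  set χ := chartAt F q with hχdef
  have hχ : χ ∈ IsManifold.maximalAtlas 𝓘(ℝ, F) ∞ N := IsManifold.chart_mem_maximalAtlas q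
  have hqχ : q ∈ χ.source := mem_chart_source F q
  have h0t : (0 : E) ∈ φ.target := by
    simpa using (hslice 0 (Metric.mem_ball_self hε)).2.2.1
  obtain ⟨W, Γ, hΓ, h0W⟩ := D.exists_isConnectionForm hφ h0t
  -- neighborhoods of `q` given by coordinate balls
  let P : ℝ → Set N := fun r => χ.source ∩ χ ⁻¹' Metric.ball (χ q) r
  have hPo : ∀ r, IsOpen (P r) := fun r =>
    χ.continuousOn.isOpen_inter_preimage χ.open_source Metric.isOpen_ball
  have hPq : ∀ r > 0, q ∈ P r := fun r hr => ⟨hqχ, Metric.mem_ball_self hr⟩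
  have hPu : ∀ {r q'}, q' ∈ P r → χ q' - χ q ∈ Metric.ball (0 : F) r := fun {r q'} h => by
    rw [mem_ball_zero_iff, ← dist_eq_norm]
    exact h.2
  have hPinv : ∀ {q'}, q' ∈ P ε → q' ∈ O ∧ L (χ q' - χ q) ∈ φ.target ∧
      φ.symm (L (χ q' - χ q)) = γ q' := fun {q'} h => by
    have h1 := hslice _ (hPu h)
    rw [add_sub_cancel, χ.left_inv h.1] at h1
    exact h1.2
  let K' : Set F := {u | χ.symm (χ q + u) ∈ K}
  have hfin : ∀ r > 0, P (min r ε) ⊆ O ∧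
      γ '' (K ∩ P (min r ε)) ⊆ (fun u => φ.symm (L u)) '' (Metric.ball 0 r ∩ K') := by
    intro r hr
    have hsub : ∀ {q'}, q' ∈ P (min r ε) → q' ∈ P ε ∧ q' ∈ P r := fun {q'} h =>
      ⟨⟨h.1, Metric.ball_subset_ball (min_le_right _ _) h.2⟩,
        ⟨h.1, Metric.ball_subset_ball (min_le_left _ _) h.2⟩⟩
    refine ⟨fun q' h => (hPinv (hsub h).1).1, ?_⟩
    rintro _ ⟨q', ⟨hK, h⟩, rfl⟩
    refine ⟨_, ⟨hPu (hsub h).2, ?_⟩, (hPinv (hsub h).1).2.2⟩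
    change χ.symm (χ q + (χ q' - χ q)) ∈ K
    rwa [add_sub_cancel, χ.left_inv h.1]
  let s : Set F := Metric.ball 0 ε ∩ L ⁻¹' W
  have hso : IsOpen s := Metric.isOpen_ball.inter (hΓ.isOpen.preimage L.continuous)
  have hs0 : (0 : F) ∈ s := ⟨Metric.mem_ball_self hε, by simpa using h0W⟩
  have hslin : ∀ u ∈ s ∩ K', D.PointLinear (φ.symm (L u)) := fun u hu => by
    obtain ⟨-, h2, -, h4⟩ := hslice u hu.1.1
    rw [h4]
    exact hlin _ ⟨h2, hu.2⟩
  have key := hΓ.exists_normal_slice hφ h0W hπ (hso.mem_nhds hs0) (fun u hu => hu.2) hslin (by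
    intro u hu v w
    -- If dim F ≤ 1, then v and w are multiples of one vector and the antisymmetric expression
    -- vanishes whatever Γ is, even at points where `D` is not linear. Otherwise `D` is linear on
    -- the whole slice by `hOK`, and flatness comes from the curvature.
    by_cases hF : 1 < finrank ℝ F
    · refine hΓ.flat_of_curvature hφ hu.2
        (eventually_of_mem (hso.mem_nhds hu) fun u hu => hslin u
          ⟨hu, hOK hF (hslice u hu.1).2.1⟩) fun X Y Z hX hY => ?_
      obtain ⟨h1, h2, h3, h4⟩ := hslice u hu.1
      rw [h4] at hX hY ⊢
      set q' := χ.symm (χ q + u) with hq'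
      have hq'P : q' ∈ P ε := ⟨χ.map_target h1, by
        rw [mem_preimage, hq', χ.right_inv h1]
        simpa using hu.1⟩
      have htan : ∀ {X : VF E M} {v : F}, (∀ᶠ p in 𝓝 (γ q'), chartRep φ X p = L v) →
          ∀ᶠ q'' in 𝓝 q', ∃ w, mfderiv 𝓘(ℝ, F) 𝓘(ℝ, E) γ q'' w = X (γ q'') := by
        intro X v hX
        have hcont : ContinuousAt γ q' := (hγ.contMDiffAt (hO.mem_nhds h2)).continuousAt
        filter_upwards [(hPo ε).mem_nhds hq'P, hcont.eventually hX] with q'' h5 h6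
        obtain ⟨h7, h8, h9⟩ := hPinv h5
        refine tangent_of_slice hφ hχ (x₀ := χ q) h5.1 (h9 ▸ φ.map_target h8)
          ((hγ.contMDiffAt (hO.mem_nhds h7)).mdifferentiableAt (by simp)) ?_ h6
        filter_upwards [(hPo ε).mem_nhds h5] with q₃ h10
        obtain ⟨-, h11, h12⟩ := hPinv h10
        rw [← h12, φ.right_inv h11]
      exact hflat hF q' h2 X Y Z (htan hX) (htan hY)
    · obtain ⟨t, ht⟩ := finrank_le_one_iff.1 (not_lt.1 hF)
      obtain ⟨a, rfl⟩ := ht v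
      obtain ⟨b, rfl⟩ := ht w
      simp only [map_smul, smul_apply, smul_mul_smul_comm]
      rw [smul_comm a b, mul_comm b a]
      abel)
  refine ⟨?_, fun ht => ?_⟩
  · obtain ⟨r, hr, h⟩ := key.1
    exact ⟨_, (hfin r hr).1, hPo _, hPq _ (lt_min hr hε), h.mono (hfin r hr).2⟩
  · have hsym : ∀ u ∈ s ∩ K', ∀ v w, Γ (L u) v w = Γ (L u) w v := by
      intro u hu v w
      obtain ⟨-, h2, h3, h4⟩ := hslice u hu.1.1
      have h5 := hΓ.symm_of_torsion hφ (p := φ.symm (L u)) (φ.map_target h3)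
        (by rw [φ.right_inv h3]; exact hu.1.2) (hslin u hu)
        (ht _ (h4 ▸ mem_image_of_mem γ ⟨h2, hu.2⟩)) v w
      rwa [φ.right_inv h3] at h5
    -- Tangential symmetry is required on the whole slice, also off K: in dimension at most 1 it is
    -- automatic, and otherwise K contains the whole slice.
    obtain ⟨r, hr, h⟩ := key.2 (by
      intro u hu v w
      by_cases hF : 1 < finrank ℝ F
      · exact hsym u ⟨hu, hOK hF (hslice u hu.1).2.1⟩ _ _
      · obtain ⟨t, ht⟩ := finrank_le_one_iff.1 (not_lt.1 hF)
        obtain ⟨a, rfl⟩ := ht v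
        obtain ⟨b, rfl⟩ := ht w
        simp only [map_smul, smul_apply]
        rw [smul_comm a b]) hsym
    exact ⟨_, (hfin r hr).1, hPo _, hPq _ (lt_min hr hε), h.mono (hfin r hr).2⟩

end DerivationAlongVF

theorem injective_of_ne_zero {E : Type*} [NormedAddCommGroup E] [NormedSpace ℝ E] {T : ℝ →L[ℝ] E}
    (hT : T ≠ 0) : Function.Injective T := by
  rw [injective_iff_map_eq_zero]
  intro t ht
  by_contra h0
  refine hT ?_
  ext
  have h1 := T.map_smul t⁻¹ t
  rwa [ht, smul_zero, smul_eq_mul, inv_mul_cancel₀ h0] at h1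

/-! ### Points, regular paths, open sets, immersions -/

namespace DerivationAlongVF

variable {E : Type*} [NormedAddCommGroup E] [NormedSpace ℝ E] [FiniteDimensional ℝ E]
  {M : Type*} [TopologicalSpace M] [ChartedSpace E M] [IsManifold 𝓘(ℝ, E) ∞ M] [T2Space M]
  (D : DerivationAlongVF E M)

/-- A point is an immersed manifold of dimension 0, with `PUnit` as model and source, and there is
no curvature condition. -/
theorem hasNormal_singleton_iff (p : M) : (D.HasNormalFrame {p} ↔ D.LinearAt p) ∧
    (D.HasNormalCoords {p} ↔ D.LinearAt p ∧ D.TorsionlessOn {p}) := by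
  have key := fun h : D.LinearAt p => D.exists_normal_along (F := PUnit.{1}) (N := PUnit.{1})
    (γ := fun _ => p) (q := PUnit.unit.{1}) (O := univ) (K := univ) isOpen_univ (mem_univ _)
    contMDiffOn_const (fun _ _ _ => Subsingleton.elim (α := PUnit.{1}) _ _)
    (fun _ _ => D.pointLinear_of_linearAt h) (fun _ => subset_rfl)
    (fun h => absurd h (by simp [finrank_zero_of_subsingleton]))
  refine ⟨⟨fun h => h.linearOn p rfl, fun h => ?_⟩,
    ⟨fun h => ⟨h.hasNormalFrame.linearOn p rfl, h.torsionlessOn⟩, fun h => ?_⟩⟩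
  · obtain ⟨O, -, -, hO, hn⟩ := (key h).1
    exact hn.mono (singleton_subset_iff.2 ⟨_, ⟨mem_univ _, hO⟩, rfl⟩)
  · obtain ⟨O, -, -, hO, hn⟩ := (key h.1).2 (by
      intro q hq
      obtain ⟨-, -, rfl⟩ := hq
      exact h.2 _ rfl)
    exact hn.mono (singleton_subset_iff.2 ⟨_, ⟨mem_univ _, hO⟩, rfl⟩)

/-- The path is extended to an open set and K = J. Since dim ℝ = 1, linearity is needed only on J,
so endpoints of J require no separate treatment. -/
theorem hasNormal_regularPath_iff {J : Set ℝ} {γ : ℝ → M} (hγ : IsRegularPath (E := E) γ J) :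
    ((∀ s ∈ J, ∃ O : Set ℝ, IsOpen O ∧ s ∈ O ∧ D.HasNormalFrame (γ '' (J ∩ O))) ↔
        D.LinearOn (γ '' J)) ∧
      ((∀ s ∈ J, ∃ O : Set ℝ, IsOpen O ∧ s ∈ O ∧ D.HasNormalCoords (γ '' (J ∩ O))) ↔
        D.LinearOn (γ '' J) ∧ D.TorsionlessOn (γ '' J)) := by
  obtain ⟨-, ⟨O, hO, hJO, hsm⟩, hreg⟩ := hγ
  have key := fun (h : D.LinearOn (γ '' J)) (s : ℝ) (hs : s ∈ J) =>
    D.exists_normal_along (F := ℝ) (q := s) (K := J) hO (hJO hs) hsm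
      (injective_of_ne_zero (E := E) (T := mfderiv 𝓘(ℝ, ℝ) 𝓘(ℝ, E) γ s) (hreg s hs))
      (fun t ht => D.pointLinear_of_linearAt (h _ (mem_image_of_mem γ ht.2)))
      (fun h => absurd h (by simp)) (fun h => absurd h (by simp))
  refine ⟨⟨?_, fun h s hs => ?_⟩, ⟨fun h => ⟨?_, ?_⟩, fun h s hs => ?_⟩⟩
  · rintro h _ ⟨s, hs, rfl⟩
    obtain ⟨O, -, hsO, hn⟩ := h s hs
    exact hn.linearOn _ ⟨s, ⟨hs, hsO⟩, rfl⟩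
  · obtain ⟨O', -, hO', hsO', hn⟩ := (key h s hs).1
    exact ⟨O', hO', hsO', hn⟩
  · rintro _ ⟨s, hs, rfl⟩
    obtain ⟨O, -, hsO, hn⟩ := h s hs
    exact hn.hasNormalFrame.linearOn _ ⟨s, ⟨hs, hsO⟩, rfl⟩
  · rintro _ ⟨s, hs, rfl⟩
    obtain ⟨O, -, hsO, hn⟩ := h s hs
    exact hn.torsionlessOn _ ⟨s, ⟨hs, hsO⟩, rfl⟩
  · obtain ⟨O', -, hO', hsO', hn⟩ := (key h.1 s hs).2 fun p hp =>
      h.2 p (image_mono inter_subset_right hp)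
    exact ⟨O', hO', hsO', hn⟩

theorem flatOn_of_hasNormalFrame {V : Set M} (hV : IsOpen V) (h : D.HasNormalFrame V) :
    D.FlatOn V := by
  obtain ⟨V', e, hVV', he, hn⟩ := h
  intro p hp X Y Z
  have htan : ∀ X : VF E M, ∃ v, mfderiv 𝓘(ℝ, E) 𝓘(ℝ, E) (id : M → M) p v = X (id p) := fun X =>
    ⟨X p, by rw [mfderiv_id]; rfl⟩
  exact D.curvature_eq_zero_of_normalOn (γ := (id : M → M)) he hVV' hn mdifferentiableAt_id
    (hV.mem_nhds hp) (htan X) (htan Y) Z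

/-- The case of the identity map of M, to which every vector field is tangent. -/
theorem hasNormal_open_iff {U : Set M} (hU : IsOpen U) :
    ((∀ p ∈ U, ∃ V ⊆ U, IsOpen V ∧ p ∈ V ∧ D.HasNormalFrame V) ↔ D.LinearOn U ∧ D.FlatOn U) ∧
      ((∀ p ∈ U, ∃ V ⊆ U, IsOpen V ∧ p ∈ V ∧ D.HasNormalCoords V) ↔
        D.LinearOn U ∧ D.FlatOn U ∧ D.TorsionlessOn U) := by
  have key := fun (hl : D.LinearOn U) (hf : D.FlatOn U) (p : M) (hp : p ∈ U) =>
    D.exists_normal_along (F := E) (N := M) (γ := id) (q := p) (K := U) hU hp contMDiffOn_id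
      (by rw [mfderiv_id]; exact Function.injective_id)
      (fun q hq => D.pointLinear_of_linearAt (hl q hq.1)) (fun _ => subset_rfl)
      (fun _ q hq X Y Z _ _ => hf q hq X Y Z)
  have hid : ∀ {O : Set M}, O ⊆ U → id '' (U ∩ O) = O := fun {O} h => by
    rw [image_id, inter_eq_self_of_subset_right h]
  refine ⟨⟨fun h => ⟨fun p hp => ?_, fun p hp => ?_⟩, fun h p hp => ?_⟩,
    ⟨fun h => ⟨fun p hp => ?_, fun p hp => ?_, fun p hp => ?_⟩, fun h p hp => ?_⟩⟩
  · obtain ⟨V, -, -, hpV, hn⟩ := h p hp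
    exact hn.linearOn p hpV
  · obtain ⟨V, -, hV, hpV, hn⟩ := h p hp
    exact D.flatOn_of_hasNormalFrame hV hn p hpV
  · obtain ⟨O, hOU, hO, hpO, hn⟩ := (key h.1 h.2 p hp).1
    exact ⟨O, hOU, hO, hpO, hid hOU ▸ hn⟩
  · obtain ⟨V, -, -, hpV, hn⟩ := h p hp
    exact hn.hasNormalFrame.linearOn p hpV
  · obtain ⟨V, -, hV, hpV, hn⟩ := h p hp
    exact D.flatOn_of_hasNormalFrame hV hn.hasNormalFrame p hpV
  · obtain ⟨V, -, -, hpV, hn⟩ := h p hp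
    exact hn.torsionlessOn p hpV
  · obtain ⟨O, hOU, hO, hpO, hn⟩ := (key h.1 h.2.1 p hp).2 fun q hq => h.2.2 q (by simpa using hq)
    exact ⟨O, hOU, hO, hpO, hid hOU ▸ hn⟩

section Immersions

variable {F : Type*} [NormedAddCommGroup F] [NormedSpace ℝ F] [FiniteDimensional ℝ F]
  {N : Type*} [TopologicalSpace N] [ChartedSpace F N] [IsManifold 𝓘(ℝ, F) ∞ N] {γ : N → M}
  (hγ : IsSmoothImmersion (F := F) (E := E) γ)
include hγ

omit [FiniteDimensional ℝ F] [IsManifold 𝓘(ℝ, F) ∞ N] in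
theorem flatAlong_of_hasNormalFrame
    (h : ∀ q : N, ∃ O : Set N, IsOpen O ∧ q ∈ O ∧ D.HasNormalFrame (γ '' O)) :
    D.FlatAlong (F := F) γ := by
  intro q X Y Z hX hY
  obtain ⟨O, hO, hqO, V, e, hV, he, hn⟩ := h q
  refine D.curvature_eq_zero_of_normalOn he hV hn (hγ.1.contMDiffAt.mdifferentiableAt (by simp))
    ?_ hX.self_of_nhds hY.self_of_nhds Z
  filter_upwards [hO.mem_nhds hqO] with q' hq' using mem_image_of_mem γ hq'

theorem hasNormal_immersion_iff :
    ((∀ q : N, ∃ O : Set N, IsOpen O ∧ q ∈ O ∧ D.HasNormalFrame (γ '' O)) ↔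
        D.LinearOn (range γ) ∧ D.FlatAlong (F := F) γ) ∧
      ((∀ q : N, ∃ O : Set N, IsOpen O ∧ q ∈ O ∧ D.HasNormalCoords (γ '' O)) ↔
        D.LinearOn (range γ) ∧ D.FlatAlong (F := F) γ ∧ D.TorsionlessOn (range γ)) := by
  have key := fun (hl : D.LinearOn (range γ)) (hf : D.FlatAlong (F := F) γ) (q : N) =>
    D.exists_normal_along (F := F) (q := q) (O := univ) (K := univ) isOpen_univ (mem_univ q)
      hγ.1.contMDiffOn (hγ.2 q) (fun q _ => D.pointLinear_of_linearAt (hl _ (mem_range_self q)))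
      (fun _ => subset_rfl) (fun _ q _ => hf q)
  simp only [univ_inter] at key
  refine ⟨⟨fun h => ⟨?_, D.flatAlong_of_hasNormalFrame hγ h⟩, fun h q => ?_⟩,
    ⟨fun h => ⟨?_, D.flatAlong_of_hasNormalFrame hγ fun q => ?_, ?_⟩, fun h q => ?_⟩⟩
  · rintro _ ⟨q, rfl⟩
    obtain ⟨O, -, hqO, hn⟩ := h q
    exact hn.linearOn _ (mem_image_of_mem γ hqO)
  · obtain ⟨O, -, hO, hqO, hn⟩ := (key h.1 h.2 q).1
    exact ⟨O, hO, hqO, hn⟩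
  · rintro _ ⟨q, rfl⟩
    obtain ⟨O, -, hqO, hn⟩ := h q
    exact hn.hasNormalFrame.linearOn _ (mem_image_of_mem γ hqO)
  · obtain ⟨O, hO, hqO, hn⟩ := h q
    exact ⟨O, hO, hqO, hn.hasNormalFrame⟩
  · rintro _ ⟨q, rfl⟩
    obtain ⟨O, -, hqO, hn⟩ := h q
    exact hn.torsionlessOn _ (mem_image_of_mem γ hqO)
  · obtain ⟨O, -, hO, hqO, hn⟩ := (key h.1 h.2.1 q).2 fun p hp =>
      h.2.2 p (image_subset_range _ _ hp)
    exact ⟨O, hO, hqO, hn⟩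

end Immersions

/-- For an embedding, neighborhoods in the source and in the ambient space can be exchanged. -/
theorem forall_mem_range_iff_of_isEmbedding {M N : Type*} [TopologicalSpace M]
    [TopologicalSpace N] {γ : N → M} (hγ : IsEmbedding γ) {P : Set M → Prop} :
    (∀ p ∈ range γ, ∃ V : Set M, IsOpen V ∧ p ∈ V ∧ P (range γ ∩ V)) ↔
      ∀ q : N, ∃ O : Set N, IsOpen O ∧ q ∈ O ∧ P (γ '' O) := by
  constructor
  · intro h q
    obtain ⟨V, hV, hqV, hP⟩ := h _ (mem_range_self q)
    refine ⟨γ ⁻¹' V, hV.preimage hγ.continuous, hqV, ?_⟩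
    rwa [image_preimage_eq_range_inter]
  · rintro h _ ⟨q, rfl⟩
    obtain ⟨O, hO, hqO, hP⟩ := h q
    obtain ⟨V, hV, rfl⟩ := hγ.isOpen_iff.1 hO
    refine ⟨V, hV, hqO, ?_⟩
    rwa [← image_preimage_eq_range_inter]

end DerivationAlongVF

/-! ### Linearity of tensor operations over finite sums -/

section TensorAlgebra

variable {V : Type*} [AddCommGroup V] [Module ℝ V]

theorem sum_tensorMul {r s r' s' : ℕ} {ι : Type*} (t : Finset ι) (c : ι → ℝ) (S : ι → Tensor V r s)
    (T : Tensor V r' s') :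
    tensorMul (∑ i ∈ t, c i • S i) T = ∑ i ∈ t, c i • tensorMul (S i) T := by
  ext α v
  simp [tensorMul, Finset.sum_mul, mul_assoc]

theorem tensorMul_sum {r s r' s' : ℕ} {ι : Type*} (t : Finset ι) (c : ι → ℝ) (S : Tensor V r s)
    (T : ι → Tensor V r' s') :
    tensorMul S (∑ i ∈ t, c i • T i) = ∑ i ∈ t, c i • tensorMul S (T i) := by
  ext α v
  simp [tensorMul, Finset.mul_sum, mul_left_comm]

theorem contract_sum [FiniteDimensional ℝ V] {r s : ℕ} {ι : Type*} (t : Finset ι) (c : ι → ℝ)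
    (a : Fin (r + 1)) (b : Fin (s + 1)) (T : ι → Tensor V (r + 1) (s + 1)) :
    contract a b (∑ i ∈ t, c i • T i) = ∑ i ∈ t, c i • contract a b (T i) := by
  ext α v
  simp only [contract, MultilinearMap.coe_mk, sum_apply, smul_apply,
    Finset.smul_sum]
  exact Finset.sum_comm

theorem vecTensor_sum {ι : Type*} (t : Finset ι) (c : ι → ℝ) (v : ι → V) :
    vecTensor (∑ i ∈ t, c i • v i) = ∑ i ∈ t, c i • vecTensor (v i) := by
  let T : V →ₗ[ℝ] Tensor V 1 0 :=
    { toFun := vecTensor, map_add' := vecTensor_add, map_smul' := vecTensor_smul }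
  change T _ = ∑ i ∈ t, c i • T (v i)
  simp

end TensorAlgebra

/-! ### Reduction to linear connections -/

section LinearConnections

variable {E : Type*} [NormedAddCommGroup E] [NormedSpace ℝ E] [FiniteDimensional ℝ E]
  {M : Type*} [TopologicalSpace M] [ChartedSpace E M] [IsManifold 𝓘(ℝ, E) ∞ M] [T2Space M]

omit [FiniteDimensional ℝ E] [T2Space M] in
theorem field_sum_apply {ι : Type*} (t : Finset ι) (X : ι → VF E M) (q : M) :
    (∑ k ∈ t, X k) q = ∑ k ∈ t, X k q := by
  rw [← ContMDiffSection.coeAddHom_apply, map_sum, Finset.sum_apply]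
  rfl

variable (E M) in
/-- A locally finite system of vector fields and covector fields which decomposes the identity of
the tangent bundle. -/
structure DualSystem (ι : Type*) where
  field : ι → VF E M
  coord : ι → CovectorField E M
  supp : M → Finset ι
  mem_supp : ∀ p i, (coord i).1 p ≠ 0 → i ∈ supp p
  locallyFinite : LocallyFinite fun i => {p | (coord i).1 p ≠ 0}
  sum_eq : ∀ (p : M) (v : TangentSpace 𝓘(ℝ, E) p),
    ∑ i ∈ supp p, (coord i).1 p v • field i p = v

/-- For each centre c, take global extensions of the coordinate fields that are exact on a
neighborhood U_c, and the dual coframe multiplied by ρ_c, where (ρ_c) is a partition of unity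
subordinate to (U_c). On the support of ρ_c the sum over k is ρ_c times the identity. -/
theorem exists_dualSystem [SigmaCompactSpace M] : Nonempty (DualSystem E M (M × Idx E)) := by
  have he := fun c : M => isFrame_coordFrame
    (IsManifold.chart_mem_maximalAtlas (I := 𝓘(ℝ, E)) (n := ∞) c)
  choose Z hZ using fun c => DerivationAlongVF.exists_frame_fields (he c) (mem_chart_source E c)
  choose U hUZ hU hcU using fun c => eventually_nhds_iff.1
    ((eventually_all.2 (hZ c)).and ((chartAt E c).open_source.mem_nhds (mem_chart_source E c)))
  obtain ⟨ρ, hρ⟩ := SmoothPartitionOfUnity.exists_isSubordinate 𝓘(ℝ, E) isClosed_univ U hU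
    fun c _ => mem_iUnion.2 ⟨c, hcU c⟩
  have hne : ∀ {c k p}, ρ c p • frameCoeff (he c) k p ≠ 0 → ρ c p ≠ 0 := fun h h0 =>
    h (by rw [h0, zero_smul])
  refine ⟨{
    field := fun i => Z i.1 i.2
    coord := fun i => ⟨fun p => ρ i.1 p • frameCoeff (he i.1) i.2 p, fun X => ?_⟩
    supp := fun p => ρ.finsupport p ×ˢ Finset.univ
    mem_supp := fun p i hi => ?_
    locallyFinite := ?_
    sum_eq := fun p v => ?_ }⟩
  · refine contMDiff_of_tsupport fun x hx => ?_
    have hxU : x ∈ U i.1 := hρ i.1 (closure_mono (fun y hy => ?_) hx)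
    · have h1 := (contMDiffOn_frameCoeff_field (he i.1) X i.2).contMDiffAt
        ((he i.1).1.mem_nhds (hUZ i.1 x hxU).2)
      exact ((ρ i.1).contMDiff.contMDiffAt).mul h1
    · intro h0
      exact hy (by simp [h0])
  · simp only [Finset.mem_product, Finset.mem_univ, and_true]
    exact (ρ.mem_finsupport p).2 (hne hi)
  · intro p
    obtain ⟨t, ht, hf⟩ := ρ.locallyFinite p
    refine ⟨t, ht, (hf.prod (finite_univ (α := Idx E))).subset ?_⟩
    rintro ⟨c, k⟩ ⟨x, hx, hxt⟩
    exact ⟨⟨x, hne hx, hxt⟩, mem_univ _⟩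
  · rw [Finset.sum_product]
    have h1 : ∀ c ∈ ρ.finsupport p,
        ∑ k, (ρ c p • frameCoeff (he c) k p) v • Z c k p = ρ c p • v := by
      intro c hc
      have hpU : p ∈ U c := hρ c (subset_closure ((ρ.mem_finsupport p).1 hc))
      conv_rhs => rw [← sum_frameCoeff (he c) (hUZ c p hpU).2 v, Finset.smul_sum]
      refine Finset.sum_congr rfl fun k _ => ?_
      rw [(hUZ c p hpU).1 k, LinearMap.smul_apply, smul_assoc]
    rw [Finset.sum_congr rfl h1, ← Finset.sum_smul, ρ.sum_finsupport p (mem_univ p), one_smul]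

namespace DualSystem

variable {ι : Type*} (σ : DualSystem E M ι) (D : DerivationAlongVF E M)

/-- The linear combination, with the coefficients of `X`, of the derivations in the directions of
the fields of the system. -/
def derMap (X : VF E M) (r s : ℕ) : TensorField E M r s →ₗ[ℝ] TensorField E M r s where
  toFun T := ⟨fun p => ∑ i ∈ σ.supp p,
      (σ.coord i).1 p (X p) • ((D.der (σ.field i)).toFun r s T).1 p, fun α Y => by
    -- The index set `σ.supp p` varies with p; a `finsum` over all indices makes smoothness a
    -- consequence of local finiteness.
    have h : (fun p => (∑ i ∈ σ.supp p, (σ.coord i).1 p (X p) •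
        ((D.der (σ.field i)).toFun r s T).1 p) (fun i => (α i).1 p) (fun j => Y j p)) =
        fun p => ∑ᶠ i, (σ.coord i).1 p (X p) *
          ((D.der (σ.field i)).toFun r s T).1 p (fun i => (α i).1 p) (fun j => Y j p) := by
      funext p
      rw [finsum_eq_sum_of_support_subset (s := σ.supp p)]
      · simp
      · intro i hi
        exact σ.mem_supp p i fun h0 => hi (by simp [h0])
    rw [h]
    refine contMDiff_finsum (fun i => ((σ.coord i).2 X).mul
      (((D.der (σ.field i)).toFun r s T).2 α Y)) (σ.locallyFinite.subset fun i p hp h0 => hp ?_)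
    simp [h0]⟩
  map_add' S T := by
    ext p : 2
    simp only [map_add, Submodule.coe_add, Pi.add_apply, smul_add, Finset.sum_add_distrib]
  map_smul' c T := by
    ext p : 2
    simp only [map_smul, Submodule.coe_smul, Pi.smul_apply, Finset.smul_sum, RingHom.id_apply,
      smul_comm c]

/-- The linear connection determined by the derivations in the directions of the fields of the
system. -/
def connection : DerivationAlongVF E M where
  der X :=
    { toFun := σ.derMap D X
      leibniz := fun {r s r' s'} S T => by
        ext p : 2
        change ∑ i ∈ σ.supp p, (σ.coord i).1 p (X p) •
          ((D.der (σ.field i)).toFun (r + r') (s + s') (tfMul S T)).1 p =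
          tensorMul (∑ i ∈ σ.supp p, (σ.coord i).1 p (X p) •
            ((D.der (σ.field i)).toFun r s S).1 p) (T.1 p) +
          tensorMul (S.1 p) (∑ i ∈ σ.supp p, (σ.coord i).1 p (X p) •
            ((D.der (σ.field i)).toFun r' s' T).1 p)
        rw [sum_tensorMul, tensorMul_sum, ← Finset.sum_add_distrib]
        refine Finset.sum_congr rfl fun i _ => ?_
        rw [(D.der (σ.field i)).leibniz, ← smul_add]
        rfl
      comm_contract := fun {r s} a b T U h p => by
        change ∑ i ∈ σ.supp p, (σ.coord i).1 p (X p) •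
          ((D.der (σ.field i)).toFun r s U).1 p = contract a b (∑ i ∈ σ.supp p,
            (σ.coord i).1 p (X p) • ((D.der (σ.field i)).toFun (r + 1) (s + 1) T).1 p)
        rw [contract_sum]
        refine Finset.sum_congr rfl fun i _ => ?_
        rw [(D.der (σ.field i)).comm_contract a b T U h p] }
  der_fun X f p := by
    change (∑ i ∈ σ.supp p, (σ.coord i).1 p (X p) •
      ((D.der (σ.field i)).toFun 0 0 f).1 p) ![] ![] = _
    simp only [sum_apply, smul_apply, D.der_fun, dirDeriv]
    -- On functions the derivations D_{Xᵢ} are honest derivatives, which depend on the direction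
    -- linearly, so the decomposition of X(p) recovers X f.
    conv_rhs => rw [← σ.sum_eq p (X p), map_sum]
    exact Finset.sum_congr rfl fun i _ => (map_smul _ _ _).symm

omit [T2Space M] in
theorem act_connection (X Y : VF E M) (p : M) : ((σ.connection D).act X Y).1 p =
    ∑ i ∈ σ.supp p, (σ.coord i).1 p (X p) • (D.act (σ.field i) Y).1 p := rfl

omit [T2Space M] in
theorem isLinearConnection_connection : (σ.connection D).IsLinearConnection := by
  intro f _ X Y Z hZ r s T p
  change ∑ i ∈ σ.supp p, (σ.coord i).1 p (Z p) • ((D.der (σ.field i)).toFun r s T).1 p =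
    f p • (∑ i ∈ σ.supp p, (σ.coord i).1 p (X p) • ((D.der (σ.field i)).toFun r s T).1 p) +
      ∑ i ∈ σ.supp p, (σ.coord i).1 p (Y p) • ((D.der (σ.field i)).toFun r s T).1 p
  rw [Finset.smul_sum, ← Finset.sum_add_distrib]
  refine Finset.sum_congr rfl fun i _ => ?_
  rw [hZ, map_add, map_smul, add_smul, smul_assoc]

/-- Where `D` is linear, D_X Y can be computed from the decomposition X(p) = ∑ αᵢ(X) Xᵢ(p), and the
result is the definition of the connection. -/
theorem agreeOn_connection {S : Set M} (h : D.LinearOn S) : D.AgreeOn (σ.connection D) S := by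
  intro p hp X Y
  obtain ⟨l, hl⟩ := D.pointLinear_iff.1 (D.linearAt_iff.1 (h p hp)) Y
  rw [act_connection, D.act_apply, hl]
  conv_lhs => rw [← σ.sum_eq p (X p), map_sum]
  simp only [map_smul]
  rw [vecTensor_sum]
  refine Finset.sum_congr rfl fun i _ => ?_
  rw [D.act_apply, hl]

end DualSystem

namespace DerivationAlongVF

theorem IsLinearConnection.cov_eq {C : DerivationAlongVF E M} (hC : C.IsLinearConnection)
    {f : M → ℝ} (hf : ContMDiff 𝓘(ℝ, E) 𝓘(ℝ, ℝ) ∞ f) {X Y Z : VF E M}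
    (h : ∀ p, Z p = f p • X p + Y p) (T : VF E M) (p : M) :
    C.cov Z T p = f p • C.cov X T p + C.cov Y T p := by
  refine (C.act_eq_iff Z T p _).1 ((hC f hf X Y Z h 1 0 (vfTensor T) p).trans ?_)
  rw [vecTensor_add, vecTensor_smul, ← C.act_apply, ← C.act_apply]
  rfl

/-- Tensoriality: for a cutoff ρ supported where the fields Z_k are the frame, ρX = ∑ (ρX^k) Z_k
holds on all of M. Linearity over functions then expresses the value at p, where ρ = 1, through the
numbers X^k(p). -/
theorem IsLinearConnection.pointLinear {C : DerivationAlongVF E M} (hC : C.IsLinearConnection)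
    (p : M) : C.PointLinear p := by
  have he := isFrame_coordFrame (IsManifold.chart_mem_maximalAtlas (I := 𝓘(ℝ, E)) (n := ∞) p)
  have hp := mem_chart_source E p
  obtain ⟨Z, hZ⟩ := exists_frame_fields he hp
  rw [pointLinear_iff]
  intro T
  have hzero : C.cov 0 T p = 0 := by
    have := hC.cov_eq (f := fun _ => 1) contMDiff_const (X := 0) (Y := 0) (Z := 0) (by simp) T p
    simpa using this
  have hsmul : ∀ {f : M → ℝ} (hf : ContMDiff 𝓘(ℝ, E) 𝓘(ℝ, ℝ) ∞ f) (X : VF E M),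
      C.cov (smulField f hf X) T p = f p • C.cov X T p := by
    intro f hf X
    have := hC.cov_eq hf (X := X) (Y := 0) (Z := smulField f hf X)
      (fun q => (add_zero (f q • X q)).symm) T p
    rw [this, hzero, add_zero]
  have hadd : ∀ X Y : VF E M, C.cov (X + Y) T p = C.cov X T p + C.cov Y T p := by
    intro X Y
    have := hC.cov_eq (f := fun _ => 1) contMDiff_const (X := X) (Y := Y) (Z := X + Y)
      (by simp) T p
    simpa using this
  have hsum : ∀ (t : Finset (Idx E)) (X : Idx E → VF E M),
      C.cov (∑ k ∈ t, X k) T p = ∑ k ∈ t, C.cov (X k) T p := by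
    intro t X
    induction t using Finset.induction_on with
    | empty => simpa using hzero
    | insert a t ha ih => rw [Finset.sum_insert ha, Finset.sum_insert ha, hadd, ih]
  refine ⟨∑ k, (frameCoeff he k p).smulRight (C.cov (Z k) T p), fun X => ?_⟩
  obtain ⟨V, hV, hVo, hpV⟩ := eventually_nhds_iff.1
    ((eventually_all.2 hZ).and (he.1.mem_nhds hp))
  obtain ⟨ρ, hρ, hρV, hρ1⟩ := exists_smooth_cutoff E (hVo.mem_nhds hpV)
  have hg : ∀ k, ContMDiff 𝓘(ℝ, E) 𝓘(ℝ, ℝ) ∞ fun q => ρ q * frameCoeff he k q (X q) := by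
    intro k
    refine contMDiff_of_tsupport fun x hx => ?_
    have hxV : x ∈ V := hρV (closure_mono (fun y hy => ?_) hx)
    · exact hρ.contMDiffAt.mul ((contMDiffOn_frameCoeff_field he X k).contMDiffAt
        (he.1.mem_nhds (hV x hxV).2))
    · intro h0
      exact hy (by simp [h0])
  have h1 : smulField ρ hρ X = ∑ k, smulField _ (hg k) (Z k) := by
    ext q
    rw [field_sum_apply]
    change ρ q • X q = ∑ k, (ρ q * frameCoeff he k q (X q)) • Z k q
    by_cases hq : q ∈ V
    · conv_lhs => rw [← sum_frameCoeff he (hV q hq).2 (X q), Finset.smul_sum]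
      exact Finset.sum_congr rfl fun k _ => by rw [mul_smul, (hV q hq).1 k]
    · have h0 : ρ q = 0 := by
        by_contra h0
        exact hq (hρV (subset_closure h0))
      simp [h0]
  have h2 := hsmul hρ X
  rw [h1, hsum, hρ1.self_of_nhds, one_smul] at h2
  rw [← h2, LinearMap.sum_apply]
  refine Finset.sum_congr rfl fun k _ => ?_
  rw [hsmul, hρ1.self_of_nhds, one_mul]
  rfl

omit [T2Space M] in
theorem AgreeOn.normalOn_iff {D C : DerivationAlongVF E M} {S : Set M} (h : D.AgreeOn C S)
    (e : Idx E → (p : M) → TangentSpace 𝓘(ℝ, E) p) : D.NormalOn e S ↔ C.NormalOn e S :=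
  forall₃_congr fun p hp X => forall₃_congr fun j Y _ => by rw [h p hp X Y]

theorem AgreeOn.pointLinear {D C : DerivationAlongVF E M} {S : Set M} (h : D.AgreeOn C S) {p : M}
    (hp : p ∈ S) (hC : C.PointLinear p) : D.PointLinear p := by
  intro Y
  obtain ⟨l, hl⟩ := hC Y
  refine ⟨l, fun X => ?_⟩
  rw [← hl]
  exact (D.act_eq_iff X Y p _).1 ((h p hp X Y).trans (C.act_apply X Y p))

theorem linearOn_iff_exists_linearConnection [SigmaCompactSpace M] (D : DerivationAlongVF E M)
    (S : Set M) : D.LinearOn S ↔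
      ∃ C : DerivationAlongVF E M, C.IsLinearConnection ∧ D.AgreeOn C S := by
  constructor
  · intro h
    obtain ⟨σ⟩ := exists_dualSystem (E := E) (M := M)
    exact ⟨σ.connection D, σ.isLinearConnection_connection D, σ.agreeOn_connection D h⟩
  · rintro ⟨C, hC, hDC⟩ p hp
    exact D.linearAt_iff.2 (hDC.pointLinear hp (hC.pointLinear p))

end DerivationAlongVF

end LinearConnections

/-! ### Continuation of rigid local sections along an interval -/

section SectionsOverIntervals

variable {E : Type*} {J : Set ℝ} {P : ℝ → (ℝ → E) → Prop}

/-- That f and g agree at s iff they agree at t is an equivalence relation between s and t. It holds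
locally by rigidity, hence throughout the connected set J ∩ I. -/
theorem eqOn_of_locally_rigid (hJ : J.OrdConnected)
    (hrigid : ∀ s ∈ J, ∀ f g, P s f → P s g → ∀ᶠ t in 𝓝[J] s, (f s = g s ↔ f t = g t))
    {I : Set ℝ} (hI : IsOpen I) (hIc : I.OrdConnected) {f g : ℝ → E}
    (hf : ∀ t ∈ J ∩ I, P t f) (hg : ∀ t ∈ J ∩ I, P t g) {s t : ℝ} (hs : s ∈ J ∩ I)
    (ht : t ∈ J ∩ I) (h : f s = g s) : f t = g t := by
  refine (IsPreconnected.induction₂ (hJ.inter hIc).isPreconnected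
    (fun s t => (f s = g s ↔ f t = g t)) (fun s hs => ?_)
    (fun _ _ _ _ _ _ h1 h2 => h1.trans h2) (fun _ _ _ _ h => h.symm) hs ht).1 h
  rw [nhdsWithin_inter_of_mem' (mem_nhdsWithin_of_mem_nhds (hI.mem_nhds hs.2))]
  exact hrigid s hs.1 f g (hf s hs) (hg s hs)

/-- Local sections over an interval extend to global ones if they exist locally, with arbitrary
values, and are locally determined by their values. -/
theorem exists_section_of_locally_rigid (hJ : J.OrdConnected)
    (hcongr : ∀ s ∈ J, ∀ f g, (∀ᶠ t in 𝓝[J] s, f t = g t) → P s f → P s g)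
    (hrigid : ∀ s ∈ J, ∀ f g, P s f → P s g → ∀ᶠ t in 𝓝[J] s, (f s = g s ↔ f t = g t))
    (hloc : ∀ s ∈ J, ∃ I : Set ℝ, IsOpen I ∧ I.OrdConnected ∧ s ∈ I ∧ ∀ t ∈ J ∩ I, ∀ v,
      ∃ f, f t = v ∧ ∀ t' ∈ J ∩ I, P t' f) {t₀ : ℝ} (ht₀ : t₀ ∈ J) (v : E) :
    ∃ f, f t₀ = v ∧ ∀ t ∈ J, P t f := by
  -- Sharing an interval on which all initial values are attained is a local, symmetric and
  -- transitive relation. Transitivity is the gluing of sections over two intervals with a common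
  -- point y, where `eqOn_of_locally_rigid` gives agreement on the overlap.
  have hpair : ∀ t ∈ J, ∃ I : Set ℝ, IsOpen I ∧ I.OrdConnected ∧ t₀ ∈ I ∧ t ∈ I ∧
      ∀ t ∈ J ∩ I, ∀ v, ∃ f, f t = v ∧ ∀ t' ∈ J ∩ I, P t' f := by
    intro t ht
    refine IsPreconnected.induction₂ hJ.isPreconnected
      (fun x y => ∃ I : Set ℝ, IsOpen I ∧ I.OrdConnected ∧ x ∈ I ∧ y ∈ I ∧
        ∀ t ∈ J ∩ I, ∀ v, ∃ f, f t = v ∧ ∀ t' ∈ J ∩ I, P t' f) ?_ ?_ ?_ ht₀ ht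
    · intro x hx
      obtain ⟨I, hI, hIc, hxI, h⟩ := hloc x hx
      filter_upwards [mem_nhdsWithin_of_mem_nhds (hI.mem_nhds hxI)] with y hy
        using ⟨I, hI, hIc, hxI, hy, h⟩
    · rintro x y z - hy - ⟨I, hI, hIc, hxI, hyI, h⟩ ⟨I', hI', hIc', hyI', hzI', h'⟩
      have hglue : ∀ f g : ℝ → E, f y = g y → (∀ t ∈ J ∩ I, P t f) → (∀ t ∈ J ∩ I', P t g) →
          ∃ k : ℝ → E, (∀ t ∈ J ∩ I, k t = f t) ∧ (∀ t ∈ J ∩ I', k t = g t) ∧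
            ∀ t ∈ J ∩ (I ∪ I'), P t k := by
        classical
        intro f g hfg hf hg
        have heq : ∀ t ∈ J ∩ (I ∩ I'), f t = g t := fun t ht =>
          eqOn_of_locally_rigid hJ hrigid (hI.inter hI') (hIc.inter hIc')
            (fun t ht => hf t ⟨ht.1, ht.2.1⟩) (fun t ht => hg t ⟨ht.1, ht.2.2⟩)
            ⟨hy, hyI, hyI'⟩ ht hfg
        let k : ℝ → E := fun t => if t ∈ I then f t else g t
        have hkf : ∀ t ∈ J ∩ I, k t = f t := fun t ht => if_pos ht.2
        have hkg : ∀ t ∈ J ∩ I', k t = g t := fun t ht => by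
          by_cases htI : t ∈ I
          · rw [hkf t ⟨ht.1, htI⟩, heq t ⟨ht.1, htI, ht.2⟩]
          · exact if_neg htI
        have hnear : ∀ {I : Set ℝ} {f : ℝ → E}, IsOpen I → (∀ t ∈ J ∩ I, k t = f t) →
            ∀ t ∈ J ∩ I, P t f → P t k := fun {I f} hI hk t ht hP => by
          refine hcongr t ht.1 f k ?_ hP
          filter_upwards [self_mem_nhdsWithin, mem_nhdsWithin_of_mem_nhds (hI.mem_nhds ht.2)]
            with t' h1 h2 using (hk t' ⟨h1, h2⟩).symm
        refine ⟨k, hkf, hkg, fun t ht => ?_⟩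
        rcases ht.2 with h1 | h1
        · exact hnear hI hkf t ⟨ht.1, h1⟩ (hf t ⟨ht.1, h1⟩)
        · exact hnear hI' hkg t ⟨ht.1, h1⟩ (hg t ⟨ht.1, h1⟩)
      refine ⟨I ∪ I', hI.union hI', ?_, Or.inl hxI, Or.inr hzI', ?_⟩
      · exact ((hIc.isPreconnected).union y hyI hyI' hIc'.isPreconnected).ordConnected
      · rintro t ⟨htJ, htI | htI⟩ v
        · obtain ⟨f, hfv, hf⟩ := h t ⟨htJ, htI⟩ v
          obtain ⟨g, hgv, hg⟩ := h' y ⟨hy, hyI'⟩ (f y)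
          obtain ⟨k, hk, -, hP⟩ := hglue f g hgv.symm hf hg
          exact ⟨k, (hk t ⟨htJ, htI⟩).trans hfv, hP⟩
        · obtain ⟨g, hgv, hg⟩ := h' t ⟨htJ, htI⟩ v
          obtain ⟨f, hfv, hf⟩ := h y ⟨hy, hyI⟩ (g y)
          obtain ⟨k, -, hk, hP⟩ := hglue f g hfv hf hg
          exact ⟨k, (hk t ⟨htJ, htI⟩).trans hgv, hP⟩
    · rintro x y - - ⟨I, hI, hIc, hxI, hyI, h⟩
      exact ⟨I, hI, hIc, hyI, hxI, h⟩
  have hpt : ∀ t : J, ∃ (I : Set ℝ) (f : ℝ → E), IsOpen I ∧ I.OrdConnected ∧ t₀ ∈ I ∧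
      t.1 ∈ I ∧ f t₀ = v ∧ ∀ t' ∈ J ∩ I, P t' f := by
    rintro ⟨t, ht⟩
    obtain ⟨I, hI, hIc, h0, h1, h⟩ := hpair t ht
    obtain ⟨f, hf, hP⟩ := h t₀ ⟨ht₀, h0⟩ v
    exact ⟨I, f, hI, hIc, h0, h1, hf, hP⟩
  choose I f hI hIc h0 h1 hfv hP using hpt
  classical
  -- The diagonal of the sections f_t. All of them have the value v at t₀, hence they agree wherever
  -- two of their intervals meet J; off J the value is arbitrary.
  let F : ℝ → E := fun t => if ht : t ∈ J then f ⟨t, ht⟩ t else v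
  have hF : ∀ t : J, ∀ t' ∈ J ∩ I t, F t' = f t t' := by
    intro t t' ht'
    have : F t' = f ⟨t', ht'.1⟩ t' := dif_pos ht'.1
    rw [this]
    exact eqOn_of_locally_rigid hJ hrigid ((hI ⟨t', ht'.1⟩).inter (hI t))
      ((hIc ⟨t', ht'.1⟩).inter (hIc t)) (fun x hx => hP ⟨t', ht'.1⟩ x ⟨hx.1, hx.2.1⟩)
      (fun x hx => hP t x ⟨hx.1, hx.2.2⟩) (s := t₀) ⟨ht₀, h0 _, h0 _⟩ ⟨ht'.1, h1 _, ht'.2⟩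
      ((hfv _).trans (hfv _).symm)
  refine ⟨F, (hF ⟨t₀, ht₀⟩ t₀ ⟨ht₀, h0 _⟩).trans (hfv _), fun t ht => ?_⟩
  refine hcongr t ht (f ⟨t, ht⟩) F ?_ (hP ⟨t, ht⟩ t ⟨ht, h1 ⟨t, ht⟩⟩)
  filter_upwards [self_mem_nhdsWithin,
    mem_nhdsWithin_of_mem_nhds ((hI ⟨t, ht⟩).mem_nhds (h1 ⟨t, ht⟩))] with t' h2 h3
    using (hF ⟨t, ht⟩ t' ⟨h2, h3⟩).symm

end SectionsOverIntervals

/-! ### Partitions of unity on open sets and fields that are independent -/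

section PartitionsOfUnity

variable {E : Type*} [NormedAddCommGroup E] [NormedSpace ℝ E] [FiniteDimensional ℝ E]
  {M : Type*} [TopologicalSpace M] [ChartedSpace E M] [IsManifold 𝓘(ℝ, E) ∞ M]

/-- Smooth partitions of unity over open subsets. -/
theorem exists_partition_iUnion [T2Space M] [SigmaCompactSpace M] {ι : Type*} {V : ι → Set M}
    (hV : ∀ i, IsOpen (V i)) : ∃ ρ : ι → M → ℝ,
      (∀ i, ContMDiffOn 𝓘(ℝ, E) 𝓘(ℝ, ℝ) ∞ (ρ i) (⋃ i, V i)) ∧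
      (∀ x ∈ ⋃ i, V i, ∃ t : Finset ι, ∀ᶠ y in 𝓝 x, (∀ i ∉ t, ρ i y = 0) ∧
        ∑ i ∈ t, ρ i y = 1) ∧
      ∀ x ∈ ⋃ i, V i, ∀ i, x ∉ V i → ∀ᶠ y in 𝓝 x, ρ i y = 0 := by
  classical
  have : LocallyCompactSpace M := ChartedSpace.locallyCompactSpace E M
  have : SecondCountableTopology M := ChartedSpace.secondCountable_of_sigmaCompact E M
  -- The partition of unity lives on the union as an open submanifold, which is again σ-compact. Its
  -- extension by zero is claimed to be smooth over the union only.
  let U : TopologicalSpace.Opens M := ⟨⋃ i, V i, isOpen_iUnion hV⟩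
  have : LocallyCompactSpace U := U.2.locallyCompactSpace
  obtain ⟨ρ, hρ⟩ := SmoothPartitionOfUnity.exists_isSubordinate (M := U) 𝓘(ℝ, E) isClosed_univ
    (fun i => (Subtype.val ⁻¹' V i : Set U)) (fun i => (hV i).preimage continuous_subtype_val)
    fun x _ => by
      obtain ⟨i, hi⟩ := mem_iUnion.1 x.2
      exact mem_iUnion.2 ⟨i, hi⟩
  have hnhds : ∀ {x : M} (hx : x ∈ U) {p : M → Prop}, (∀ᶠ y : U in 𝓝 ⟨x, hx⟩, p y) →
      ∀ᶠ y in 𝓝 x, p y := fun {x} hx {p} h => by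
    rw [← U.2.isOpenEmbedding_subtypeVal.map_nhds_eq ⟨x, hx⟩]
    exact h
  let g : ι → M → ℝ := fun i x => if hx : x ∈ U then ρ i ⟨x, hx⟩ else 0
  have hg : ∀ i (x : U), g i x = ρ i x := fun i x => dif_pos x.2
  refine ⟨g, fun i x hx => ?_, fun x hx => ?_, fun x hx i hxi => ?_⟩
  · refine ContMDiffAt.contMDiffWithinAt ?_
    refine (contMDiffAt_subtype_iff (U := U) (x := ⟨x, hx⟩)).1 ?_
    exact (ρ i).contMDiff.contMDiffAt.congr_of_eventuallyEq (Eventually.of_forall (hg i))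
  · obtain ⟨N, hN, hfin⟩ := ρ.locallyFinite ⟨x, hx⟩
    refine ⟨hfin.toFinset, hnhds (x := x) hx ?_⟩
    filter_upwards [hN] with y hy
    have h0 : ∀ i ∉ hfin.toFinset, ρ i y = 0 := fun i hi => by
      by_contra h
      exact hi (hfin.mem_toFinset.2 ⟨y, h, hy⟩)
    refine ⟨fun i hi => (hg i y).trans (h0 i hi), ?_⟩
    rw [Finset.sum_congr rfl fun i _ => hg i y, ← ρ.sum_eq_one (mem_univ y)]
    refine (finsum_eq_sum_of_support_subset _ fun i hi => ?_).symm
    by_contra h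
    exact hi (h0 i h)
  · refine hnhds (x := x) hx ?_
    have h1 : (⟨x, hx⟩ : U) ∉ tsupport (ρ i) := fun h => hxi (hρ i h)
    filter_upwards [(isClosed_tsupport (ρ i)).isOpen_compl.mem_nhds h1] with y hy
    rw [hg]
    exact image_eq_zero_of_notMem_tsupport hy

/-- Smooth vector fields form a frame over the open set of points where they are independent. -/
theorem isFrame_of_linearIndependent {e : Idx E → (p : M) → TangentSpace 𝓘(ℝ, E) p} {U : Set M}
    (hU : IsOpen U) (he : ∀ j, ContMDiffOn 𝓘(ℝ, E) (𝓘(ℝ, E).prod 𝓘(ℝ, E)) ∞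
      (fun q => (⟨q, e j q⟩ : TangentBundle 𝓘(ℝ, E) M)) U) :
    IsFrame e {p | p ∈ U ∧ LinearIndependent ℝ fun j => e j p} := by
  have : CompleteSpace E := FiniteDimensional.complete ℝ E
  refine ⟨isOpen_iff_mem_nhds.2 fun p hp => ?_, fun hp => hp.2, fun {p} hp => ?_,
    fun j => (he j).mono fun p hp => hp.1⟩
  · let φ := chartAt E p
    have hφ : φ ∈ IsManifold.maximalAtlas 𝓘(ℝ, E) ∞ M := IsManifold.chart_mem_maximalAtlas p
    have hpφ : p ∈ φ.source := mem_chart_source E p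
    have h1 : ContinuousAt (fun q => fun j => chartRep φ (e j) q) p :=
      continuousAt_pi.2 fun j =>
        (contMDiffAt_chartRep hφ hpφ ((he j).contMDiffAt (hU.mem_nhds hp.1))).continuousAt
    have h2 : LinearIndependent ℝ fun j => chartRep φ (e j) p :=
      LinearIndependent.map' (M := E) (M' := E) hp.2 (chartDeriv φ p).toLinearMap
        (LinearMap.ker_eq_bot.2 (Function.LeftInverse.injective (chartDerivInv_chartDeriv hφ hpφ)))
    filter_upwards [h1.eventually (isOpen_setOfPred_linearIndependent.mem_nhds h2),
      hU.mem_nhds hp.1] with q h3 h4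
    exact ⟨h4, LinearIndependent.of_comp (M := E) (M' := E) (chartDeriv φ q).toLinearMap h3⟩
  · refine (hp.2.span_eq_top_of_card_eq_finrank' ?_).ge
    exact Fintype.card_fin _

end PartitionsOfUnity

theorem along_sum {E : Type*} [NormedAddCommGroup E] [NormedSpace ℝ E]
    {M : Type*} [TopologicalSpace M] [ChartedSpace E M] [IsManifold 𝓘(ℝ, E) ∞ M]
    {ι : Type} [Fintype ι] (X : VF E M) {f : ι → M → ℝ} {p : M}
    (hf : ∀ i, MDifferentiableAt 𝓘(ℝ, E) 𝓘(ℝ, ℝ) (f i) p) :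
    along X (fun q => ∑ i, f i q) p = ∑ i, along X (f i) p := by
  have h := HasMFDerivAt.sum (t := Finset.univ) fun i _ => (hf i).hasMFDerivAt
  have h1 : (fun q => ∑ i, f i q) = ∑ i, f i := by
    ext q
    rw [Finset.sum_apply]
  have h2 : ∀ (T : ι → E →L[ℝ] ℝ) (v : E), (∑ i, T i) v = ∑ i, T i v := fun T v =>
    sum_apply _ _ _
  rw [along, vderiv, h1, h.mfderiv]
  exact h2 _ _

/-! ### Parallel fields along a path and frames along embedded paths -/

namespace DerivationAlongVF

variable {E : Type*} [NormedAddCommGroup E] [NormedSpace ℝ E] [FiniteDimensional ℝ E]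
  {M : Type*} [TopologicalSpace M] [ChartedSpace E M] [IsManifold 𝓘(ℝ, E) ∞ M] [T2Space M]
  (D : DerivationAlongVF E M) {γ : ℝ → M} {J O : Set ℝ} {s : ℝ}

section NormalOnPath

variable {e : Idx E → (p : M) → TangentSpace 𝓘(ℝ, E) p} {V : Set M} (he : IsFrame e V)
  (hV : γ '' (J ∩ O) ⊆ V) (hn : D.NormalOn e (γ '' (J ∩ O))) (hO : IsOpen O)
  (hγ : ContMDiffOn 𝓘(ℝ, ℝ) 𝓘(ℝ, E) ∞ γ O) (hJ : J.OrdConnected)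

include hV hn hO hγ hJ in
/-- The components of parallel fields in a normal frame are locally constant. -/
theorem frameCoeff_eventually_const (hs : s ∈ J) (hsO : s ∈ O) {Y : VF E M}
    (hY : ∀ᶠ t in 𝓝[J] s, ∀ X : VF E M, D.cov X Y (γ t) = 0) (j : Idx E) :
    ∀ᶠ t in 𝓝[J] s,
      frameCoeff he j (γ t) (Y (γ t)) = frameCoeff he j (γ s) (Y (γ s)) := by
  let g : M → ℝ := fun q => frameCoeff he j q (Y q)
  obtain ⟨ε, hε, hball⟩ := Metric.mem_nhdsWithin_iff.1
    (hY.and (mem_nhdsWithin_of_mem_nhds (hO.mem_nhds hsO)))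
  have hd : ∀ t ∈ Metric.ball s ε ∩ J, HasFDerivWithinAt (g ∘ γ) (0 : ℝ →L[ℝ] ℝ)
      (Metric.ball s ε ∩ J) t := by
    intro t ht
    obtain ⟨hYt, htO⟩ := hball ht
    have htS : γ t ∈ γ '' (J ∩ O) := mem_image_of_mem γ ⟨ht.2, htO⟩
    have h1 := hγ.contMDiffAt (hO.mem_nhds htO)
    have h2 : ContMDiffAt 𝓘(ℝ, E) 𝓘(ℝ, ℝ) ∞ g (γ t) :=
      (contMDiffOn_frameCoeff_field he Y j).contMDiffAt (he.1.mem_nhds (hV htS))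
    have h3 : DifferentiableAt ℝ (g ∘ γ) t :=
      ((h2.comp t h1).contDiffAt).differentiableAt (by simp)
    -- Parallelism is required for every X, in particular for one whose value is the velocity. In a
    -- normal frame it then says that the derivative of the component along the path vanishes.
    obtain ⟨X, hX⟩ := exists_vectorField_apply (γ t)
      (mfderiv 𝓘(ℝ, ℝ) 𝓘(ℝ, E) γ t (1 : ℝ))
    have h4 : along X g (γ t) = 0 := by
      have h5 := D.cov_of_normalOn he hn htS (hV htS) X Y
      rw [hYt X] at h5
      refine congrFun (frame_sum_injective he (hV htS) (d := 0)
        (c := fun j => along X (fun q => frameCoeff he j q (Y q)) (γ t)) ?_) j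
      rw [← h5]
      simp
    have h6 : vderiv (E := ℝ) (g ∘ γ) t (1 : ℝ) = 0 := by
      refine (vderiv_comp_map (h1.mdifferentiableAt (by simp))
        (h2.mdifferentiableAt (by simp)) (1 : ℝ)).trans ?_
      rw [along, hX] at h4
      exact h4
    have h7 : fderiv ℝ (g ∘ γ) t = 0 := by
      ext
      rw [vderiv, mfderiv_eq_fderiv] at h6
      exact h6
    exact (h7 ▸ h3.hasFDerivAt).hasFDerivWithinAt
  filter_upwards [inter_mem_nhdsWithin J (Metric.ball_mem_nhds s hε)] with t ht
  have h := ((convex_ball s ε).inter hJ.convex).norm_image_sub_le_of_norm_hasFDerivWithin_le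
    (C := 0) hd (fun _ _ => norm_zero.le) ⟨Metric.mem_ball_self hε, hs⟩ ⟨ht.2, ht.1⟩
  rw [zero_mul] at h
  exact sub_eq_zero.1 (norm_le_zero_iff.1 h)

end NormalOnPath

/-- `f` is near `s` the restriction to `γ` of a vector field that is parallel at the points
of `γ '' J`. -/
def ParallelAt (γ : ℝ → M) (J : Set ℝ) (s : ℝ) (f : ℝ → E) : Prop :=
  ∃ Y : VF E M, ∀ᶠ t in 𝓝[J] s, f t = Y (γ t) ∧ ∀ X : VF E M, D.cov X Y (γ t) = 0

variable {D} {f g : ℝ → E}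

theorem ParallelAt.congr (hf : D.ParallelAt γ J s f) (h : ∀ᶠ t in 𝓝[J] s, f t = g t) :
    D.ParallelAt γ J s g := by
  obtain ⟨Y, hY⟩ := hf
  refine ⟨Y, ?_⟩
  filter_upwards [hY, h] with t h1 h2 using ⟨h2.symm.trans h1.1, h1.2⟩

theorem ParallelAt.sum {ι : Type*} [Fintype ι] {f : ι → ℝ → E}
    (hf : ∀ i, D.ParallelAt γ J s (f i)) (c : ι → ℝ) :
    D.ParallelAt γ J s (fun t => ∑ i, c i • f i t) := by
  choose Y hY using hf
  refine ⟨∑ i, c i • Y i, ?_⟩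
  filter_upwards [eventually_all.2 hY] with t ht
  refine ⟨?_, fun X => ?_⟩
  · refine Eq.trans ?_ (field_sum_apply Finset.univ (fun i => c i • Y i) (γ t)).symm
    exact Finset.sum_congr rfl fun i _ => congrArg (c i • ·) (ht i).1
  · rw [D.cov_sum]
    refine Finset.sum_eq_zero fun i _ => ?_
    rw [D.cov_const_smul]
    exact (congrArg (c i • ·) ((ht i).2 X)).trans (smul_zero _)

theorem ParallelAt.sub (hf : D.ParallelAt γ J s f) (hg : D.ParallelAt γ J s g) :
    D.ParallelAt γ J s (fun t => f t - g t) := by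
  refine (ParallelAt.sum (f := ![f, g]) (Fin.forall_fin_two.2 ⟨hf, hg⟩) ![1, -1]).congr
    (Eventually.of_forall fun t => ?_)
  simp [sub_eq_add_neg]

section NormalOnPath

variable {e : Idx E → (p : M) → TangentSpace 𝓘(ℝ, E) p} {V : Set M} (he : IsFrame e V)
  (hV : γ '' (J ∩ O) ⊆ V) (hn : D.NormalOn e (γ '' (J ∩ O))) (hO : IsOpen O)
  (hγ : ContMDiffOn 𝓘(ℝ, ℝ) 𝓘(ℝ, E) ∞ γ O) (hJ : J.OrdConnected)

-- The components in the normal frame are locally constant, so they all vanish at s iff they all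
-- vanish at t. Applied to differences, this is the rigidity of parallel fields.
include he hV hn hO hγ hJ in
theorem ParallelAt.eventually_eq_zero_iff (hs : s ∈ J) (hsO : s ∈ O)
    (hf : D.ParallelAt γ J s f) : ∀ᶠ t in 𝓝[J] s, (f s = 0 ↔ f t = 0) := by
  obtain ⟨Y, hY⟩ := hf
  have h0 : ∀ t ∈ J ∩ O, f t = Y (γ t) →
      (f t = 0 ↔ ∀ j, frameCoeff he j (γ t) (Y (γ t)) = 0) := by
    intro t ht hft
    rw [hft]
    refine ⟨fun h j => (congrArg (frameCoeff he j (γ t)) h).trans (map_zero _), fun h => ?_⟩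
    refine (sum_frameCoeff he (hV (mem_image_of_mem γ ht)) (Y (γ t))).symm.trans ?_
    exact Finset.sum_eq_zero fun j _ => by rw [h j, zero_smul]
  have hc := eventually_all.2
    (D.frameCoeff_eventually_const he hV hn hO hγ hJ hs hsO (hY.mono fun t ht => ht.2))
  filter_upwards [hY, hc, self_mem_nhdsWithin, mem_nhdsWithin_of_mem_nhds (hO.mem_nhds hsO)]
    with t h1 h2 h3 h4
  rw [h0 s ⟨hs, hsO⟩ (hY.self_of_nhdsWithin hs).1, h0 t ⟨h3, h4⟩ h1.1]
  exact forall_congr' fun j => by rw [h2 j]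

-- Linear combinations of the normal frame with constant coefficients are parallel, and they attain
-- every value at t.
include he hV hn hO in
theorem exists_parallelAt (v : E) {t : ℝ} (ht : t ∈ J ∩ O)
    (hγ : ContinuousOn γ O) : ∃ f : ℝ → E, f t = v ∧ ∀ t' ∈ J ∩ O, D.ParallelAt γ J t' f := by
  let a : Idx E → ℝ := fun j => frameCoeff he j (γ t) v
  let f : Idx E → ℝ → E := fun j t' => e j (γ t')
  refine ⟨fun t' => ∑ j, a j • f j t', sum_frameCoeff he (hV (mem_image_of_mem γ ht)) v,
    fun t' ht' => ParallelAt.sum (fun j => ?_) a⟩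
  obtain ⟨Z, hZ⟩ := exists_frame_fields he (hV (mem_image_of_mem γ ht'))
  have hc := (hγ.continuousAt (hO.mem_nhds ht'.2)).eventually (eventually_eventually_nhds.2 (hZ j))
  refine ⟨Z j, ?_⟩
  filter_upwards [mem_nhdsWithin_of_mem_nhds hc, self_mem_nhdsWithin,
    mem_nhdsWithin_of_mem_nhds (hO.mem_nhds ht'.2)] with x h1 h2 h3
  exact ⟨h1.self_of_nhds.symm, fun X =>
    D.normalOn_iff.1 hn _ (mem_image_of_mem γ ⟨h2, h3⟩) X j (Z j) h1⟩

end NormalOnPath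

/-- Parallel frames along a path on which the derivation is linear. -/
theorem LinearOn.exists_parallel_frame (hl : D.LinearOn (γ '' J))
    (hγ : IsRegularPath (E := E) γ J) {t₀ : ℝ} (ht₀ : t₀ ∈ J) :
    ∃ f : Idx E → ℝ → E, (∀ j, ∀ t ∈ J, D.ParallelAt γ J t (f j)) ∧
      ∀ t ∈ J, LinearIndependent ℝ fun j => f j t := by
  have hloc : ∀ s ∈ J, ∃ (O : Set ℝ) (e : Idx E → (p : M) → TangentSpace 𝓘(ℝ, E) p) (V : Set M),
      IsOpen O ∧ O.OrdConnected ∧ s ∈ O ∧ ContMDiffOn 𝓘(ℝ, ℝ) 𝓘(ℝ, E) ∞ γ O ∧ IsFrame e V ∧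
        γ '' (J ∩ O) ⊆ V ∧ D.NormalOn e (γ '' (J ∩ O)) := by
    intro s hs
    obtain ⟨O, hO, hsO, V, e, hV, he, hn⟩ := (D.hasNormal_regularPath_iff hγ).1.2 hl s hs
    obtain ⟨-, ⟨O', hO', hJO', hsm⟩, -⟩ := hγ
    obtain ⟨ε, hε, hball⟩ := Metric.isOpen_iff.1 (hO.inter hO') s ⟨hsO, hJO' hs⟩
    have h1 : γ '' (J ∩ Metric.ball s ε) ⊆ γ '' (J ∩ O) :=
      image_mono (inter_subset_inter_right J fun t ht => (hball ht).1)
    exact ⟨Metric.ball s ε, e, V, Metric.isOpen_ball, (convex_ball s ε).ordConnected,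
      Metric.mem_ball_self hε, hsm.mono fun t ht => (hball ht).2, he, h1.trans hV, hn.mono h1⟩
  have hrigid : ∀ s ∈ J, ∀ f g, D.ParallelAt γ J s f → D.ParallelAt γ J s g →
      ∀ᶠ t in 𝓝[J] s, (f s = g s ↔ f t = g t) := by
    intro s hs f g hf hg
    obtain ⟨O, e, V, hO, -, hsO, hsm, he, hV, hn⟩ := hloc s hs
    filter_upwards [(hf.sub hg).eventually_eq_zero_iff he hV hn hO hsm hγ.1 hs hsO] with t ht
    rwa [sub_eq_zero, sub_eq_zero] at ht
  have hex := exists_section_of_locally_rigid (P := D.ParallelAt γ J) hγ.1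
    (fun s _ f g h hf => hf.congr h) hrigid (fun s hs => by
      obtain ⟨O, e, V, hO, hOc, hsO, hsm, he, hV, hn⟩ := hloc s hs
      exact ⟨O, hO, hOc, hsO, fun t ht v => exists_parallelAt he hV hn hO v ht hsm.continuousOn⟩)
    ht₀
  choose f hf₀ hf using fun j => hex (finBasis ℝ E j)
  refine ⟨f, hf, fun t ht => Fintype.linearIndependent_iff.2 fun c hc => ?_⟩
  refine Fintype.linearIndependent_iff.1 (finBasis ℝ E).linearIndependent c ?_
  -- A linear relation at t says that a parallel combination agrees with zero there. By rigidity it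
  -- does so at t₀ too, where the fields form a basis.
  have h := eqOn_of_locally_rigid hγ.1 hrigid isOpen_univ ordConnected_univ
    (f := fun t => ∑ j, c j • f j t) (g := fun t => ∑ j, (0 : Idx E → ℝ) j • f j t)
    (fun t ht => ParallelAt.sum (fun j => hf j t ht.1) c)
    (fun t ht => ParallelAt.sum (fun j => hf j t ht.1) 0) (s := t) (t := t₀)
    ⟨ht, mem_univ _⟩ ⟨ht₀, mem_univ _⟩ (hc.trans (by simp))
  simpa [hf₀] using h

/-- The parallel frame f along the path is locally the restriction of fields Y_s, which are averaged
with a partition of unity. On the path D_X of the average is ∑ X(ρ_s) f_j, as all Y_s with ρ_s ≠ 0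
equal f_j there and are parallel, and this is zero because ∑ X(ρ_s) = 0. -/
theorem hasNormalFrame_embeddedPath_iff [SigmaCompactSpace M] (D : DerivationAlongVF E M)
    (hγ : IsRegularPath (E := E) γ J) (hemb : IsEmbedding (J.domRestrict γ)) :
    D.HasNormalFrame (γ '' J) ↔ D.LinearOn (γ '' J) := by
  refine ⟨fun h => h.linearOn, fun hl => ?_⟩
  rcases J.eq_empty_or_nonempty with rfl | ⟨t₀, ht₀⟩
  -- With J empty there is no initial parameter; anything is a frame over the empty set.
  · refine ⟨∅, 0, by simp, ⟨isOpen_empty, fun h => h.elim, fun h => h.elim, fun j => ?_⟩, ?_⟩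
    · exact fun p hp => hp.elim
    · rw [image_empty]
      exact fun p hp => hp.elim
  obtain ⟨f, hf, hind⟩ := hl.exists_parallel_frame hγ ht₀
  choose Y hY using fun (s : J) j => hf j s s.2
  -- The embedding is used here: a neighborhood of s in J is cut out by an open set of M, so no
  -- remote part of the path enters V, where Y_s would not extend f.
  have hYV : ∀ s : J, ∃ V : Set M, IsOpen V ∧ γ s ∈ V ∧ ∀ t ∈ J, γ t ∈ V → ∀ j,
      f j t = Y s j (γ t) ∧ ∀ X : VF E M, D.cov X (Y s j) (γ t) = 0 := by
    intro s
    have h1 := (eventually_nhds_subtype_iff J s _).2 (eventually_all.2 (hY s))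
    rw [hemb.nhds_eq_comap, eventually_comap] at h1
    obtain ⟨V, hV, hVo, hsV⟩ := eventually_nhds_iff.1 h1
    exact ⟨V, hVo, hsV, fun t ht htV => hV _ htV ⟨t, ht⟩ rfl⟩
  choose V hVo hsV hV using hYV
  obtain ⟨ρ, hρ, hsum, hzero⟩ := exists_partition_iUnion (E := E) hVo
  have hU : IsOpen (⋃ s, V s) := isOpen_iUnion hVo
  have hJU : ∀ t ∈ J, γ t ∈ ⋃ s, V s := fun t ht => mem_iUnion.2 ⟨⟨t, ht⟩, hsV ⟨t, ht⟩⟩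
  let e : Idx E → (p : M) → TangentSpace 𝓘(ℝ, E) p := fun j p => ∑ᶠ s, ρ s p • Y s j p
  have hloc : ∀ p ∈ ⋃ s, V s, ∃ t : Finset J, ∀ᶠ q in 𝓝 p,
      (∀ j, e j q = ∑ s : t, ρ s q • Y s j q) ∧ ∑ s : t, ρ s q = 1 := by
    intro p hp
    obtain ⟨t, ht⟩ := hsum p hp
    refine ⟨t, ?_⟩
    filter_upwards [ht] with q hq
    refine ⟨fun j => ?_, (Finset.sum_coe_sort t fun s => ρ s q).trans hq.2⟩
    refine Eq.trans ?_ (Finset.sum_coe_sort t fun s => ρ s q • Y s j q).symm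
    refine finsum_eq_sum_of_support_subset _ fun s hs => ?_
    by_contra h
    exact hs ((congrArg (· • Y s j q) (hq.1 s h)).trans (zero_smul _ _))
  have hsm : ∀ j, ContMDiffOn 𝓘(ℝ, E) (𝓘(ℝ, E).prod 𝓘(ℝ, E)) ∞
      (fun q => (⟨q, e j q⟩ : TangentBundle 𝓘(ℝ, E) M)) (⋃ s, V s) := by
    intro j p hp
    refine ContMDiffAt.contMDiffWithinAt ?_
    obtain ⟨t, ht⟩ := hloc p hp
    have h1 : ContMDiffAt 𝓘(ℝ, E) (𝓘(ℝ, E).prod 𝓘(ℝ, E)) ∞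
        (fun q => (⟨q, ∑ s : t, ρ s q • Y s j q⟩ : TangentBundle 𝓘(ℝ, E) M)) p :=
      ContMDiffAt.sum_section fun s _ =>
        ((hρ s).contMDiffAt (hU.mem_nhds hp)).smul_section (Y s j).contMDiff.contMDiffAt
    refine h1.congr_of_eventuallyEq ?_
    filter_upwards [ht] with q hq
    rw [hq.1 j]
  -- Off V_s the field Y_s is unrelated to f, but there ρ_s vanishes near the point, so both its
  -- value and its derivative drop out.
  have hval : ∀ x ∈ J, ∀ j (s : J), ρ s (γ x) • (Y s j (γ x) : E) = ρ s (γ x) • f j x := by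
    intro x hx j s
    by_cases h : γ x ∈ V s
    · rw [(hV s x hx h j).1]; rfl
    · rw [(hzero _ (hJU x hx) s h).self_of_nhds, zero_smul, zero_smul]; rfl
  have hef : ∀ x ∈ J, ∀ j, e j (γ x) = f j x := by
    intro x hx j
    obtain ⟨t, ht⟩ := hloc _ (hJU x hx)
    refine (ht.self_of_nhds.1 j).trans ?_
    refine (Finset.sum_congr rfl fun (s : t) _ => hval x hx j s).trans ?_
    exact (Finset.sum_smul (M := E)).symm.trans (by rw [ht.self_of_nhds.2, one_smul])
  refine ⟨_, e, ?_, isFrame_of_linearIndependent hU hsm, ?_⟩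
  · rintro _ ⟨x, hx, rfl⟩
    refine ⟨hJU x hx, ?_⟩
    have : (fun j => e j (γ x)) = fun j => f j x := funext fun j => hef x hx j
    rw [this]
    exact hind x hx
  · rw [normalOn_iff]
    rintro _ ⟨x, hx, rfl⟩ X j Z hZ
    obtain ⟨t, ht⟩ := hloc _ (hJU x hx)
    have h1 := D.cov_expand X Z (fun s : t => Y s j) (fun s => ρ s) hU (hJU x hx)
      (fun s => hρ s) (by
        filter_upwards [hZ, ht] with q h1 h2
        rw [h1, h2.1 j])
    have h2 : ∀ s : J, along X (ρ s) (γ x) • (Y s j (γ x) : E) + ρ s (γ x) • D.cov X (Y s j) (γ x)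
        = along X (ρ s) (γ x) • f j x := by
      intro s
      by_cases h : γ x ∈ V s
      · rw [(hV s x hx h j).1, (hV s x hx h j).2 X, smul_zero, add_zero]; rfl
      · rw [along_eq_zero_of_eventually_const (hzero _ (hJU x hx) s h),
          (hzero _ (hJU x hx) s h).self_of_nhds, zero_smul, zero_smul, zero_smul, add_zero]; rfl
    refine h1.trans ((Finset.sum_congr rfl fun (s : t) _ => h2 s).trans ?_)
    have h3 : ∑ s : t, along X (ρ s) (γ x) = 0 := by
      rw [← along_sum X fun s : t => ((hρ s).contMDiffAt
        (hU.mem_nhds (hJU x hx))).mdifferentiableAt (by simp)]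
      exact along_eq_zero_of_eventually_const (ht.mono fun q hq => hq.2)
    exact (Finset.sum_smul (M := E)).symm.trans (by rw [h3, zero_smul]; rfl)

end DerivationAlongVF

end NormalFrames

end

/-! ### The theorem -/

open NormalFrames in
theorem mainTheorem5
    {E : Type*} [NormedAddCommGroup E] [NormedSpace ℝ E] [FiniteDimensional ℝ E]
    {M : Type*} [TopologicalSpace M] [ChartedSpace E M] [IsManifold 𝓘(ℝ, E) ∞ M]
    [T2Space M] [SigmaCompactSpace M]
    (D : DerivationAlongVF E M) :
    -- Normal frames exist only if `D` is linear (and then it is linear in every frame).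
    (∀ (S V : Set M) (e : Idx E → (p : M) → TangentSpace 𝓘(ℝ, E) p),
      S ⊆ V → IsFrame e V → D.NormalOn e S →
        D.LinearOn S ∧
          ∀ p ∈ S, ∀ (V' : Set M) (e' : Idx E → (p : M) → TangentSpace 𝓘(ℝ, E) p),
            p ∈ V' → IsFrame e' V' → D.LinearInFrameAt e' p) ∧
    -- Equations of the transition to normal frames.
    (∀ (S V : Set M) (e e' : Idx E → (p : M) → TangentSpace 𝓘(ℝ, E) p)
      (A : M → Matrix (Idx E) (Idx E) ℝ),
      S ⊆ V → IsFrame e V → IsFrame e' V →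
      (∀ p ∈ V, ∀ j, e' j p = ∑ i, A p i j • e i p) →
        (D.NormalOn e' S ↔
          ∀ p ∈ S, ∀ (X : VF E M) (W : Matrix (Idx E) (Idx E) ℝ), D.HasComponents e X p W →
            ∀ i j, dirDeriv X (fun q => A q i j) p + (W * A p) i j = 0) ∧
        (D.NormalOn e S →
          (D.NormalOn e' S ↔
            ∀ p ∈ S, ∀ i j, mfderiv 𝓘(ℝ, E) 𝓘(ℝ, ℝ) (fun q => A q i j) p = 0))) ∧
    -- Reduction to linear connections.
    (∀ S : Set M,
      (D.LinearOn S ↔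
        ∃ C : DerivationAlongVF E M, C.IsLinearConnection ∧ D.AgreeOn C S) ∧
      ∀ C : DerivationAlongVF E M, C.IsLinearConnection → D.AgreeOn C S →
        ∀ S' ⊆ S, ∀ (V : Set M) (e : Idx E → (p : M) → TangentSpace 𝓘(ℝ, E) p),
          S' ⊆ V → IsFrame e V → (D.NormalOn e S' ↔ C.NormalOn e S')) ∧
    -- At a single point.
    (∀ p : M,
      (D.HasNormalFrame {p} ↔ D.LinearAt p) ∧
      (D.HasNormalCoords {p} ↔ D.LinearAt p ∧ D.TorsionlessOn {p})) ∧
    -- Along a path: locally along every regular path, and along the whole of an embedded one.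
    (∀ (J : Set ℝ) (γ : ℝ → M), IsRegularPath (E := E) γ J →
      ((∀ s ∈ J, ∃ O : Set ℝ, IsOpen O ∧ s ∈ O ∧ D.HasNormalFrame (γ '' (J ∩ O))) ↔
        D.LinearOn (γ '' J)) ∧
      ((∀ s ∈ J, ∃ O : Set ℝ, IsOpen O ∧ s ∈ O ∧ D.HasNormalCoords (γ '' (J ∩ O))) ↔
        D.LinearOn (γ '' J) ∧ D.TorsionlessOn (γ '' J)) ∧
      (IsEmbedding (J.domRestrict γ) → (D.HasNormalFrame (γ '' J) ↔ D.LinearOn (γ '' J)))) ∧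
    -- On neighborhoods.
    (∀ U : Set M, IsOpen U →
      ((∀ p ∈ U, ∃ V ⊆ U, IsOpen V ∧ p ∈ V ∧ D.HasNormalFrame V) ↔
        D.LinearOn U ∧ D.FlatOn U) ∧
      ((∀ p ∈ U, ∃ V ⊆ U, IsOpen V ∧ p ∈ V ∧ D.HasNormalCoords V) ↔
        D.LinearOn U ∧ D.FlatOn U ∧ D.TorsionlessOn U)) ∧
    -- On (embedded) submanifolds, and along mappings (immersions, which are locally injective).
    (∀ {F : Type*} [NormedAddCommGroup F] [NormedSpace ℝ F] [FiniteDimensional ℝ F]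
      {N : Type*} [TopologicalSpace N] [ChartedSpace F N] [IsManifold 𝓘(ℝ, F) ∞ N]
      (γ : N → M), IsSmoothImmersion (F := F) (E := E) γ →
      (IsEmbedding γ →
        ((∀ p ∈ range γ, ∃ V : Set M, IsOpen V ∧ p ∈ V ∧ D.HasNormalFrame (range γ ∩ V)) ↔
          D.LinearOn (range γ) ∧ D.FlatAlong (F := F) γ) ∧
        ((∀ p ∈ range γ, ∃ V : Set M, IsOpen V ∧ p ∈ V ∧ D.HasNormalCoords (range γ ∩ V)) ↔
          D.LinearOn (range γ) ∧ D.FlatAlong (F := F) γ ∧ D.TorsionlessOn (range γ))) ∧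
      ((∀ q : N, ∃ O : Set N, IsOpen O ∧ q ∈ O ∧ D.HasNormalFrame (γ '' O)) ↔
        D.LinearOn (range γ) ∧ D.FlatAlong (F := F) γ) ∧
      ((∀ q : N, ∃ O : Set N, IsOpen O ∧ q ∈ O ∧ D.HasNormalCoords (γ '' O)) ↔
        D.LinearOn (range γ) ∧ D.FlatAlong (F := F) γ ∧ D.TorsionlessOn (range γ))) := by
  refine ⟨fun S V e hSV he hn => ⟨fun p hp => ⟨V, e, hSV hp, he, D.linearInFrameAt_of_normalOn hn hp⟩,
      fun p hp V' e' hp' he' =>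
        (D.linearInFrameAt_iff he' hp').2 (D.pointLinear_of_normalOn he hSV hn hp)⟩,
    fun S V e e' A hSV he he' hA => ⟨D.normalOn_transition_iff he he' hA hSV,
      D.normalOn_transition_iff_of_normalOn he he' hA hSV⟩, ?_, D.hasNormal_singleton_iff,
    fun J γ hγ => ⟨(D.hasNormal_regularPath_iff hγ).1, (D.hasNormal_regularPath_iff hγ).2, ?_⟩,
    fun U hU => D.hasNormal_open_iff hU, fun γ hγ => ?_⟩
  · exact fun S => ⟨D.linearOn_iff_exists_linearConnection S, fun C _ hDC S' hS' _ e _ _ =>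
      DerivationAlongVF.AgreeOn.normalOn_iff (fun p hp => hDC p (hS' hp)) e⟩
  · exact D.hasNormalFrame_embeddedPath_iff hγ
  · obtain ⟨h1, h2⟩ := D.hasNormal_immersion_iff hγ
    refine ⟨fun he => ?_, h1, h2⟩
    rw [DerivationAlongVF.forall_mem_range_iff_of_isEmbedding he,
      DerivationAlongVF.forall_mem_range_iff_of_isEmbedding he]
    exact ⟨h1, h2⟩
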